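/- Setting. Let $\mathcal X$ be a metric space (for instance a Riemannian manifold with its distance), $\mu$ a Borel probability measure, $f:\mathcal X\to\mathcal X$ measurable and $\mu$-preserving, and $\varphi:\mathcal X\to\mathbb R\cup\{\pm\infty\}$ measurable; put $X_j=\varphi\circ f^j$ and $U(u)=\{X_0>u\}$. Let $\zeta\in\mathcal X$, $N\ge 1$, $m_1<\dots<m_N$ in $\mathbb N_0$, $\xi_i=f^{m_i}(\zeta)$, $q=m_N-m_1$. Assume that no $\xi_i$ is a periodic point of $f$, that $f$ is continuous at every point of the orbit of $\zeta$ and in a neighbourhood of $f^s(\zeta)$ for each $m_1\le s<m_N$, that $\varphi$ has a global maximum $u_F\in(-\infty,+\infty]$ attained exactly at $\xi_1,\dots,\xi_N$, and that for $u<u_F$ close to $u_F$ one has $U(u)=\bigcup_{i=1}^N B_{\varepsilon_i(u)}(\xi_i)$ with $0<\varepsilon_i(u)\to0$ as $u\to u_F$. Let $(u_n)$ be real levels with $u_n\to u_F$, $u_n<u_F$ eventually, and $n\mu(U(u_n))\to\tau$ for some $\tau>0$. Write $U_n=U(u_n)$ and $U_n(\xi_i)=B_{\varepsilon_i(u_n)}(\xi_i)$.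 Define $U_n^{(0)}=U_n$, $A_{q,n}^{(\kappa)}=U_n^{(\kappa)}\cap\bigcap_{s=1}^{q}f^{-s}\big((U_n^{(\kappa)})^c\big)$ and $U_n^{(\kappa+1)}=U_n^{(\kappa)}\setminus A_{q,n}^{(\kappa)}$. Assumption A. There are a Banach space $\mathcal C_1$ of real-valued measurable functions and a summable sequence $(\rho_n)$ with $$\Big|\int g\cdot(\psi\circ f^n)\,d\mu-\int g\,d\mu\int\psi\,d\mu\Big|\le\|g\|_{\mathcal C_1}\|\psi\|_{L^1(\mu)}\,\rho_n\qquad(g\in\mathcal C_1,\ \psi\in L^1(\mu),\ n\ge1)$$ (the integrals on the left existing), and a constant $K>0$ such that, for all large $n$ and all $\kappa\ge0$, $\mathbf 1_{A_{q,n}^{(\kappa)}}$ agrees $\mu$-a.e. with an element of $\mathcal C_1$ of norm at most $K$. Condition (R3). For all large $n$ and all $1\le i<j\le N$: either $U_n(\xi_i)\subset f^{-(m_j-m_i)}(U_n(\xi_j))$ or $f^{-(m_j-m_i)}(U_n(\xi_j))\cap\partial U_n(\xi_i)=\emptyset$; moreover $f^{-(m_j-m_i)}(U_n(\xi_j))\cap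 U_n(\xi_i)$ is connected. Indices (depending on $n$). Put $j_{i,0}=i$ for $1\le i\le N$. Given $0\le k<N$ and $j_{\ell,k}$ for $1\le\ell\le N-k$, let $P_{i,k}=\bigcup_{\ell=i+1}^{N-k}f^{-(m_{j_{\ell,k}}-m_i)}(U_n(\xi_{j_{\ell,k}}))$ and let $I_{k+1}$ be the set of $i\in\{1,\dots,N-k-1\}$ with $P_{i,k}\cap\partial U_n(\xi_i)=\emptyset$. For $1\le i\le N-k-1$: if $i\in I_{k+1}$, let $j_{i,k+1}$ be one of the indices $j_{\ell,k}$, $i<\ell\le N-k$, such that $P_{i,k}\cap U_n(\xi_i)=f^{-(m_{j_{i,k+1}}-m_i)}(U_n(\xi_{j_{i,k+1}}))\cap U_n(\xi_i)$; otherwise let $j_{i,k+1}=i$. Statement. Under these assumptions the following holds. (1) For all sufficiently large $n$, such indices $j_{i,k}$ exist, and for every such choice and every $0\le k<N$, $$\mu(A^{(k)}_{q,n})=\mu\big(f^{-(m_{j_{N-k,k}}-m_{N-k})}(U_n(\xi_{j_{N-k,k}}))\cap U_n(\xi_{N-k})\big)$$ $$+\sum_{i\in I_{k+1}}\Big[\mu\big(f^{-(m_{j_{i,k}}-m_i)}(U_n(\xi_{j_{i,k}}))\cap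 U_n(\xi_i)\big)-\mu\big(f^{-(m_{j_{i,k+1}}-m_i)}(U_n(\xi_{j_{i,k+1}}))\cap U_n(\xi_i)\big)\Big];$$ moreover $\mu(A^{(k)}_{q,n})=0$ for all $k\ge N$. (2) Suppose that for every $k\ge1$ the limit $$\pi(k)=\lim_{n\to\infty}\frac{\mu(A^{(k-1)}_{q,n})-\mu(A^{(k)}_{q,n})}{\mu(A^{(0)}_{q,n})}$$ exists. Then $(\pi(k))_{k\ge1}$ is a probability distribution on $\{1,2,\dots\}$, the limit $\theta=\lim_n\mu(A_{q,n}^{(0)})/\mu(U_n)$ exists and is positive, and the rare event point processes $N_n=\sum_{j\ge0:\,X_j>u_n}\delta_{j\mu(U_n)}$ (so that $N_n(J)$ counts the exceedances at times in $v_nJ$, $v_n=1/\mu(U_n)$) converge in distribution under $\mu$, in the space of locally finite counting measures on $[0,\infty)$ with the vague topology, to the compound Poisson process $\sum_{i\ge1}D_i\,\delta_{T_1+\dots+T_i}$ of intensity $\theta$ and multiplicity distribution $\pi$, where $(T_i)$ are i.i.d. exponential with mean $1/\theta$, $(D_i)$ are i.i.d. with law $\pi$, and the two sequences are independent. -/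

import Mathlib

open MeasureTheory ProbabilityTheory Filter Topology Set
open scoped NNReal ENNReal

noncomputable section

namespace ClusterREPP

/-! ### Exceedances and the nested sets `U^(κ)`, `A^(κ)` -/

section Sets

variable {X : Type*}

/-- The exceedance set `U(u) = {x : φ x > u}`. -/
def exceedSet (φ : X → EReal) (u : ℝ) : Set X := {x | (u : EReal) < φ x}

/-- The points of `B` whose orbit does not meet `B` at any of the times `1, …, q`. -/
def escapeSet (f : X → X) (q : ℕ) (B : Set X) : Set X :=
  B ∩ ⋂ i ∈ Finset.Icc 1 q, f^[i] ⁻¹' Bᶜ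

/-- `U^(0)(u) = U(u)` and `U^(κ+1)(u) = U^(κ)(u) \ A_q^(κ)(u)`. -/
def nestedU (f : X → X) (φ : X → EReal) (q : ℕ) (u : ℝ) : ℕ → Set X
  | 0 => exceedSet φ u
  | κ + 1 => nestedU f φ q u κ \ escapeSet f q (nestedU f φ q u κ)

/-- `A_q^(κ)(u) = U^(κ)(u) ∩ ⋂_{1 ≤ i ≤ q} f^{-i}(U^(κ)(u)ᶜ)`. -/
def nestedA (f : X → X) (φ : X → EReal) (q : ℕ) (u : ℝ) (κ : ℕ) : Set X :=
  escapeSet f q (nestedU f φ q u κ)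

end Sets

/-! ### Decay of correlations -/

/-- Summable decay of correlations of `(f, μ)` for a Banach space `C₁` of real-valued measurable
functions (elements of `C₁` are turned into functions by `toFun`) against `L¹(μ)` observables,
together with a uniform bound in `C₁` for the indicators of the sets `A n κ`. -/
structure AssumptionA {X : Type*} [MeasurableSpace X] (f : X → X) (μ : Measure X)
    {C₁ : Type*} [NormedAddCommGroup C₁] [NormedSpace ℝ C₁] (toFun : C₁ →ₗ[ℝ] (X → ℝ))
    (A : ℕ → ℕ → Set X) : Prop where
  measurable : ∀ g : C₁, Measurable (toFun g)
  decay : ∃ ρ : ℕ → ℝ, Summable ρ ∧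
    ∀ (g : C₁) (ψ : X → ℝ), Integrable ψ μ → ∀ n : ℕ, 1 ≤ n →
      Integrable (fun x => toFun g x * ψ (f^[n] x)) μ ∧
      |(∫ x, toFun g x * ψ (f^[n] x) ∂μ) - (∫ x, toFun g x ∂μ) * (∫ x, ψ x ∂μ)|
        ≤ ‖g‖ * (∫ x, |ψ x| ∂μ) * ρ n
  indicator_bound : ∃ K : ℝ, 0 < K ∧ ∀ᶠ n in atTop, ∀ κ : ℕ,
    ∃ g : C₁, toFun g =ᵐ[μ] (A n κ).indicator 1 ∧ ‖g‖ ≤ K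

/-! ### Maxima along an orbit -/

/-- Real levels `u` tending to `uF` from below; `uF` may be `+∞`. -/
def levelsToMax (uF : EReal) : Filter ℝ := comap (fun u : ℝ => (u : EReal)) (𝓝[<] uF)

/-- `φ` has global maximum `uF`, attained exactly at the points `ξ_i = f^{m_i}(ζ)`, `1 ≤ i ≤ N`,
and for levels `u < uF` close to `uF` the exceedance set is the union of the balls of radius
`ε_i(u)` about the points `ξ_i`, where `ε_i(u) → 0` as `u → uF`. -/
structure HasOrbitMaxima {X : Type*} [MetricSpace X] (f : X → X) (φ : X → EReal) (uF : EReal)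
    (ζ : X) (N : ℕ) (m : ℕ → ℕ) (ε : ℕ → ℝ → ℝ) : Prop where
  le_max : ∀ x, φ x ≤ uF
  eq_max_iff : ∀ x, φ x = uF ↔ ∃ i ∈ Finset.Icc 1 N, x = f^[m i] ζ
  exceedSet_eq : ∀ᶠ u in levelsToMax uF,
    exceedSet φ u = ⋃ i ∈ Finset.Icc 1 N, Metric.ball (f^[m i] ζ) (ε i u)
  radius_tendsto : ∀ i ∈ Finset.Icc 1 N, Tendsto (ε i) (levelsToMax uF) (𝓝[>] 0)

section Indices

variable {X : Type*}

/-- `f^{-(m_j - m_i)}(W_j)`, used for `i ≤ j`. -/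
def pullBack (f : X → X) (m : ℕ → ℕ) (W : ℕ → Set X) (i j : ℕ) : Set X :=
  f^[m j - m i] ⁻¹' W j

/-- The nesting condition: for `i < j`, either `W_i ⊆ f^{-(m_j - m_i)}(W_j)`, or
`f^{-(m_j - m_i)}(W_j)` does not meet the boundary of `W_i`. -/
def NestingCondition [TopologicalSpace X] (f : X → X) (m : ℕ → ℕ) (N : ℕ) (W : ℕ → Set X) : Prop :=
  ∀ i j : ℕ, 1 ≤ i → i < j → j ≤ N →
    W i ⊆ pullBack f m W i j ∨ pullBack f m W i j ∩ frontier (W i) = ∅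

/-- For `i < j`, the part of `f^{-(m_j - m_i)}(W_j)` inside `W_i` is connected. -/
def SinglePiece [TopologicalSpace X] (f : X → X) (m : ℕ → ℕ) (N : ℕ) (W : ℕ → Set X) : Prop :=
  ∀ i j : ℕ, 1 ≤ i → i < j → j ≤ N → IsPreconnected (pullBack f m W i j ∩ W i)

/-- For `1 ≤ i ≤ N - k - 1`: the union of `f^{-(m_{j_{ℓ,k}} - m_i)}(W_{j_{ℓ,k}})` over all
`ℓ > i` for which `j_{ℓ,k}` is defined, that is, `ℓ = i + 1, …, N - k`.  Here `j ℓ k` stands for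
`j_{ℓ,k}`. -/
def pullUnion (f : X → X) (m : ℕ → ℕ) (N : ℕ) (W : ℕ → Set X) (j : ℕ → ℕ → ℕ) (i k : ℕ) : Set X :=
  ⋃ ℓ ∈ Finset.Icc (i + 1) (N - k), pullBack f m W i (j ℓ k)

open Classical in
/-- `indexSet … k` is the set `I_{k+1}` of all `i ∈ {1, …, N - k - 1}` such that `pullUnion … i k`
does not meet the boundary of `W_i`. -/
def indexSet [TopologicalSpace X] (f : X → X) (m : ℕ → ℕ) (N : ℕ) (W : ℕ → Set X)
    (j : ℕ → ℕ → ℕ) (k : ℕ) : Finset ℕ :=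
  (Finset.Icc 1 (N - (k + 1))).filter
    (fun i => pullUnion f m N W j i k ∩ frontier (W i) = ∅)

/-- `j ℓ k` (for `0 ≤ k < N`, `1 ≤ ℓ ≤ N - k`) is an admissible choice of the indices `j_{ℓ,k}`:
`j_{i,0} = i`; if `i ∈ I_{k+1}` then `j_{i,k+1}` is one of the indices `j_{ℓ,k}` of the union
`pullUnion … i k`, and inside `W_i` the whole union equals its `j_{i,k+1}`-member; if
`i ∉ I_{k+1}` then `j_{i,k+1} = i`. -/
structure IsIndexChoice [TopologicalSpace X] (f : X → X) (m : ℕ → ℕ) (N : ℕ) (W : ℕ → Set X)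
    (j : ℕ → ℕ → ℕ) : Prop where
  zero : ∀ i ∈ Finset.Icc 1 N, j i 0 = i
  succ_mem : ∀ k, ∀ i ∈ indexSet f m N W j k,
    (∃ ℓ ∈ Finset.Icc (i + 1) (N - k), j i (k + 1) = j ℓ k) ∧
    pullUnion f m N W j i k ∩ W i = pullBack f m W i (j i (k + 1)) ∩ W i
  succ_not_mem : ∀ k, ∀ i ∈ Finset.Icc 1 (N - (k + 1)), i ∉ indexSet f m N W j k →
    j i (k + 1) = i

end Indices

/-! ### Point processes on `[0, ∞)` -/

/-- Counting measures on `[0, ∞)`: locally finite with values in `ℕ ∪ {∞}`. -/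
def IsPointMeasure (ν : Measure ℝ≥0) : Prop :=
  IsLocallyFiniteMeasure ν ∧ ∀ B, MeasurableSet B → ∃ k : ℕ∞, ν B = (k : ℝ≥0∞)

/-- The space `M_p([0, ∞))` of counting measures. -/
def PointMeasure : Type := {ν : Measure ℝ≥0 // IsPointMeasure ν}

/-- The vague topology: the coarsest one for which `ν ↦ ∫ ψ dν` is continuous for all continuous
`ψ : [0, ∞) → ℝ` with compact support. -/
instance : TopologicalSpace PointMeasure :=
  TopologicalSpace.induced
    (fun (ν : PointMeasure) (ψ : CompactlySupportedContinuousMap ℝ≥0 ℝ) => ∫ x, ψ x ∂ν.1)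
    inferInstance

instance : MeasurableSpace PointMeasure := borel PointMeasure

instance : BorelSpace PointMeasure := ⟨rfl⟩

theorem isPointMeasure_zero : IsPointMeasure 0 :=
  ⟨inferInstance, fun _ _ => ⟨0, by simp⟩⟩

open Classical in
/-- A measure as an element of `M_p([0, ∞))`; measures that are not counting measures (they only
arise on null sets, or for levels with `μ(U(u)) = 0`) are sent to the zero measure. -/
def toPointMeasure (ν : Measure ℝ≥0) : PointMeasure :=
  if h : IsPointMeasure ν then ⟨ν, h⟩ else ⟨0, isPointMeasure_zero⟩

/-- The rare event point process at level `u`: with `v = 1 / μ(U(u))`, it has a unit mass at `j / v`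
for each time `j ≥ 0` at which `X_j = φ ∘ f^j` exceeds `u`, so that `N(J)` is the number of
exceedances at times in `v J`. -/
def repp {X : Type*} [MeasurableSpace X] (μ : Measure X) (f : X → X) (φ : X → EReal) (u : ℝ)
    (x : X) : PointMeasure :=
  toPointMeasure (Measure.sum fun j : ℕ =>
    (exceedSet φ u).indicator
      (fun _ => Measure.dirac ((j : ℝ≥0) / ((μ (exceedSet φ u)).toNNReal)⁻¹)) (f^[j] x))

/-- The law of two independent i.i.d. sequences: waiting times `T_0, T_1, …`, exponential with
mean `1 / θ`, and multiplicities `D_0, D_1, …` with law `p`. -/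
def compoundPoissonSpace (θ : {r : ℝ // 0 < r}) (p : PMF ℕ) : Measure ((ℕ → ℝ) × (ℕ → ℕ)) :=
  (Measure.infinitePi fun _ : ℕ => expMeasure (θ : ℝ)).prod
    (Measure.infinitePi fun _ : ℕ => p.toMeasure)

instance (θ : {r : ℝ // 0 < r}) (p : PMF ℕ) :
    IsProbabilityMeasure (compoundPoissonSpace θ p) := by
  have := isProbabilityMeasure_expMeasure θ.2
  unfold compoundPoissonSpace
  infer_instance

/-- The point process `∑_i D_i δ_{T_0 + ⋯ + T_i}`; under `compoundPoissonSpace θ p` it is the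
compound Poisson process of intensity `θ` and multiplicity distribution `p`. -/
def compoundPoisson (ω : (ℕ → ℝ) × (ℕ → ℕ)) : PointMeasure :=
  toPointMeasure (Measure.sum fun i : ℕ =>
    (ω.2 i : ℝ≥0∞) • Measure.dirac (∑ l ∈ Finset.range (i + 1), ω.1 l).toNNReal)

end ClusterREPP

end

open ClusterREPP

/-! Clusters. No maximal point is periodic and `f` is continuous along the orbit of `ζ`. So, in any
bounded time and for large `n`, a point of one small ball can reach another only at the time at
which `ζ` does. Hence a visit to `U_n` is followed by further visits only within `q` steps
(`GapAfter`), the number of remaining visits drops by one at each visit, and `A^(κ)` is the set of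
points of `U_n` with exactly `κ` visits at times `1, …, q` (`nestedA_eq`).

Statement (1). Let `atLeast i k` be the points of the `i`-th ball with at least `k` later visits.
Splitting at the next ball visited writes `atLeast i (k + 1)` as a union of pull-backs.
Connectedness and avoidance of boundaries force a pull-back from a later ball to pass through the
intermediate one (`pullBack_inter_subset`), so the pull-backs inside one ball form a chain and the
union is its largest member. If the union meets the boundary of the ball, it fills the ball. Thus
`atLeast i k` is the pull-back with index `j_{i,k}` (`indexChoice_spec`), and the formula is a sum
of differences over `i`.

Statement (2). The sets `A^(κ)`, `κ < N`, partition `U_n`, so the limits `π` force `μ(U_n) /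
μ(A^(0))` to converge to the mean of `π`, and `θ` is its inverse (`exists_index_of_tendsto_sizes`).
Consider the probability of `k` visits before time `m` together with an event `B` at time `m`. By
stationarity, lengthening the window by one step changes it only through points starting in `U_n`.
These are sorted by cluster size, and decay of correlations makes what comes after the cluster
almost independent of it. The result is a discrete Kolmogorov equation whose step is a contraction,
with error at most a small multiple of `μ(U_n)` per step. Over the `O(1 / μ(U_n))` steps the total
error stays small, and the Euler scheme of the compound Poisson equations obeys the same recursion
(`abs_countEvent_sub_cpMass_le`). Keeping `B` in the statement gives asymptotic independence of
successive blocks (`tendsto_blocks`).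

On the limit side, decomposition at the first cluster and lack of memory show that grid counts of
the compound Poisson process are independent with the same one-cell law
(`compoundPoissonSpace_hasCounts`). Finally, counts on fine dyadic grids decide membership in
vaguely open sets, so convergence of their joint laws is enough (`tendstoInDistribution_of_counts`).
-/

namespace ClusterREPP

/-! ### Point measures and counts on a grid -/

/-- The `l`-th interval of the grid of mesh `h`. -/
def gridCell (h : ℝ≥0) (l : ℕ) : Set ℝ≥0 := Ico (l * h) ((l + 1) * h)

theorem measurableSet_gridCell (h : ℝ≥0) (l : ℕ) : MeasurableSet (gridCell h l) :=
  measurableSet_Ico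

theorem mem_gridCell_iff {h : ℝ≥0} (hh : 0 < h) {l : ℕ} {x : ℝ≥0} :
    x ∈ gridCell h l ↔ ⌊x / h⌋₊ = l := by
  rw [Nat.floor_eq_iff zero_le, gridCell, mem_Ico, le_div_iff₀ hh, div_lt_iff₀ hh]

theorem pairwise_disjoint_gridCell {h : ℝ≥0} (hh : 0 < h) :
    Pairwise (Function.onFun Disjoint (gridCell h)) := by
  intro a b hab
  refine Set.disjoint_left.2 fun x hx hx' => hab ?_
  rw [mem_gridCell_iff hh] at hx hx'
  exact hx.symm.trans hx'

theorem iUnion_gridCell {h : ℝ≥0} (hh : 0 < h) (L : ℕ) :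
    ⋃ l ∈ Finset.range L, gridCell h l = Iio (L * h) := by
  ext x
  simp only [mem_iUnion, Finset.mem_range, exists_prop, mem_gridCell_iff hh, mem_Iio,
    ← div_lt_iff₀ hh]
  simp [Nat.floor_lt]

theorem measure_gridCell_lt_top {ν : Measure ℝ≥0} [IsLocallyFiniteMeasure ν] (h : ℝ≥0) (l : ℕ) :
    ν (gridCell h l) < ∞ :=
  (measure_mono Ico_subset_Icc_self).trans_lt isCompact_Icc.measure_lt_top

/-- The integral of a function with small oscillation on the cells of a grid is close to its
Riemann sum. -/
theorem abs_integral_sub_gridSum_le {ν : Measure ℝ≥0} [IsLocallyFiniteMeasure ν]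
    (ψ : CompactlySupportedContinuousMap ℝ≥0 ℝ) {h : ℝ≥0} (hh : 0 < h) {L : ℕ} {c : ℝ}
    (hsupp : ∀ x, (L : ℝ≥0) * h ≤ x → ψ x = 0)
    (hosc : ∀ l < L, ∀ x ∈ gridCell h l, |ψ x - ψ (l * h)| ≤ c) :
    |∫ x, ψ x ∂ν - ∑ l ∈ Finset.range L, ψ (l * h) * ν.real (gridCell h l)|
      ≤ c * ∑ l ∈ Finset.range L, ν.real (gridCell h l) := by
  have hint : Integrable ψ ν := ψ.continuous.integrable_of_hasCompactSupport ψ.hasCompactSupport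
  have h1 : ∫ x, ψ x ∂ν = ∑ l ∈ Finset.range L, ∫ x in gridCell h l, ψ x ∂ν := by
    rw [← integral_biUnion_finset _ (fun l _ => measurableSet_gridCell h l)
      (fun a _ b _ hab => pairwise_disjoint_gridCell hh hab) (fun l _ => hint.integrableOn),
      iUnion_gridCell hh]
    refine (setIntegral_eq_integral_of_forall_compl_eq_zero fun x hx => hsupp x ?_).symm
    simpa using hx
  rw [h1, ← Finset.sum_sub_distrib, Finset.mul_sum]
  refine (Finset.abs_sum_le_sum_abs _ _).trans (Finset.sum_le_sum fun l hl => ?_)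
  have h2 : ψ (l * h) * ν.real (gridCell h l) = ∫ _ in gridCell h l, ψ (l * h) ∂ν := by
    simp [mul_comm]
  have hfin := measure_gridCell_lt_top (ν := ν) h l
  rw [h2, ← integral_sub hint.integrableOn (integrableOn_const hfin.ne)]
  have h3 : ∀ x ∈ gridCell h l, ‖ψ x - ψ (l * h)‖ ≤ c :=
    fun x hx => hosc l (Finset.mem_range.1 hl) x hx
  exact norm_setIntegral_le_of_norm_le_const hfin h3

/-- The mesh `2^{-p}`. -/
noncomputable def dyadicMesh (p : ℕ) : ℝ≥0 := (2 ^ p)⁻¹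

theorem dyadicMesh_pos (p : ℕ) : 0 < dyadicMesh p := by unfold dyadicMesh; positivity

/-- Close integrals for measures with the same counts on a fine dyadic grid. -/
theorem eventually_abs_integral_sub_lt (ψ : CompactlySupportedContinuousMap ℝ≥0 ℝ)
    (ν : Measure ℝ≥0) [IsLocallyFiniteMeasure ν] {ε : ℝ} (hε : 0 < ε) :
    ∀ᶠ p : ℕ in atTop, ∀ ν' : Measure ℝ≥0, IsLocallyFiniteMeasure ν' →
      (∀ l < p * 2 ^ p, ν' (gridCell (dyadicMesh p) l) = ν (gridCell (dyadicMesh p) l)) →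
      |∫ x, ψ x ∂ν' - ∫ x, ψ x ∂ν| < ε := by
  obtain ⟨M, hM⟩ : ∃ M : ℕ, ∀ x : ℝ≥0, (M : ℝ≥0) ≤ x → ψ x = 0 := by
    obtain ⟨b, hb⟩ := ψ.hasCompactSupport.isCompact.bddAbove
    obtain ⟨M, hM⟩ := exists_nat_gt b
    refine ⟨M, fun x hx => ?_⟩
    by_contra h0
    exact absurd (hb (subset_tsupport ψ h0)) (not_le.2 (hM.trans_le hx))
  -- Equal counts give `ν` and `ν'` the same Riemann sum and the same mass `C` before `M`. With
  -- oscillation at most `ε / (3 * (C + 1))` each integral is within `ε / 3` of that sum; the `+ 1`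
  -- covers `C = 0`.
  set C : ℝ := ν.real (Iio (M : ℝ≥0)) with hC
  have hC0 : 0 ≤ C := measureReal_nonneg
  obtain ⟨δ, hδ, huc⟩ := Metric.uniformContinuous_iff.1
    (ψ.hasCompactSupport.uniformContinuous_of_continuous ψ.continuous)
    (ε / (3 * (C + 1))) (by positivity)
  have hmesh : Tendsto (fun p => ((dyadicMesh p : ℝ≥0) : ℝ)) atTop (𝓝 0) := by
    have := tendsto_pow_atTop_nhds_zero_of_lt_one (r := (2 : ℝ)⁻¹) (by norm_num) (by norm_num)
    simpa [dyadicMesh, inv_pow] using this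
  -- The bound `M ≤ p` puts the `M * 2 ^ p` cells covering `[0, M)` among the `p * 2 ^ p` cells with
  -- known counts.
  filter_upwards [eventually_ge_atTop M, hmesh.eventually (gt_mem_nhds hδ)] with p hpM hpδ ν' hν' heq
  have hh := dyadicMesh_pos p
  have hLh : ((M * 2 ^ p : ℕ) : ℝ≥0) * dyadicMesh p = M := by
    simp [dyadicMesh]
  have hosc : ∀ l < M * 2 ^ p, ∀ x ∈ gridCell (dyadicMesh p) l,
      |ψ x - ψ (l * dyadicMesh p)| ≤ ε / (3 * (C + 1)) := by
    intro l _ x hx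
    have hd : dist x (l * dyadicMesh p) < δ := ?_
    · exact (huc hd).le
    rw [NNReal.dist_eq, abs_of_nonneg (sub_nonneg.2 (by exact_mod_cast hx.1))]
    have h2 : (x : ℝ) < (l + 1) * dyadicMesh p := by exact_mod_cast hx.2
    push_cast
    linarith
  have key := fun (η : Measure ℝ≥0) [IsLocallyFiniteMeasure η] =>
    abs_integral_sub_gridSum_le (ν := η) ψ hh (L := M * 2 ^ p) (by rw [hLh]; exact hM) hosc
  have e : ∀ l ∈ Finset.range (M * 2 ^ p), ν'.real (gridCell (dyadicMesh p) l)
      = ν.real (gridCell (dyadicMesh p) l) := fun l hl => by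
    rw [measureReal_def, measureReal_def, heq l
      ((Finset.mem_range.1 hl).trans_le (Nat.mul_le_mul_right _ hpM))]
  have k1 := key ν'
  have k2 := key ν
  rw [Finset.sum_congr rfl e, Finset.sum_congr rfl fun l hl => by rw [e l hl]] at k1
  have hsum : ∑ l ∈ Finset.range (M * 2 ^ p), ν.real (gridCell (dyadicMesh p) l) = C := by
    rw [hC, ← hLh, ← iUnion_gridCell hh, measureReal_biUnion_finset
      (fun a _ b _ hab => pairwise_disjoint_gridCell hh hab)
      (fun l _ => measurableSet_gridCell _ l) (fun l _ => (measure_gridCell_lt_top _ l).ne)]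
  rw [hsum] at k1 k2
  have h3 : ε / (3 * (C + 1)) * C ≤ ε / 3 := by
    rw [div_mul_eq_mul_div, div_le_div_iff₀ (by positivity) (by norm_num)]
    nlinarith
  rw [abs_le] at k1 k2
  rw [abs_lt]
  constructor <;> linarith

/-- The counts of `ν` on the first cells of the dyadic grid are prescribed by `k`. -/
def HasCounts (h : ℝ≥0) {L : ℕ} (k : Fin L → ℕ) (ν : Measure ℝ≥0) : Prop :=
  ∀ l : Fin L, ν (gridCell h l) = k l

theorem PointMeasure.exists_hasCounts (ν : PointMeasure) (h : ℝ≥0) (L : ℕ) :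
    ∃ k : Fin L → ℕ, HasCounts h k ν.1 := by
  have := ν.2.1
  have : ∀ l : Fin L, ∃ k : ℕ, ν.1 (gridCell h l) = k := fun l => by
    obtain ⟨k, hk⟩ := ν.2.2 _ (measurableSet_gridCell h l)
    have hlt := measure_gridCell_lt_top (ν := ν.1) h l
    rw [hk] at hlt ⊢
    lift k to ℕ using by rintro rfl; simp at hlt
    exact ⟨k, by simp⟩
  choose k hk using this
  exact ⟨k, hk⟩

/-- In an open set of point measures, membership is decided by counts on fine dyadic grids. -/
theorem PointMeasure.eventually_mem_of_isOpen {G : Set PointMeasure} (hG : IsOpen G)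
    {ν : PointMeasure} (hν : ν ∈ G) :
    ∀ᶠ p : ℕ in atTop, ∀ k : Fin (p * 2 ^ p) → ℕ, HasCounts (dyadicMesh p) k ν.1 →
      ∀ ν' : PointMeasure, HasCounts (dyadicMesh p) k ν'.1 → ν' ∈ G := by
  obtain ⟨O, hO, rfl⟩ := isOpen_induced_iff.1 hG
  obtain ⟨I, u, hu, hsub⟩ := isOpen_pi_iff.1 hO _ hν
  have := ν.2.1
  have key : ∀ ψ ∈ I, ∀ᶠ p : ℕ in atTop, ∀ ν' : Measure ℝ≥0, IsLocallyFiniteMeasure ν' →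
      (∀ l < p * 2 ^ p, ν' (gridCell (dyadicMesh p) l) = ν.1 (gridCell (dyadicMesh p) l)) →
      ∫ x, ψ x ∂ν' ∈ u ψ := by
    intro ψ hψ
    obtain ⟨ε, hε, hball⟩ := Metric.isOpen_iff.1 (hu ψ hψ).1 _ (hu ψ hψ).2
    filter_upwards [eventually_abs_integral_sub_lt ψ ν.1 hε] with p hp ν' h1 h2
    exact hball (hp ν' h1 h2)
  filter_upwards [(Filter.eventually_all_finset I).2 key] with p hp k hk ν' hk'
  refine hsub fun ψ hψ => hp ψ hψ ν'.1 ν'.2.1 fun l hl => ?_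
  exact (hk' ⟨l, hl⟩).trans (hk ⟨l, hl⟩).symm

/-- The part of `G` that is recognised at the dyadic level `p`. -/
def recognised (G : Set PointMeasure) (p : ℕ) : Set (Fin (p * 2 ^ p) → ℕ) :=
  {k | ∀ ν' : PointMeasure, HasCounts (dyadicMesh p) k ν'.1 → ν' ∈ G}

/-- A point of `G` is recognised at all large levels, and recognition at one level already implies
membership. The countable form serves twice: it makes maps with measurable counts Borel, and the
union increases in `p₀`, so its measure is a supremum. -/
theorem PointMeasure.eq_iUnion_of_isOpen {G : Set PointMeasure} (hG : IsOpen G) :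
    G = ⋃ p₀ : ℕ, ⋂ p ≥ p₀, ⋃ k ∈ recognised G p,
      {ν : PointMeasure | HasCounts (dyadicMesh p) k ν.1} := by
  ext ν
  simp only [mem_iUnion, mem_iInter, mem_ofPred_eq, exists_prop]
  constructor
  · intro hν
    obtain ⟨p₀, h⟩ := eventually_atTop.1 (PointMeasure.eventually_mem_of_isOpen hG hν)
    refine ⟨p₀, fun p hp => ?_⟩
    obtain ⟨k, hk⟩ := ν.exists_hasCounts (dyadicMesh p) (p * 2 ^ p)
    exact ⟨k, h p hp k hk, hk⟩
  · rintro ⟨p₀, h⟩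
    obtain ⟨k, hk, hk'⟩ := h p₀ le_rfl
    exact hk ν hk'

/-! ### Convergence in distribution from joint laws of counts. -/

section Criterion

variable {Ω : Type*} [MeasurableSpace Ω]

theorem measurableSet_hasCounts {Y : Ω → PointMeasure} {h : ℝ≥0}
    (hY : ∀ l : ℕ, Measurable fun ω => (Y ω).1 (gridCell h l)) {L : ℕ} (k : Fin L → ℕ) :
    MeasurableSet {ω | HasCounts h k (Y ω).1} := by
  simp only [HasCounts, ofPred_forall]
  exact MeasurableSet.iInter fun l => hY l (measurableSet_singleton _)

theorem measurable_of_counts {Y : Ω → PointMeasure}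
    (hY : ∀ (h : ℝ≥0) (l : ℕ), Measurable fun ω => (Y ω).1 (gridCell h l)) : Measurable Y := by
  refine measurable_of_isOpen fun G hG => ?_
  rw [PointMeasure.eq_iUnion_of_isOpen hG]
  simp only [preimage_iUnion, preimage_iInter]
  exact MeasurableSet.iUnion fun _ => MeasurableSet.iInter fun p => MeasurableSet.iInter fun _ =>
    MeasurableSet.biUnion (to_countable _) fun k _ => measurableSet_hasCounts (hY _) k

/-- Convergence of the joint laws of the counts on dyadic grids implies convergence in
distribution for the vague topology. -/
theorem tendstoInDistribution_of_counts {Ω' : Type*} [MeasurableSpace Ω']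
    {μ : Measure Ω} [IsProbabilityMeasure μ] {μ' : Measure Ω'} [IsProbabilityMeasure μ']
    {Y : ℕ → Ω → PointMeasure} {Z : Ω' → PointMeasure}
    (hY : ∀ (n : ℕ) (h : ℝ≥0) (l : ℕ), Measurable fun ω => (Y n ω).1 (gridCell h l))
    (hZ : ∀ (h : ℝ≥0) (l : ℕ), Measurable fun ω => (Z ω).1 (gridCell h l))
    (hlim : ∀ h : ℝ≥0, 0 < h → ∀ (L : ℕ) (k : Fin L → ℕ),
      Tendsto (fun n => μ {ω | HasCounts h k (Y n ω).1}) atTop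
        (𝓝 (μ' {ω | HasCounts h k (Z ω).1}))) :
    TendstoInDistribution Y atTop Z (fun _ => μ) μ' where
  forall_aemeasurable n := (measurable_of_counts (hY n)).aemeasurable
  aemeasurable_limit := (measurable_of_counts hZ).aemeasurable
  tendsto := by
    refine tendsto_of_forall_isOpen_le_liminf' fun G hG => ?_
    simp only [ProbabilityMeasure.coe_mk]
    rw [Measure.map_apply (measurable_of_counts hZ) hG.measurableSet]
    have hYG : ∀ n, (μ.map (Y n)) G = μ (Y n ⁻¹' G) := fun n =>
      Measure.map_apply (measurable_of_counts (hY n)) hG.measurableSet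
    simp only [hYG]
    have hmeas : ∀ p, ∀ k : Fin (p * 2 ^ p) → ℕ,
        MeasurableSet {ω | HasCounts (dyadicMesh p) k (Z ω).1} :=
      fun p k => measurableSet_hasCounts (hZ _) k
    -- Fatou at a fixed level: only finitely many count patterns are used at a time. Distinct
    -- patterns are disjoint events, and each recognised pattern forces `Y n` into `G`.
    have hsingle : ∀ p, μ' (⋃ k ∈ recognised G p, {ω | HasCounts (dyadicMesh p) k (Z ω).1}) ≤
        liminf (fun n => μ (Y n ⁻¹' G)) atTop := by
      intro p
      refine (measure_biUnion_le μ' (to_countable _) _).trans ?_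
      rw [ENNReal.tsum_eq_iSup_sum]
      refine iSup_le fun F => ?_
      have ht : Tendsto (fun n => ∑ k ∈ F, μ {ω | HasCounts (dyadicMesh p) k.1 (Y n ω).1}) atTop
          (𝓝 (∑ k ∈ F, μ' {ω | HasCounts (dyadicMesh p) k.1 (Z ω).1})) :=
        tendsto_finsetSum _ fun k _ => hlim _ (dyadicMesh_pos p) _ _
      rw [← ht.liminf_eq]
      refine liminf_le_liminf (Eventually.of_forall fun n => ?_)
      rw [← measure_biUnion_finset]
      · refine measure_mono (iUnion₂_subset fun k _ ω hω => k.2 _ hω)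
      · intro a _ b _ hab
        refine Set.disjoint_left.2 fun ω ha hb => hab (Subtype.ext (funext fun l => ?_))
        exact_mod_cast (ha l).symm.trans (hb l)
      · exact fun k _ => measurableSet_hasCounts (hY n _) _
    rw [PointMeasure.eq_iUnion_of_isOpen hG]
    simp only [preimage_iUnion, preimage_iInter]
    rw [Monotone.measure_iUnion]
    · refine iSup_le fun p₀ => ?_
      rw [PointMeasure.eq_iUnion_of_isOpen hG] at hsingle
      simp only [preimage_iUnion, preimage_iInter] at hsingle
      rw [← PointMeasure.eq_iUnion_of_isOpen hG] at hsingle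
      exact (measure_mono (iInter₂_subset p₀ le_rfl)).trans (hsingle p₀)
    · intro a b hab
      exact iInter₂_mono' fun p hp => ⟨p, hab.trans hp, subset_rfl⟩

end Criterion


/-! ### The compound Poisson probabilities -/

/-- The compound Poisson probabilities multiplied by `exp (θ t)`. -/
noncomputable def cpPoly (θ : ℝ) (π : ℕ → ℝ) : ℕ → ℝ → ℝ
  | 0 => fun _ => 1
  | k + 1 => fun t => ∫ s in (0 : ℝ)..t, θ * ∑ i : Fin (k + 1), π (k + 1 - i) * cpPoly θ π i s
termination_by k => k
decreasing_by exact i.2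

/-- The probability that a compound Poisson process of intensity `θ` and multiplicity
distribution `π` has total mass `k` on an interval of length `t`. -/
noncomputable def cpMass (θ : ℝ) (π : ℕ → ℝ) (t : ℝ) (k : ℕ) : ℝ :=
  Real.exp (-(θ * t)) * cpPoly θ π k t

section CompoundPoissonMass

variable {θ : ℝ} {π : ℕ → ℝ}

theorem cpPoly_zero (t : ℝ) : cpPoly θ π 0 t = 1 := by rw [cpPoly]

theorem cpPoly_succ (k : ℕ) (t : ℝ) : cpPoly θ π (k + 1) t =
    ∫ s in (0 : ℝ)..t, θ * ∑ i ∈ Finset.range (k + 1), π (k + 1 - i) * cpPoly θ π i s := by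
  rw [cpPoly]
  simp only [Finset.sum_range]

theorem continuous_cpPoly (k : ℕ) : Continuous (cpPoly θ π k) := by
  induction k using Nat.strong_induction_on with
  | _ k ih =>
    cases k with
    | zero => simpa only [funext cpPoly_zero] using continuous_const
    | succ k =>
      rw [funext (cpPoly_succ k)]
      refine intervalIntegral.continuous_primitive (fun a b => ?_) 0
      refine Continuous.intervalIntegrable ?_ _ _
      refine continuous_const.mul (continuous_finsetSum _ fun i hi => ?_)
      exact continuous_const.mul (ih i (Finset.mem_range.1 hi))

theorem cpPoly_nonneg (hθ : 0 ≤ θ) (hπ : ∀ k, 0 ≤ π k) (k : ℕ) {t : ℝ} (ht : 0 ≤ t) :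
    0 ≤ cpPoly θ π k t := by
  induction k using Nat.strong_induction_on generalizing t with
  | _ k ih =>
    cases k with
    | zero => simp [cpPoly_zero]
    | succ k =>
      rw [cpPoly_succ]
      refine intervalIntegral.integral_nonneg ht fun s hs => mul_nonneg hθ ?_
      exact Finset.sum_nonneg fun i hi => mul_nonneg (hπ _) (ih i (Finset.mem_range.1 hi) hs.1)

theorem cpMass_nonneg (hθ : 0 ≤ θ) (hπ : ∀ k, 0 ≤ π k) (k : ℕ) {t : ℝ} (ht : 0 ≤ t) :
    0 ≤ cpMass θ π t k :=
  mul_nonneg (Real.exp_pos _).le (cpPoly_nonneg hθ hπ k ht)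

theorem cpMass_zero (k : ℕ) : cpMass θ π 0 k = if k = 0 then 1 else 0 := by
  cases k with
  | zero => simp [cpMass, cpPoly_zero]
  | succ k => simp [cpMass, cpPoly_succ]

theorem continuous_cpMass (k : ℕ) : Continuous fun t => cpMass θ π t k := by
  unfold cpMass
  have := continuous_cpPoly (θ := θ) (π := π) k
  fun_prop

theorem hasDerivAt_cpPoly (k : ℕ) (t : ℝ) :
    HasDerivAt (cpPoly θ π k) (θ * ∑ i ∈ Finset.range k, π (k - i) * cpPoly θ π i t) t := by
  cases k with
  | zero => simpa [funext cpPoly_zero] using hasDerivAt_const t (1 : ℝ)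
  | succ k =>
    rw [funext (cpPoly_succ k)]
    have hc : Continuous fun s => θ * ∑ i ∈ Finset.range (k + 1), π (k + 1 - i) * cpPoly θ π i s :=
      continuous_const.mul (continuous_finsetSum _ fun i _ =>
        continuous_const.mul (continuous_cpPoly i))
    exact intervalIntegral.integral_hasDerivAt_right (hc.intervalIntegrable _ _)
      hc.aestronglyMeasurable.stronglyMeasurableAtFilter hc.continuousAt

/-- The right-hand side of the Kolmogorov equations of the compound Poisson process. -/
noncomputable def cpDeriv (θ : ℝ) (π : ℕ → ℝ) (t : ℝ) (k : ℕ) : ℝ :=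
  -θ * cpMass θ π t k + θ * ∑ i ∈ Finset.range k, π (k - i) * cpMass θ π t i

theorem hasDerivAt_cpMass (k : ℕ) (t : ℝ) :
    HasDerivAt (fun s => cpMass θ π s k) (cpDeriv θ π t k) t := by
  have h1 : HasDerivAt (fun s : ℝ => Real.exp (-(θ * s))) (Real.exp (-(θ * t)) * -(θ * 1)) t :=
    ((hasDerivAt_id t).const_mul θ).neg.exp
  refine (h1.mul (hasDerivAt_cpPoly k t)).congr_deriv ?_
  simp only [cpDeriv, cpMass, Finset.mul_sum]
  congr 1
  · ring
  · exact Finset.sum_congr rfl fun i _ => by ring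

theorem exists_lipschitz_cpMass (k : ℕ) (T : ℝ) :
    ∃ C, 0 ≤ C ∧ ∀ s ∈ Icc 0 T, ∀ t ∈ Icc 0 T, |cpMass θ π t k - cpMass θ π s k| ≤ C * |t - s| := by
  have hc : Continuous fun t => cpDeriv θ π t k := by
    unfold cpDeriv
    exact (continuous_const.mul (continuous_cpMass k)).add
      (continuous_const.mul (continuous_finsetSum _ fun i _ =>
        continuous_const.mul (continuous_cpMass i)))
  obtain ⟨C, hC⟩ := isCompact_Icc.exists_bound_of_continuousOn (s := Icc 0 T) hc.continuousOn
  refine ⟨|C|, abs_nonneg _, fun s hs t ht => ?_⟩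
  exact (convex_Icc 0 T).norm_image_sub_le_of_norm_hasDerivWithin_le
    (f := fun t => cpMass θ π t k)
    (fun x _ => (hasDerivAt_cpMass k x).hasDerivWithinAt)
    (fun x hx => (hC x hx).trans (le_abs_self C)) hs ht

theorem exists_lipschitz_cpDeriv (k : ℕ) (T : ℝ) :
    ∃ C, 0 ≤ C ∧ ∀ s ∈ Icc 0 T, ∀ t ∈ Icc 0 T,
      |cpDeriv θ π t k - cpDeriv θ π s k| ≤ C * |t - s| := by
  choose C hC0 hC using fun k => exists_lipschitz_cpMass (θ := θ) (π := π) k T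
  refine ⟨|θ| * C k + |θ| * ∑ i ∈ Finset.range k, |π (k - i)| * C i,
    add_nonneg (mul_nonneg (abs_nonneg _) (hC0 k)) (mul_nonneg (abs_nonneg _)
      (Finset.sum_nonneg fun i _ => mul_nonneg (abs_nonneg _) (hC0 i))), fun s hs t ht => ?_⟩
  have e : cpDeriv θ π t k - cpDeriv θ π s k = -θ * (cpMass θ π t k - cpMass θ π s k) +
      θ * ∑ i ∈ Finset.range k, π (k - i) * (cpMass θ π t i - cpMass θ π s i) := by
    simp only [cpDeriv, mul_sub, Finset.sum_sub_distrib]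
    ring
  rw [e, add_mul]
  refine (abs_add_le _ _).trans (add_le_add ?_ ?_)
  · rw [abs_mul, abs_neg, mul_assoc]
    exact mul_le_mul_of_nonneg_left (hC k s hs t ht) (abs_nonneg _)
  · rw [abs_mul, mul_assoc]
    refine mul_le_mul_of_nonneg_left ?_ (abs_nonneg _)
    rw [Finset.sum_mul]
    refine (Finset.abs_sum_le_sum_abs _ _).trans (Finset.sum_le_sum fun i _ => ?_)
    rw [abs_mul, mul_assoc]
    exact mul_le_mul_of_nonneg_left (hC i s hs t ht) (abs_nonneg _)

/-- One Euler step for the Kolmogorov equations has an error of second order. -/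
theorem exists_cpMass_euler (k : ℕ) (T : ℝ) :
    ∃ C, 0 ≤ C ∧ ∀ t δ : ℝ, 0 ≤ t → 0 ≤ δ → t + δ ≤ T →
      |cpMass θ π (t + δ) k - cpMass θ π t k - δ * cpDeriv θ π t k| ≤ C * δ ^ 2 := by
  obtain ⟨C, hC0, hC⟩ := exists_lipschitz_cpDeriv (θ := θ) (π := π) k T
  refine ⟨C, hC0, fun t δ ht hδ hT => ?_⟩
  have hd : ∀ x ∈ Icc t (t + δ), HasDerivWithinAt
      (fun s => cpMass θ π s k - s * cpDeriv θ π t k)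
      (cpDeriv θ π x k - cpDeriv θ π t k) (Icc t (t + δ)) x := fun x _ => by
    have := (hasDerivAt_cpMass (θ := θ) (π := π) k x).sub
      ((hasDerivAt_id x).mul_const (cpDeriv θ π t k))
    exact (this.congr_deriv (by simp)).hasDerivWithinAt
  have hb : ∀ x ∈ Icc t (t + δ), ‖cpDeriv θ π x k - cpDeriv θ π t k‖ ≤ C * δ := fun x hx => by
    refine (hC t ⟨ht, by linarith⟩ x ⟨ht.trans hx.1, hx.2.trans hT⟩).trans ?_
    refine mul_le_mul_of_nonneg_left ?_ hC0
    rw [abs_of_nonneg (by linarith [hx.1])]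
    linarith [hx.2]
  have := (convex_Icc t (t + δ)).norm_image_sub_le_of_norm_hasDerivWithin_le hd hb
    (left_mem_Icc.2 (by linarith)) (right_mem_Icc.2 (by linarith))
  have e : t + δ - t = δ := by ring
  rw [e, Real.norm_eq_abs, Real.norm_eq_abs, abs_of_nonneg hδ] at this
  calc _ = |cpMass θ π (t + δ) k - (t + δ) * cpDeriv θ π t k -
        (cpMass θ π t k - t * cpDeriv θ π t k)| := by congr 1; ring
    _ ≤ _ := this.trans (le_of_eq (by ring))

/-- The renewal equation. -/
theorem cpMass_renewal (k : ℕ) (t : ℝ) :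
    cpMass θ π t k = (if k = 0 then Real.exp (-(θ * t)) else 0) +
      ∫ r in (0 : ℝ)..t, θ * Real.exp (-(θ * r)) *
        ∑ i ∈ Finset.range k, π (k - i) * cpMass θ π (t - r) i := by
  cases k with
  | zero => simp [cpMass, cpPoly_zero]
  | succ k =>
    -- The factors at `r` and `t - r` multiply to the constant `exp (-(θ * t))`, so what remains is
    -- the integral defining `cpPoly` after the substitution `s = t - r`.
    have e : ∀ r : ℝ, θ * Real.exp (-(θ * r)) *
        ∑ i ∈ Finset.range (k + 1), π (k + 1 - i) * cpMass θ π (t - r) i =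
        Real.exp (-(θ * t)) *
          (θ * ∑ i ∈ Finset.range (k + 1), π (k + 1 - i) * cpPoly θ π i (t - r)) := by
      intro r
      have : Real.exp (-(θ * t)) = Real.exp (-(θ * r)) * Real.exp (-(θ * (t - r))) := by
        rw [← Real.exp_add]; ring_nf
      rw [this]
      simp only [cpMass, Finset.mul_sum]
      exact Finset.sum_congr rfl fun i _ => by ring
    simp only [e]
    rw [intervalIntegral.integral_const_mul, cpMass, cpPoly_succ,
      intervalIntegral.integral_comp_sub_left
        (fun s => θ * ∑ i ∈ Finset.range (k + 1), π (k + 1 - i) * cpPoly θ π i s) t]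
    simp

end CompoundPoissonMass


/-! ### Sums of weighted point masses -/

/-- A finite sum of natural numbers has only finitely many nonzero terms, since each such term is at
least `1`. -/
theorem exists_enat_eq_tsum (b : ℕ → ℕ) : ∃ k : ℕ∞, ∑' i, (b i : ℝ≥0∞) = k := by
  by_cases h : ∑' i, (b i : ℝ≥0∞) = ∞
  · exact ⟨⊤, by simpa using h⟩
  · have hfin : (Function.support b).Finite := by
      refine (ENNReal.finite_const_le_of_tsum_ne_top h one_ne_zero).subset fun i hi => ?_
      have : 1 ≤ b i := Nat.one_le_iff_ne_zero.2 hi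
      exact_mod_cast this
    refine ⟨((∑ i ∈ hfin.toFinset, b i : ℕ) : ℕ∞), ?_⟩
    rw [tsum_eq_sum (s := hfin.toFinset) fun i hi => by simpa using hi]
    rw [ENat.toENNReal_coe, Nat.cast_sum]

/-- The measure with mass `a i` at `s i`. -/
noncomputable def pointSum (a : ℕ → ℕ) (s : ℕ → ℝ≥0) : Measure ℝ≥0 :=
  Measure.sum fun i => (a i : ℝ≥0∞) • Measure.dirac (s i)

theorem pointSum_apply (a : ℕ → ℕ) (s : ℕ → ℝ≥0) {B : Set ℝ≥0} (hB : MeasurableSet B) :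
    pointSum a s B = ∑' i, (a i : ℝ≥0∞) * B.indicator 1 (s i) := by
  simp [pointSum, Measure.sum_apply _ hB, Measure.dirac_apply' _ hB]

theorem pointSum_apply_eq_sum (a : ℕ → ℕ) (s : ℕ → ℝ≥0) {B : Set ℝ≥0} (hB : MeasurableSet B)
    {n : ℕ} (hn : ∀ i, n ≤ i → s i ∉ B) :
    pointSum a s B = ∑ i ∈ Finset.range n, (a i : ℝ≥0∞) * B.indicator 1 (s i) := by
  rw [pointSum_apply a s hB]
  refine tsum_eq_sum fun i hi => ?_
  rw [indicator_of_notMem (hn i (by simpa using hi)), mul_zero]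

theorem isPointMeasure_pointSum (a : ℕ → ℕ) (s : ℕ → ℝ≥0)
    (hs : ∀ t : ℝ≥0, ∃ n, ∀ i, n ≤ i → t ≤ s i) : IsPointMeasure (pointSum a s) := by
  refine ⟨⟨fun x => ⟨Iio (x + 1), Iio_mem_nhds (by simp), ?_⟩⟩, fun B hB => ?_⟩
  · obtain ⟨n, hn⟩ := hs (x + 1)
    rw [pointSum_apply_eq_sum a s measurableSet_Iio fun i hi => by simpa using hn i hi]
    refine ENNReal.sum_lt_top.2 fun i _ => ENNReal.mul_lt_top (by simp) ?_
    exact (indicator_le_self' (by simp) _).trans_lt (by simp)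
  · rw [pointSum_apply a s hB]
    classical
    obtain ⟨k, hk⟩ := exists_enat_eq_tsum fun i => if s i ∈ B then a i else 0
    refine ⟨k, hk ▸ tsum_congr fun i => ?_⟩
    by_cases h : s i ∈ B <;> simp [h]

/-! ### The compound Poisson process -/

/-- Put `a` in front of the sequence `s`. -/
def seqCons {α : Type*} (a : α) (s : ℕ → α) : ℕ → α
  | 0 => a
  | i + 1 => s i

theorem measurable_seqCons {α : Type*} [MeasurableSpace α] :
    Measurable fun x : α × (ℕ → α) => seqCons x.1 x.2 := by
  refine measurable_pi_lambda _ fun i => ?_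
  cases i with
  | zero => exact measurable_fst
  | succ i => exact (measurable_pi_apply i).comp measurable_snd

/-- An i.i.d. sequence stays i.i.d. with the same law when an independent copy of a term is put in
front; this is checked on finite boxes by splitting off coordinate `0`. It is what isolates the
first cluster. -/
theorem map_seqCons_infinitePi {α : Type*} [MeasurableSpace α] (ν : Measure α)
    [IsProbabilityMeasure ν] :
    (ν.prod (Measure.infinitePi fun _ : ℕ => ν)).map (fun x => seqCons x.1 x.2) =
      Measure.infinitePi fun _ : ℕ => ν := by
  refine Measure.eq_infinitePi _ fun s t ht => ?_
  classical
  have hpre : (fun x : α × (ℕ → α) => seqCons x.1 x.2) ⁻¹' Set.pi s t =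
      (if 0 ∈ s then t 0 else univ) ×ˢ
        Set.pi ((s.erase 0).image Nat.pred : Finset ℕ) (fun i => t (i + 1)) := by
    ext ⟨a, x⟩
    simp only [mem_preimage, Set.mem_pi, Finset.mem_coe, mem_prod, Finset.mem_image,
      Finset.mem_erase]
    constructor
    · intro h
      refine ⟨?_, ?_⟩
      · split_ifs with h0
        · exact h 0 h0
        · trivial
      · rintro _ ⟨j, ⟨hj0, hj⟩, rfl⟩
        obtain ⟨j, rfl⟩ := Nat.exists_eq_succ_of_ne_zero hj0
        exact h _ hj
    · rintro ⟨h0, h1⟩ i hi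
      cases i with
      | zero => simpa [hi, seqCons] using h0
      | succ i => exact h1 i ⟨i + 1, ⟨by simp, hi⟩, rfl⟩
  rw [Measure.map_apply measurable_seqCons
    (MeasurableSet.pi s.countable_toSet fun i _ => ht i), hpre, Measure.prod_prod,
    Measure.infinitePi_pi _ fun i _ => ht _, Finset.prod_image]
  · have h2 : ∏ x ∈ s.erase 0, ν (t (x.pred + 1)) = ∏ x ∈ s.erase 0, ν (t x) :=
      Finset.prod_congr rfl fun x hx => by
        rw [Nat.pred_eq_sub_one, Nat.sub_add_cancel
          (Nat.one_le_iff_ne_zero.2 (Finset.ne_of_mem_erase hx))]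
    rw [h2]
    split_ifs with h0
    · exact Finset.mul_prod_erase s (fun x => ν (t x)) h0
    · rw [measure_univ, one_mul, Finset.erase_eq_of_notMem h0]
  · intro a ha b hb hab
    have ha := Finset.ne_of_mem_erase ha
    have hb := Finset.ne_of_mem_erase hb
    simp only [Nat.pred_eq_sub_one] at hab
    omega

/-- The position of the `i`-th cluster. -/
noncomputable def arrival (T : ℕ → ℝ) (i : ℕ) : ℝ≥0 := ∑ l ∈ Finset.range (i + 1), (T l).toNNReal

theorem arrival_seqCons_zero (r : ℝ) (T : ℕ → ℝ) : arrival (seqCons r T) 0 = r.toNNReal := by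
  simp [arrival, seqCons]

theorem arrival_seqCons_succ (r : ℝ) (T : ℕ → ℝ) (i : ℕ) :
    arrival (seqCons r T) (i + 1) = r.toNNReal + arrival T i := by
  rw [arrival, Finset.sum_range_succ', add_comm]
  rfl

theorem measurable_arrival (i : ℕ) : Measurable fun T => arrival T i := by
  unfold arrival
  fun_prop

/-- The random measure `∑ D_i δ_{T_0 + ⋯ + T_i}`. -/
noncomputable def cpMeasure (ω : (ℕ → ℝ) × (ℕ → ℕ)) : Measure ℝ≥0 := pointSum ω.2 (arrival ω.1)

theorem measurable_cpMeasure : Measurable cpMeasure := by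
  refine Measure.measurable_of_measurable_coe _ fun B hB => ?_
  simp only [cpMeasure, pointSum_apply _ _ hB]
  refine Measurable.tsum fun i => ?_
  refine Measurable.mul ?_ ?_
  · exact (measurable_from_top (f := fun n : ℕ => (n : ℝ≥0∞))).comp
      ((measurable_pi_apply i).comp measurable_snd)
  · exact (measurable_one.indicator hB).comp ((measurable_arrival i).comp measurable_fst)

theorem cpMeasure_seqCons_apply (r : ℝ) (d : ℕ) (ω : (ℕ → ℝ) × (ℕ → ℕ)) {B : Set ℝ≥0}
    (hB : MeasurableSet B) :
    cpMeasure (seqCons r ω.1, seqCons d ω.2) B =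
      d * B.indicator 1 r.toNNReal + cpMeasure ω ((fun x => r.toNNReal + x) ⁻¹' B) := by
  rw [cpMeasure, cpMeasure, pointSum_apply _ _ hB,
    pointSum_apply _ _ (hB.preimage (measurable_const_add _)), tsum_eq_zero_add' ENNReal.summable]
  simp only [arrival_seqCons_zero, arrival_seqCons_succ]
  rfl

/-- The part of `ν` after time `t`, as seen from `t`. -/
noncomputable def shiftBack (t : ℝ≥0) (ν : Measure ℝ≥0) : Measure ℝ≥0 :=
  (ν.restrict (Ici t)).map (fun x => x - t)

theorem shiftBack_apply (t : ℝ≥0) (ν : Measure ℝ≥0) {B : Set ℝ≥0} (hB : MeasurableSet B) :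
    shiftBack t ν B = ν ((fun x => x - t) ⁻¹' B ∩ Ici t) := by
  have hm : Measurable fun x : ℝ≥0 => x - t := measurable_id.sub_const t
  rw [shiftBack, Measure.map_apply hm hB, Measure.restrict_apply (hm hB)]

theorem measurable_shiftBack (t : ℝ≥0) : Measurable (shiftBack t) := by
  refine Measure.measurable_of_measurable_coe _ fun B hB => ?_
  simp only [shiftBack_apply t _ hB]
  exact Measure.measurable_coe ((measurable_id.sub_const t hB).inter measurableSet_Ici)

/-- Once the first cluster, at `r < t`, is removed and the origin moved to `r`, the remaining
process is cut at `t - r`. This is the recursive case of the renewal argument. -/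
theorem cpMeasure_seqCons_of_lt {r : ℝ} {t : ℝ≥0} (h : r.toNNReal < t) (d : ℕ)
    (ω : (ℕ → ℝ) × (ℕ → ℕ)) :
    cpMeasure (seqCons r ω.1, seqCons d ω.2) (Iio t) = d + cpMeasure ω (Iio (t - r.toNNReal)) ∧
    shiftBack t (cpMeasure (seqCons r ω.1, seqCons d ω.2)) =
      shiftBack (t - r.toNNReal) (cpMeasure ω) := by
  constructor
  · rw [cpMeasure_seqCons_apply _ _ _ measurableSet_Iio]
    congr 1
    · simp [h]
    · congr 1
      ext x
      simp [lt_tsub_iff_left]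
  · ext B hB
    have hm : MeasurableSet ((fun x => x - t) ⁻¹' B ∩ Ici t) :=
      (measurable_id.sub_const t hB).inter measurableSet_Ici
    rw [shiftBack_apply _ _ hB, shiftBack_apply _ _ hB, cpMeasure_seqCons_apply _ _ _ hm,
      indicator_of_notMem fun hx => absurd hx.2 (not_le.2 h), mul_zero, zero_add]
    congr 1
    ext x
    simp only [mem_inter_iff, mem_preimage, mem_Ici, tsub_le_iff_left]
    refine and_congr_left fun hx => ?_
    have : r.toNNReal + x - t = x - (t - r.toNNReal) := by
      rw [tsub_tsub_eq_add_tsub_of_le h.le, add_comm]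
    rw [this]

/-- If the first cluster comes at `r ≥ t`, cutting at `t` only shortens the first waiting time to `r
- t`; lack of memory of the exponential law then applies. -/
theorem cpMeasure_seqCons_of_le {r : ℝ} {t : ℝ≥0} (h : (t : ℝ) ≤ r) (d : ℕ)
    (ω : (ℕ → ℝ) × (ℕ → ℕ)) :
    cpMeasure (seqCons r ω.1, seqCons d ω.2) (Iio t) = 0 ∧
    shiftBack t (cpMeasure (seqCons r ω.1, seqCons d ω.2)) =
      cpMeasure (seqCons (r - t) ω.1, seqCons d ω.2) := by
  have h' : t ≤ r.toNNReal := by simpa using Real.toNNReal_mono h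
  have h'' : (r - t).toNNReal = r.toNNReal - t := by
    ext
    rw [NNReal.coe_sub h', Real.coe_toNNReal _ (sub_nonneg.2 h),
      Real.coe_toNNReal _ (t.coe_nonneg.trans h)]
  constructor
  · rw [cpMeasure_seqCons_apply _ _ _ measurableSet_Iio, indicator_of_notMem (by simpa using h'),
      mul_zero, zero_add]
    convert! measure_empty (μ := cpMeasure ω)
    ext x
    simpa using h'.trans le_self_add
  · ext B hB
    have hm : MeasurableSet ((fun x => x - t) ⁻¹' B ∩ Ici t) :=
      (measurable_id.sub_const t hB).inter measurableSet_Ici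
    rw [shiftBack_apply _ _ hB, cpMeasure_seqCons_apply _ _ _ hm,
      cpMeasure_seqCons_apply _ _ _ hB, h'']
    congr 1
    · congr 1
      by_cases hx : r.toNNReal - t ∈ B
      · have hx' : r.toNNReal ∈ (fun x => x - t) ⁻¹' B ∩ Ici t := ⟨hx, h'⟩
        rw [indicator_of_mem hx, indicator_of_mem hx']
        rfl
      · rw [indicator_of_notMem hx, indicator_of_notMem fun hx' => hx hx'.1]
    · congr 1
      ext x
      have hx : t ≤ r.toNNReal + x := h'.trans le_self_add
      simp only [mem_inter_iff, mem_preimage, mem_Ici, hx, and_true]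
      rw [tsub_add_eq_add_tsub h']

/-! ### Decomposition of the compound Poisson law at the first cluster. -/

section Law

variable (θ : {r : ℝ // 0 < r}) (p : PMF ℕ)

theorem lintegral_toMeasure (p : PMF ℕ) (F : ℕ → ℝ≥0∞) :
    ∫⁻ d, F d ∂p.toMeasure = ∑' d, p d * F d := by
  rw [lintegral_countable']
  exact tsum_congr fun d => by
    rw [PMF.toMeasure_apply_singleton _ _ (measurableSet_singleton d), mul_comm]

/-- Decomposition of the law of the waiting times and multiplicities according to the first
cluster. -/
theorem lintegral_compoundPoissonSpace {F : (ℕ → ℝ) × (ℕ → ℕ) → ℝ≥0∞} (hF : Measurable F) :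
    ∫⁻ ω, F ω ∂compoundPoissonSpace θ p =
      ∫⁻ r, ∑' d, p d * ∫⁻ ω, F (seqCons r ω.1, seqCons d ω.2) ∂compoundPoissonSpace θ p
        ∂expMeasure (θ : ℝ) := by
  have := isProbabilityMeasure_expMeasure θ.2
  have hcons : Measurable fun x : (ℝ × (ℕ → ℝ)) × (ℕ × (ℕ → ℕ)) =>
      (seqCons x.1.1 x.1.2, seqCons x.2.1 x.2.2) :=
    (measurable_seqCons.comp measurable_fst).prodMk (measurable_seqCons.comp measurable_snd)
  have hlaw : compoundPoissonSpace θ p =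
      (((expMeasure (θ : ℝ)).prod (Measure.infinitePi fun _ : ℕ => expMeasure (θ : ℝ))).prod
        (p.toMeasure.prod (Measure.infinitePi fun _ : ℕ => p.toMeasure))).map
        fun x => (seqCons x.1.1 x.1.2, seqCons x.2.1 x.2.2) := by
    conv_lhs => rw [compoundPoissonSpace, ← map_seqCons_infinitePi (expMeasure (θ : ℝ)),
      ← map_seqCons_infinitePi p.toMeasure, Measure.map_prod_map _ _ measurable_seqCons
      measurable_seqCons]
    rfl
  have hG : Measurable fun x : (ℝ × (ℕ → ℝ)) × (ℕ × (ℕ → ℕ)) =>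
      F (seqCons x.1.1 x.1.2, seqCons x.2.1 x.2.2) := hF.comp hcons
  conv_lhs => rw [hlaw]
  rw [lintegral_map hF hcons, lintegral_prod _ hG.aemeasurable]
  rw [lintegral_prod _ (Measurable.lintegral_prod_right' hG).aemeasurable]
  refine lintegral_congr fun r => ?_
  rw [← lintegral_toMeasure]
  have e : ∀ T : ℕ → ℝ, ∫⁻ y, F (seqCons r T, seqCons y.1 y.2)
        ∂(p.toMeasure.prod (Measure.infinitePi fun _ : ℕ => p.toMeasure)) =
      ∫⁻ d, ∫⁻ D, F (seqCons r T, seqCons d D) ∂(Measure.infinitePi fun _ : ℕ => p.toMeasure)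
        ∂p.toMeasure := fun T => by
    rw [lintegral_prod]
    exact (hG.comp (measurable_prodMk_left (x := ((r, T) : ℝ × (ℕ → ℝ))))).aemeasurable
  simp only [e]
  rw [lintegral_lintegral_swap]
  · refine lintegral_congr fun d => ?_
    rw [compoundPoissonSpace, lintegral_prod]
    have : Measurable fun ω : (ℕ → ℝ) × (ℕ → ℕ) => ((r, ω.1), (d, ω.2)) := by fun_prop
    exact (hG.comp this).aemeasurable
  · have h3 : Measurable fun y : ((ℕ → ℝ) × ℕ) × (ℕ → ℕ) => ((r, y.1.1), (y.1.2, y.2)) := by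
      fun_prop
    exact (Measurable.lintegral_prod_right' (hG.comp h3)).aemeasurable

end Law


/-! ### Independence of past and future for the compound Poisson process. -/

section Law

variable (θ : {r : ℝ // 0 < r}) (p : PMF ℕ)

/-- The probability of the event `A` given that the first cluster is at `r`. -/
noncomputable def firstCond (A : Set ((ℕ → ℝ) × (ℕ → ℕ))) (r : ℝ) : ℝ≥0∞ :=
  ∑' d, p d * compoundPoissonSpace θ p {ω | (seqCons r ω.1, seqCons d ω.2) ∈ A}

variable {p}

theorem measurable_seqCons_pair (d : ℕ) : Measurable
    fun x : ℝ × ((ℕ → ℝ) × (ℕ → ℕ)) => (seqCons x.1 x.2.1, seqCons d x.2.2) := by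
  have h1 : Measurable fun x : ℝ × ((ℕ → ℝ) × (ℕ → ℕ)) => (x.1, x.2.1) := by fun_prop
  have h2 : Measurable fun x : ℝ × ((ℕ → ℝ) × (ℕ → ℕ)) => (d, x.2.2) := by fun_prop
  exact (measurable_seqCons.comp h1).prodMk (measurable_seqCons.comp h2)

theorem measurable_firstCond {A : Set ((ℕ → ℝ) × (ℕ → ℕ))} (hA : MeasurableSet A) :
    Measurable (firstCond θ p A) := by
  refine Measurable.tsum fun d => Measurable.const_mul ?_ _
  exact measurable_measure_prodMk_left (measurable_seqCons_pair d hA)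

theorem compoundPoissonSpace_apply {A : Set ((ℕ → ℝ) × (ℕ → ℕ))} (hA : MeasurableSet A) :
    compoundPoissonSpace θ p A = ∫⁻ r, firstCond θ p A r ∂expMeasure (θ : ℝ) := by
  rw [← lintegral_indicator_one hA,
    lintegral_compoundPoissonSpace θ p (measurable_one.indicator hA)]
  refine lintegral_congr fun r => tsum_congr fun d => ?_
  congr 1
  have hm : MeasurableSet {ω : (ℕ → ℝ) × (ℕ → ℕ) | (seqCons r ω.1, seqCons d ω.2) ∈ A} :=
    ((measurable_seqCons_pair d).comp measurable_prodMk_left) hA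
  rw [← lintegral_indicator_one hm]
  rfl

theorem lintegral_expMeasure {F : ℝ → ℝ≥0∞} (hF : Measurable F) :
    ∫⁻ r, F r ∂expMeasure (θ : ℝ) =
      ∫⁻ r in Ici 0, ENNReal.ofReal (θ * Real.exp (-(θ * r))) * F r := by
  have hm : Measurable (exponentialPDF (θ : ℝ)) :=
    (measurable_exponentialPDFReal (θ : ℝ)).ennreal_ofReal
  have : expMeasure (θ : ℝ) = volume.withDensity (exponentialPDF θ) := rfl
  rw [this, lintegral_withDensity_eq_lintegral_mul _ hm hF, ← lintegral_indicator measurableSet_Ici]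
  refine lintegral_congr fun r => ?_
  by_cases hr : 0 ≤ r
  · rw [indicator_of_mem (mem_Ici.2 hr), Pi.mul_apply, exponentialPDF_of_nonneg hr]
  · rw [indicator_of_notMem (by simpa using hr), Pi.mul_apply,
      exponentialPDF_of_neg (not_le.1 hr), zero_mul]

/-- The exponential law has no memory. -/
theorem setLIntegral_exp_shift (F : ℝ → ℝ≥0∞) (t : ℝ) :
    ∫⁻ r in Ici t, ENNReal.ofReal (θ * Real.exp (-(θ * r))) * F (r - t) =
      ENNReal.ofReal (Real.exp (-(θ * t))) *
        ∫⁻ r in Ici 0, ENNReal.ofReal (θ * Real.exp (-(θ * r))) * F r := by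
  rw [← lintegral_const_mul' _ _ ENNReal.ofReal_ne_top, ← lintegral_indicator measurableSet_Ici,
    ← lintegral_indicator measurableSet_Ici,
    ← lintegral_add_right_eq_self (fun r => (Ici t).indicator _ r) t]
  refine lintegral_congr fun r => ?_
  by_cases hr : 0 ≤ r
  · rw [indicator_of_mem (by simpa using hr), indicator_of_mem (mem_Ici.2 hr), add_sub_cancel_right,
      ← mul_assoc, ← ENNReal.ofReal_mul (Real.exp_pos _).le]
    congr 2
    rw [mul_add, neg_add, Real.exp_add]
    ring
  · rw [indicator_of_notMem (by simpa using hr), indicator_of_notMem (by simpa using hr)]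

/-- The event that there is mass `k` before time `t`, and that the process after time `t`,
seen from `t`, belongs to `H`. -/
def splitEvent (t : ℝ≥0) (k : ℕ) (H : Set (Measure ℝ≥0)) : Set ((ℕ → ℝ) × (ℕ → ℕ)) :=
  {ω | cpMeasure ω (Iio t) = k ∧ shiftBack t (cpMeasure ω) ∈ H}

theorem measurableSet_splitEvent (t : ℝ≥0) (k : ℕ) {H : Set (Measure ℝ≥0)}
    (hH : MeasurableSet H) : MeasurableSet (splitEvent t k H) :=
  ((Measure.measurable_coe measurableSet_Iio).comp measurable_cpMeasure
    (measurableSet_singleton _)).inter ((measurable_shiftBack t).comp measurable_cpMeasure hH)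

/-- A first cluster of size `d` leaves mass `i = k - d` for the rest. The term `i = k` vanishes
because `p 0 = 0`, so only smaller masses occur and induction on `k` is possible. -/
theorem firstCond_splitEvent_of_lt (hp : p 0 = 0) {t : ℝ≥0} {r : ℝ} (hr : r.toNNReal < t) (k : ℕ)
    (H : Set (Measure ℝ≥0)) :
    firstCond θ p (splitEvent t k H) r = ∑ i ∈ Finset.range k,
      p (k - i) * compoundPoissonSpace θ p (splitEvent (t - r.toNNReal) i H) := by
  have hset : ∀ d, {ω : (ℕ → ℝ) × (ℕ → ℕ) | (seqCons r ω.1, seqCons d ω.2) ∈ splitEvent t k H} =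
      {ω | d + cpMeasure ω (Iio (t - r.toNNReal)) = k ∧
        shiftBack (t - r.toNNReal) (cpMeasure ω) ∈ H} := fun d => by
    ext ω
    obtain ⟨h1, h2⟩ := cpMeasure_seqCons_of_lt hr d ω
    simp only [splitEvent, mem_ofPred_eq, h1, h2]
  simp only [firstCond, hset]
  rw [tsum_eq_sum (s := Finset.range (k + 1))]
  · set F : ℕ → ℝ≥0∞ := fun i =>
      p (k - i) * compoundPoissonSpace θ p (splitEvent (t - r.toNNReal) i H) with hF
    have h1 : ∀ d ∈ Finset.range (k + 1), p d * compoundPoissonSpace θ p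
        {ω | d + cpMeasure ω (Iio (t - r.toNNReal)) = k ∧
          shiftBack (t - r.toNNReal) (cpMeasure ω) ∈ H} = F (k - d) := fun d hd => by
      have hdk : d ≤ k := Nat.lt_succ_iff.1 (Finset.mem_range.1 hd)
      rw [hF]
      dsimp only
      rw [Nat.sub_sub_self hdk]
      congr 2
      ext ω
      simp only [splitEvent, mem_ofPred_eq]
      refine and_congr_left fun _ => ?_
      conv_lhs => rw [← Nat.add_sub_cancel' hdk, Nat.cast_add]
      exact ENNReal.add_right_inj (ENNReal.natCast_ne_top d)
    rw [Finset.sum_congr rfl h1, Finset.sum_flip, Finset.sum_range_succ]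
    simp [hF, hp]
  · intro d hd
    have hkd : k < d := by simpa using hd
    convert! mul_zero _
    refine measure_mono_null (t := ∅) ?_ measure_empty
    rintro ω ⟨h, _⟩
    have : (d : ℝ≥0∞) ≤ k := h ▸ le_self_add
    exact absurd (Nat.cast_le.1 this) (not_le.2 hkd)

theorem firstCond_splitEvent_of_le {t : ℝ≥0} {r : ℝ} (hr : (t : ℝ) ≤ r) (k : ℕ)
    (H : Set (Measure ℝ≥0)) :
    firstCond θ p (splitEvent t k H) r =
      if k = 0 then firstCond θ p (cpMeasure ⁻¹' H) (r - t) else 0 := by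
  have hset : ∀ d, {ω : (ℕ → ℝ) × (ℕ → ℕ) | (seqCons r ω.1, seqCons d ω.2) ∈ splitEvent t k H} =
      {ω | k = 0 ∧ (seqCons (r - t) ω.1, seqCons d ω.2) ∈ cpMeasure ⁻¹' H} := fun d => by
    ext ω
    obtain ⟨h1, h2⟩ := cpMeasure_seqCons_of_le hr d ω
    simp only [splitEvent, mem_ofPred_eq, h1, h2, mem_preimage]
    refine and_congr_left fun _ => ?_
    rw [eq_comm, Nat.cast_eq_zero]
  simp only [firstCond, hset]
  split_ifs with h
  · simp [h]
  · simp [h]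

/-- Independence of the past and the future at time `t`, with the law of the total mass before
time `t`. -/
theorem compoundPoissonSpace_splitEvent (hp : p 0 = 0) (k : ℕ) (t : ℝ≥0) {H : Set (Measure ℝ≥0)}
    (hH : MeasurableSet H) :
    compoundPoissonSpace θ p (splitEvent t k H) =
      ENNReal.ofReal (cpMass θ (fun i => (p i).toReal) t k) *
        compoundPoissonSpace θ p (cpMeasure ⁻¹' H) := by
  induction k using Nat.strong_induction_on generalizing t with
  | _ k ih =>
    set π : ℕ → ℝ := fun i => (p i).toReal with hπ
    set c := compoundPoissonSpace θ p (cpMeasure ⁻¹' H) with hc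
    have hπ0 : ∀ i, 0 ≤ π i := fun i => ENNReal.toReal_nonneg
    have hmH : MeasurableSet (cpMeasure ⁻¹' H) := measurable_cpMeasure hH
    have hmA := measurableSet_splitEvent t k hH
    set e : ℝ → ℝ≥0∞ := fun r => ENNReal.ofReal (θ * Real.exp (-(θ * r))) with he
    have hsplit : Ici (0 : ℝ) = Ico 0 (t : ℝ) ∪ Ici (t : ℝ) :=
      (Ico_union_Ici_eq_Ici t.coe_nonneg).symm
    rw [compoundPoissonSpace_apply θ hmA, lintegral_expMeasure θ (measurable_firstCond θ hmA),
      hsplit, lintegral_union measurableSet_Ici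
        (Set.disjoint_left.2 fun x hx hx' => not_lt.2 hx' hx.2)]
    -- No cluster before `t`: the mass is `0`, and by lack of memory the process seen from `t` has
    -- the original law.
    have hlate : ∫⁻ r in Ici (t : ℝ), e r * firstCond θ p (splitEvent t k H) r =
        ENNReal.ofReal (if k = 0 then Real.exp (-(θ * t)) else 0) * c := by
      rw [setLIntegral_congr_fun (g := fun r => e r *
        (fun s => if k = 0 then firstCond θ p (cpMeasure ⁻¹' H) s else 0) (r - t))
        measurableSet_Ici fun r hr => by
          dsimp only; rw [firstCond_splitEvent_of_le θ (mem_Ici.1 hr)]]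
      rw [setLIntegral_exp_shift θ
        (fun s => if k = 0 then firstCond θ p (cpMeasure ⁻¹' H) s else 0) t]
      split_ifs with hk
      · rw [← lintegral_expMeasure θ (measurable_firstCond θ hmH),
          ← compoundPoissonSpace_apply θ hmH]
      · simp
    set g : ℝ → ℝ := fun r => ∑ i ∈ Finset.range k, π (k - i) * cpMass θ π (t - r) i with hg
    have hgc : Continuous g := continuous_finsetSum _ fun i _ =>
      continuous_const.mul ((continuous_cpMass i).comp (continuous_const.sub continuous_id))
    have hfc : Continuous fun r => θ * Real.exp (-(θ * r)) * g r := by fun_prop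
    have hg0 : ∀ r ∈ Icc 0 (t : ℝ), 0 ≤ g r := fun r hr => Finset.sum_nonneg fun i _ =>
      mul_nonneg (hπ0 _) (cpMass_nonneg θ.2.le hπ0 _ (sub_nonneg.2 hr.2))
    -- First cluster before `t`: the induction hypothesis at time `t - r` factors out the future
    -- `c`.
    have hearly : ∫⁻ r in Ico 0 (t : ℝ), e r * firstCond θ p (splitEvent t k H) r =
        ENNReal.ofReal (∫ r in (0 : ℝ)..t, θ * Real.exp (-(θ * r)) * g r) * c := by
      have h1 : ∀ r ∈ Ico 0 (t : ℝ), e r * firstCond θ p (splitEvent t k H) r =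
          ENNReal.ofReal (θ * Real.exp (-(θ * r)) * g r) * c := fun r hr => by
        have hrt : r.toNNReal < t := (Real.toNNReal_lt_iff_lt_coe hr.1).2 hr.2
        rw [firstCond_splitEvent_of_lt θ hp hrt,
          ENNReal.ofReal_mul (mul_nonneg θ.2.le (Real.exp_pos _).le), mul_assoc]
        congr 1
        have htr : ((t - r.toNNReal : ℝ≥0) : ℝ) = t - r := by
          rw [NNReal.coe_sub hrt.le, Real.coe_toNNReal _ hr.1]
        rw [hg, ENNReal.ofReal_sum_of_nonneg fun i _ => mul_nonneg (hπ0 _)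
          (cpMass_nonneg θ.2.le hπ0 _ (sub_nonneg.2 hr.2.le)), Finset.sum_mul]
        refine Finset.sum_congr rfl fun i hi => ?_
        rw [ih i (Finset.mem_range.1 hi), htr, ENNReal.ofReal_mul (hπ0 _), hπ, mul_assoc,
          ENNReal.ofReal_toReal (p.apply_ne_top _)]
      rw [setLIntegral_congr_fun measurableSet_Ico h1,
        lintegral_mul_const' _ _ (measure_ne_top _ _),
        intervalIntegral.integral_of_le t.coe_nonneg, ← integral_Ico_eq_integral_Ioc,
        ofReal_integral_eq_lintegral_ofReal]
      · exact (hfc.integrableOn_Icc (a := 0) (b := (t : ℝ))).mono_set Ico_subset_Icc_self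
      · refine (ae_restrict_iff' measurableSet_Ico).2 (Eventually.of_forall fun r hr => ?_)
        exact mul_nonneg (mul_nonneg θ.2.le (Real.exp_pos _).le) (hg0 r (Ico_subset_Icc_self hr))
    -- The two coefficients of `c` are exactly the two terms of the renewal equation.
    rw [hlate, hearly, cpMass_renewal, ← add_mul, add_comm, ← ENNReal.ofReal_add]
    · split_ifs <;> positivity
    · exact intervalIntegral.integral_nonneg t.coe_nonneg fun r hr =>
        mul_nonneg (mul_nonneg θ.2.le (Real.exp_pos _).le) (hg0 r hr)

theorem measurableSet_hasCounts_measure (h : ℝ≥0) {L : ℕ} (k : Fin L → ℕ) :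
    MeasurableSet {ν : Measure ℝ≥0 | HasCounts h k ν} := by
  simp only [HasCounts, ofPred_forall]
  exact MeasurableSet.iInter fun l =>
    Measure.measurable_coe (measurableSet_gridCell h l) (measurableSet_singleton _)

theorem shiftBack_gridCell (h : ℝ≥0) (ν : Measure ℝ≥0) (l : ℕ) :
    shiftBack h ν (gridCell h l) = ν (gridCell h (l + 1)) := by
  rw [shiftBack_apply _ _ (measurableSet_gridCell h l)]
  congr 1
  ext x
  simp only [gridCell, mem_inter_iff, mem_preimage, mem_Ico, mem_Ici]
  constructor
  · rintro ⟨⟨h1, h2⟩, h3⟩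
    rw [le_tsub_iff_right h3] at h1
    rw [tsub_lt_iff_right h3] at h2
    push_cast
    exact ⟨by linarith, by linarith⟩
  · rintro ⟨h1, h2⟩
    push_cast at h1 h2
    have h3 : h ≤ x := le_trans (by rw [add_mul, one_mul]; exact le_add_self) h1
    rw [le_tsub_iff_right h3, tsub_lt_iff_right h3]
    exact ⟨⟨by linarith, by linarith⟩, h3⟩

theorem hasCounts_succ_iff (h : ℝ≥0) {L : ℕ} (k : Fin (L + 1) → ℕ) (ν : Measure ℝ≥0) :
    HasCounts h k ν ↔ ν (Iio h) = k 0 ∧ HasCounts h (fun l => k l.succ) (shiftBack h ν) := by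
  have h0 : gridCell h 0 = Iio h := by
    ext x
    simp [gridCell]
  simp only [HasCounts, Fin.forall_fin_succ, Fin.val_zero, Fin.val_succ, h0, shiftBack_gridCell]

/-- The counts of the compound Poisson process on the cells of a grid are independent. -/
theorem compoundPoissonSpace_hasCounts (hp : p 0 = 0) (h : ℝ≥0) {L : ℕ} (k : Fin L → ℕ) :
    compoundPoissonSpace θ p {ω | HasCounts h k (cpMeasure ω)} =
      ∏ l, ENNReal.ofReal (cpMass θ (fun i => (p i).toReal) h (k l)) := by
  induction L with
  | zero => simp [HasCounts]
  | succ L ih =>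
    rw [Fin.prod_univ_succ, ← ih fun l => k l.succ]
    have := compoundPoissonSpace_splitEvent θ hp (k 0) h
      (measurableSet_hasCounts_measure h fun l => k l.succ)
    rw [preimage_ofPred_eq] at this
    rw [← this]
    simp only [hasCounts_succ_iff, splitEvent, mem_ofPred_eq]

/-- Almost surely the clusters do not accumulate. -/
theorem ae_tendsto_arrival : ∀ᵐ ω ∂compoundPoissonSpace θ p,
    Tendsto (arrival ω.1) atTop atTop := by
  have := isProbabilityMeasure_expMeasure θ.2
  set P := Measure.infinitePi fun _ : ℕ => expMeasure (θ : ℝ)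
  have hc : expMeasure (θ : ℝ) (Iic 1) < 1 := by
    have h1 := cdf_expMeasure_eq θ.2 1
    rw [if_pos zero_le_one, cdf_eq_real] at h1
    rw [← ENNReal.toReal_lt_toReal (measure_ne_top _ _) ENNReal.one_ne_top, ← measureReal_def, h1]
    have := Real.exp_pos (-((θ : ℝ) * 1))
    simpa using this
  -- For every `m` this event has probability at most the `m`-th power of the probability of a
  -- waiting time at most `1`. Hence almost surely infinitely many waiting times exceed `1` and
  -- their sum diverges.
  have hnull : ∀ n : ℕ, P {T | ∀ i, n ≤ i → T i ≤ 1} = 0 := fun n => by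
    refine le_antisymm (ge_of_tendsto' (ENNReal.tendsto_pow_atTop_nhds_zero_of_lt_one hc)
      fun m => ?_) zero_le
    have hsub : {T : ℕ → ℝ | ∀ i, n ≤ i → T i ≤ 1} ⊆
        Set.pi (Finset.Ico n (n + m) : Finset ℕ) fun _ => Iic (1 : ℝ) :=
      fun T hT i hi => hT i (Finset.mem_Ico.1 hi).1
    refine (measure_mono hsub).trans (le_of_eq ?_)
    rw [Measure.infinitePi_pi _ fun _ _ => measurableSet_Iic]
    simp
  have hae : ∀ᵐ T ∂P, Tendsto (arrival T) atTop atTop := by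
    have h1 : ∀ᵐ T ∂P, ∀ n : ℕ, ¬ ∀ i, n ≤ i → T i ≤ 1 :=
      ae_all_iff.2 fun n => measure_eq_zero_iff_ae_notMem.1 (hnull n)
    filter_upwards [h1] with T hT
    have hns : ¬ Summable fun i => (T i).toNNReal := fun hs => by
      have := (NNReal.tendsto_atTop_zero_of_summable hs).eventually (gt_mem_nhds zero_lt_one)
      obtain ⟨n, hn⟩ := eventually_atTop.1 this
      refine hT n fun i hi => ?_
      have := (hn i hi).le
      rwa [Real.toNNReal_le_one] at this
    exact (NNReal.not_summable_iff_tendsto_nat_atTop.1 hns).comp (tendsto_add_atTop_nat 1)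
  exact Measure.quasiMeasurePreserving_fst.ae hae

end Law


/-! ### Visits to a set and clusters -/

section Visits

variable {X : Type*} {f : X → X} {U : Set X}

/-- The number of visits to `U` at times `a ≤ i < b`. -/
noncomputable def visits (f : X → X) (U : Set X) (a b : ℕ) (x : X) : ℕ :=
  ∑ i ∈ Finset.Ico a b, U.indicator (fun _ => 1) (f^[i] x)

theorem visits_add {a b c : ℕ} (hab : a ≤ b) (hbc : b ≤ c) (x : X) :
    visits f U a b x + visits f U b c x = visits f U a c x :=
  Finset.sum_Ico_consecutive _ hab hbc

theorem visits_iterate (a b s : ℕ) (x : X) :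
    visits f U a b (f^[s] x) = visits f U (a + s) (b + s) x := by
  simp only [visits, ← Function.iterate_add_apply]
  exact Finset.sum_Ico_add' (fun i => U.indicator (fun _ => 1) (f^[i] x)) a b s

theorem visits_eq_zero_iff {a b : ℕ} {x : X} :
    visits f U a b x = 0 ↔ ∀ i, a ≤ i → i < b → f^[i] x ∉ U := by
  simp [visits, Finset.sum_eq_zero_iff]

theorem visits_self (a : ℕ) (x : X) : visits f U a a x = 0 := by simp [visits]

theorem visits_succ_of_mem {a b : ℕ} {x : X} (hab : a < b) (h : f^[a] x ∈ U) :
    visits f U a b x = visits f U (a + 1) b x + 1 := by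
  rw [visits, Finset.sum_eq_sum_Ico_succ_bot hab, indicator_of_mem h, add_comm]
  rfl

theorem visits_succ_of_notMem {a b : ℕ} {x : X} (hab : a < b) (h : f^[a] x ∉ U) :
    visits f U a b x = visits f U (a + 1) b x := by
  rw [visits, Finset.sum_eq_sum_Ico_succ_bot hab, indicator_of_notMem h, zero_add]
  rfl

/-- The points of `U` with exactly `κ` visits to `U` at the times `1, …, q`. -/
def clusterSet (f : X → X) (U : Set X) (q κ : ℕ) : Set X :=
  {x | x ∈ U ∧ visits f U 1 (q + 1) x = κ}

/-- Points of `U` do not visit `U` at the times `q + 1, …, M`. -/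
def GapAfter (f : X → X) (U : Set X) (q M : ℕ) : Prop :=
  ∀ x ∈ U, ∀ s, q < s → s ≤ M → f^[s] x ∉ U

/-- The window of `f^[r] x` consists of the times `r + 1, …, r + q` of `x`; those beyond `q` are at
most `2 * q` and fall into the gap. -/
theorem GapAfter.visits_iterate_eq {q : ℕ} (h : GapAfter f U q (2 * q)) {x : X} (hx : x ∈ U)
    {r : ℕ} (hr : r ≤ q) : visits f U 1 (q + 1) (f^[r] x) = visits f U (r + 1) (q + 1) x := by
  rw [visits_iterate, add_comm 1 r, ← visits_add (a := r + 1) (b := q + 1) (by lia) (by lia),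
    (visits_eq_zero_iff (a := q + 1)).2 fun i h1 h2 => h x hx i (by lia) (by lia), add_zero]

theorem exists_first_visit {q : ℕ} {x : X} (h : visits f U 1 (q + 1) x ≠ 0) :
    ∃ r, 1 ≤ r ∧ r ≤ q ∧ f^[r] x ∈ U ∧ ∀ i, 1 ≤ i → i < r → f^[i] x ∉ U := by
  classical
  have hex : ∃ r, 1 ≤ r ∧ r ≤ q ∧ f^[r] x ∈ U := by
    by_contra! hc
    exact h (visits_eq_zero_iff.2 fun i h1 h2 => hc i h1 (by lia))
  obtain ⟨h1, h2, h3⟩ := Nat.find_spec hex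
  exact ⟨Nat.find hex, h1, h2, h3, fun i hi hlt hU => Nat.find_min hex hlt ⟨hi, by lia, hU⟩⟩

theorem visits_eq_of_first_visit {q r : ℕ} {x : X} (hr1 : 1 ≤ r) (hrq : r ≤ q) (hr : f^[r] x ∈ U)
    (hfirst : ∀ i, 1 ≤ i → i < r → f^[i] x ∉ U) :
    visits f U 1 (q + 1) x = visits f U (r + 1) (q + 1) x + 1 := by
  rw [← visits_add (b := r) hr1 (by lia), visits_eq_zero_iff.2 hfirst, zero_add,
    visits_succ_of_mem (by lia) hr]

/-- Along a cluster the number of remaining visits drops by one at each visit. So a point with more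
than `κ` of them has a next visit with at least `κ`, while a point with exactly `κ` never returns to
such a point: escaping means having exactly `κ`. -/
theorem nestedU_eq (φ : X → EReal) (u : ℝ) {q : ℕ}
    (h : GapAfter f (exceedSet φ u) q (2 * q)) (κ : ℕ) :
    nestedU f φ q u κ =
      {x | x ∈ exceedSet φ u ∧ κ ≤ visits f (exceedSet φ u) 1 (q + 1) x} := by
  set U := exceedSet φ u
  have key : ∀ κ, escapeSet f q {x | x ∈ U ∧ κ ≤ visits f U 1 (q + 1) x} = clusterSet f U q κ := by
    intro κ
    ext x
    simp only [escapeSet, mem_inter_iff, mem_ofPred_eq, mem_iInter, Finset.mem_Icc, mem_preimage,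
      mem_compl_iff, clusterSet, and_assoc]
    refine and_congr_right fun hx => ⟨fun ⟨h1, h2⟩ => ?_, fun h1 => ⟨h1.ge, fun i hi hU => ?_⟩⟩
    · by_contra hne
      obtain ⟨r, hr1, hrq, hr, hfirst⟩ := exists_first_visit (f := f) (U := U) (q := q) (x := x)
        (by lia)
      refine h2 r ⟨hr1, hrq⟩ ⟨hr, ?_⟩
      rw [h.visits_iterate_eq hx hrq]
      have := visits_eq_of_first_visit hr1 hrq hr hfirst
      lia
    · have h2 := hU.2
      rw [h.visits_iterate_eq hx hi.2] at h2
      have h3 := visits_add (f := f) (U := U) (a := 1) (b := i) (c := q + 1) hi.1 (by lia) x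
      have h4 := visits_succ_of_mem (f := f) (U := U) (a := i) (b := q + 1) (by lia) hU.1
      lia
  induction κ with
  | zero => simp [nestedU, U]
  | succ κ ih =>
    rw [nestedU, ih, key]
    ext x
    simp only [clusterSet, Set.mem_sdiff, mem_ofPred_eq]
    grind

theorem nestedA_eq (φ : X → EReal) (u : ℝ) {q : ℕ}
    (h : GapAfter f (exceedSet φ u) q (2 * q)) (κ : ℕ) :
    nestedA f φ q u κ = clusterSet f (exceedSet φ u) q κ := by
  have h1 := nestedU_eq φ u h κ
  have h2 := nestedU_eq φ u h (κ + 1)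
  have h3 : nestedA f φ q u κ = nestedU f φ q u κ \ nestedU f φ q u (κ + 1) := by
    rw [nestedU, sdiff_sdiff_right_self, nestedA, escapeSet]
    ext x
    simp
  rw [h3, h1, h2]
  ext x
  simp only [clusterSet, Set.mem_sdiff, mem_ofPred_eq]
  grind

variable [MeasurableSpace X] {μ : Measure X}

theorem measurable_visits (hf : Measurable f) (hU : MeasurableSet U) (a b : ℕ) :
    Measurable (visits f U a b) := by
  unfold visits
  exact Finset.measurable_sum _ fun i _ =>
    (measurable_const.indicator hU).comp (hf.iterate i)

theorem measurableSet_clusterSet (hf : Measurable f) (hU : MeasurableSet U) (q κ : ℕ) :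
    MeasurableSet (clusterSet f U q κ) :=
  hU.inter (measurable_visits hf hU _ _ (measurableSet_singleton κ))

theorem measureReal_preimage_iterate (hf : MeasurePreserving f μ μ) (s : ℕ) {E : Set X}
    (hE : MeasurableSet E) : μ.real (f^[s] ⁻¹' E) = μ.real E :=
  (hf.iterate s).measureReal_preimage hE.nullMeasurableSet

/-- Long clusters are rarer than short ones. -/
theorem measureReal_clusterSet_succ_le [IsFiniteMeasure μ] (hf : MeasurePreserving f μ μ)
    (hU : MeasurableSet U)
    {q : ℕ} (h : GapAfter f U q (2 * q)) (κ : ℕ) :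
    μ.real (clusterSet f U q (κ + 1)) ≤ μ.real (clusterSet f U q κ) := by
  -- The cluster set is sorted by the first return time `r`. The iterate `f^[r]` sends `B r` into
  -- the cluster set with one visit fewer; pulling `B r` back by `q - r` steps brings all these
  -- returns to the common time `q`.
  set B : ℕ → Set X := fun r =>
    clusterSet f U q (κ + 1) ∩ {x | f^[r] x ∈ U ∧ visits f U 1 r x = 0} with hB
  have hBm : ∀ r, MeasurableSet (B r) := fun r =>
    (measurableSet_clusterSet hf.measurable hU q _).inter
      ((hf.measurable.iterate r hU).inter
        (measurable_visits hf.measurable hU _ _ (measurableSet_singleton 0)))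
  have hcover : clusterSet f U q (κ + 1) ⊆ ⋃ r ∈ Finset.Icc 1 q, B r := by
    intro x hx
    obtain ⟨r, hr1, hrq, hr, hfirst⟩ := exists_first_visit (f := f) (U := U) (q := q) (x := x)
      (by rw [hx.2]; lia)
    exact mem_biUnion (Finset.mem_coe.2 (Finset.mem_Icc.2 ⟨hr1, hrq⟩))
      ⟨hx, hr, visits_eq_zero_iff.2 hfirst⟩
  have hC : ⋃ r ∈ Finset.Icc 1 q, f^[q - r] ⁻¹' (B r) ⊆ f^[q] ⁻¹' (clusterSet f U q κ) := by
    refine iUnion₂_subset fun r hr x hx => ?_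
    obtain ⟨hr1, hrq⟩ := Finset.mem_Icc.1 hr
    obtain ⟨⟨hxU, hxv⟩, hxr, hx0⟩ := hx
    have e : f^[q] x = f^[r] (f^[q - r] x) := by
      rw [← Function.iterate_add_apply, Nat.add_sub_cancel' hrq]
    rw [mem_preimage, e]
    refine ⟨hxr, ?_⟩
    rw [h.visits_iterate_eq hxU hrq]
    have := visits_eq_of_first_visit hr1 hrq hxr (visits_eq_zero_iff.1 hx0)
    lia
  -- In the `r`-th set the last visit before time `q` is at `q - r`, so this time determines `r`.
  have hdisj : (Finset.Icc 1 q : Set ℕ).PairwiseDisjoint fun r => f^[q - r] ⁻¹' (B r) := by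
    have key : ∀ r s, 1 ≤ r → s ≤ q → r < s →
        Disjoint (f^[q - r] ⁻¹' (B r)) (f^[q - s] ⁻¹' (B s)) := by
      intro r s hr hs hrs
      refine Set.disjoint_left.2 fun x hx hx' => ?_
      have h0 := visits_eq_zero_iff.1 hx'.2.2 (s - r) (by lia) (by lia)
      rw [← Function.iterate_add_apply] at h0
      have e : s - r + (q - s) = q - r := by lia
      rw [e] at h0
      exact h0 hx.1.1
    intro r hr s hs hrs
    simp only [Finset.coe_Icc, mem_Icc] at hr hs
    rcases lt_or_gt_of_ne hrs with hlt | hlt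
    · exact key r s hr.1 hs.2 hlt
    · exact (key s r hs.1 hr.2 hlt).symm
  calc μ.real (clusterSet f U q (κ + 1)) ≤ μ.real (⋃ r ∈ Finset.Icc 1 q, B r) :=
        measureReal_mono hcover (measure_ne_top _ _)
    _ ≤ ∑ r ∈ Finset.Icc 1 q, μ.real (B r) := measureReal_biUnion_finset_le _ _
    _ = ∑ r ∈ Finset.Icc 1 q, μ.real (f^[q - r] ⁻¹' (B r)) :=
        Finset.sum_congr rfl fun r _ => (measureReal_preimage_iterate hf _ (hBm r)).symm
    _ = μ.real (⋃ r ∈ Finset.Icc 1 q, f^[q - r] ⁻¹' (B r)) :=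
        (measureReal_biUnion_finset hdisj fun r _ => hf.measurable.iterate _ (hBm r)).symm
    _ ≤ μ.real (f^[q] ⁻¹' (clusterSet f U q κ)) := measureReal_mono hC
    _ = _ := measureReal_preimage_iterate hf _ (measurableSet_clusterSet hf.measurable hU q κ)

end Visits


/-! ### The discrete Kolmogorov equation for the number of visits. -/

section OneStep

variable {X : Type*} {f : X → X} {U : Set X}

/-- The event that `U` is visited `k - j` times before time `m`, and `B` at time `m`. -/
def countEvent (f : X → X) (U B : Set X) (k m j : ℕ) : Set X :=
  {x | visits f U 0 m x + j = k ∧ f^[m] x ∈ B}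

theorem countEvent_eq_of_le {B : Set X} {k m j : ℕ} (hj : j ≤ k) :
    countEvent f U B k m j = countEvent f U B (k - j) m 0 := by
  ext x
  simp only [countEvent, mem_ofPred_eq]
  refine and_congr_left fun _ => ?_
  lia

theorem countEvent_eq_empty {B : Set X} {k m j : ℕ} (hj : k < j) :
    countEvent f U B k m j = ∅ := by
  ext x
  simp only [countEvent, mem_ofPred_eq, mem_empty_iff_false, iff_false]
  lia

theorem disjoint_clusterSet (q : ℕ) {κ κ' : ℕ} (h : κ ≠ κ') :
    Disjoint (clusterSet f U q κ) (clusterSet f U q κ') :=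
  Set.disjoint_left.2 fun _ hx hx' => h (hx.2.symm.trans hx'.2)

variable [MeasurableSpace X] {μ : Measure X}

theorem measurableSet_countEvent (hf : Measurable f) (hU : MeasurableSet U) {B : Set X}
    (hB : MeasurableSet B) (k m j : ℕ) : MeasurableSet (countEvent f U B k m j) :=
  (((measurable_visits hf hU 0 m).add_const j) (measurableSet_singleton k)).inter
    (hf.iterate m hB)

theorem abs_measureReal_sub_le_of_diff_subset [IsFiniteMeasure μ] {S T D : Set X}
    (hS : MeasurableSet S) (hT : MeasurableSet T) (h : ∀ x, x ∉ D → (x ∈ S ↔ x ∈ T)) :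
    |μ.real S - μ.real T| ≤ μ.real D := by
  refine (abs_measureReal_sub_le_measureReal_symmDiff hS.nullMeasurableSet
    hT.nullMeasurableSet).trans (measureReal_mono ?_)
  intro x hx
  by_contra hD
  have := h x hD
  rcases hx with hx | hx
  · exact hx.2 (this.1 hx.1)
  · exact hx.2 (this.2 hx.1)

theorem measureReal_visits_ne_zero_le [IsFiniteMeasure μ] (hf : MeasurePreserving f μ μ)
    (hU : MeasurableSet U) (s : ℕ) :
    μ.real {x | visits f U 0 s x ≠ 0} ≤ s * μ.real U := by
  have hsub : {x | visits f U 0 s x ≠ 0} ⊆ ⋃ i ∈ Finset.range s, f^[i] ⁻¹' U := by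
    intro x hx
    by_contra hc
    simp only [mem_iUnion, not_exists, Finset.mem_range, mem_preimage] at hc
    exact hx (visits_eq_zero_iff.2 fun i _ hi => hc i hi)
  refine (measureReal_mono hsub (measure_ne_top _ _)).trans
    ((measureReal_biUnion_finset_le _ _).trans (le_of_eq ?_))
  simp [measureReal_preimage_iterate hf _ hU]

/-- Waiting for a time `s` changes the law of the number of visits by little. -/
theorem abs_countEvent_sub_le [IsFiniteMeasure μ] (hf : MeasurePreserving f μ μ)
    (hU : MeasurableSet U) {B : Set X} (hB : MeasurableSet B) (k m j s : ℕ) :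
    |μ.real (countEvent f U B k m j) - μ.real (countEvent f U B k (m + s) j)| ≤ s * μ.real U := by
  rw [← measureReal_preimage_iterate hf s
    (measurableSet_countEvent hf.measurable hU hB k m j)]
  refine (abs_measureReal_sub_le_of_diff_subset (hf.measurable.iterate s
    (measurableSet_countEvent hf.measurable hU hB k m j))
    (measurableSet_countEvent hf.measurable hU hB k (m + s) j) (fun x hx => ?_)).trans
    (measureReal_visits_ne_zero_le hf hU s)
  simp only [mem_ofPred_eq, not_not] at hx
  simp only [countEvent, mem_preimage, mem_ofPred_eq, visits_iterate,
    ← Function.iterate_add_apply, zero_add]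
  rw [← visits_add (a := 0) (b := s) (c := m + s) (by lia) (by lia), hx, zero_add]

/-- The decay of correlations of the indicators of the sets `clusterSet f U q κ` against
indicators. -/
def ClusterDecay (μ : Measure X) (f : X → X) (U : Set X) (q : ℕ) (r : ℕ → ℝ) : Prop :=
  ∀ κ, ∀ E, MeasurableSet E → ∀ s, 1 ≤ s →
    |μ.real (clusterSet f U q κ ∩ f^[s] ⁻¹' E) - μ.real (clusterSet f U q κ) * μ.real E|
      ≤ μ.real E * r s

variable [IsProbabilityMeasure μ]

/-- The probability of a second cluster before time `g`. -/
theorem measureReal_second_cluster_le (hU : MeasurableSet U)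
    {q s₀ g : ℕ} {r : ℕ → ℝ} (hr : ∀ s, 0 ≤ r s) (hdec : ClusterDecay μ f U q r)
    (hgap : GapAfter f U q s₀) (κ : ℕ) :
    μ.real (clusterSet f U q κ ∩ {x | visits f U (q + 1) g x ≠ 0}) ≤
      g * μ.real U ^ 2 + μ.real U * ∑ s ∈ Finset.Ico (s₀ + 1) g, r s := by
  have hsub : clusterSet f U q κ ∩ {x | visits f U (q + 1) g x ≠ 0} ⊆
      ⋃ s ∈ Finset.Ico (max (q + 1) (s₀ + 1)) g, clusterSet f U q κ ∩ f^[s] ⁻¹' U := by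
    rintro x ⟨hx, hv⟩
    by_contra hc
    simp only [mem_iUnion, not_exists, Finset.mem_Ico] at hc
    refine hv (visits_eq_zero_iff.2 fun i h1 h2 hi => ?_)
    by_cases his : i ≤ s₀
    · exact hgap x hx.1 i (by lia) his hi
    · exact hc i ⟨by lia, h2⟩ ⟨hx, hi⟩
  -- Decay against `L¹` contributes the factor `μ.real U`, the norm of the indicator of `U`; without
  -- it the sum of the `r s` would not be small relative to `μ.real U`.
  have hterm : ∀ s ∈ Finset.Ico (max (q + 1) (s₀ + 1)) g,
      μ.real (clusterSet f U q κ ∩ f^[s] ⁻¹' U) ≤ μ.real U ^ 2 + μ.real U * r s := fun s hs => by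
    have h1 := (abs_le.1 (hdec κ U hU s (by simp only [Finset.mem_Ico] at hs; lia))).2
    have h2 : μ.real (clusterSet f U q κ) ≤ μ.real U := measureReal_mono fun x hx => hx.1
    nlinarith [measureReal_nonneg (μ := μ) (s := U)]
  refine (measureReal_mono hsub (measure_ne_top _ _)).trans
    ((measureReal_biUnion_finset_le _ _).trans ((Finset.sum_le_sum hterm).trans ?_))
  rw [Finset.sum_add_distrib, Finset.sum_const, Nat.card_Ico, nsmul_eq_mul, ← Finset.mul_sum]
  refine add_le_add (mul_le_mul_of_nonneg_right ?_ (sq_nonneg _))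
    (mul_le_mul_of_nonneg_left ?_ measureReal_nonneg)
  · exact_mod_cast Nat.sub_le _ _
  · exact Finset.sum_le_sum_of_subset_of_nonneg
      (Finset.Ico_subset_Ico (le_max_right _ _) le_rfl) fun s _ _ => hr s

/-- After a cluster of given size the number of visits is almost independent of that cluster. -/
theorem abs_cluster_inter_sub_le (hf : MeasurePreserving f μ μ) (hU : MeasurableSet U)
    {q g m : ℕ} (hqg : q + 1 ≤ g) (hgm : g ≤ m + 1) {r : ℕ → ℝ}
    (hr : ∀ s, 0 ≤ r s) (hdec : ClusterDecay μ f U q r)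
    {β : ℝ} {κ : ℕ} (hβ : μ.real (clusterSet f U q κ ∩ {x | visits f U (q + 1) g x ≠ 0}) ≤ β)
    {B : Set X} (hB : MeasurableSet B) (k j : ℕ) :
    |μ.real (clusterSet f U q κ ∩
        {x | visits f U (q + 1) (m + 1) x + j = k ∧ f^[m + 1] x ∈ B}) -
      μ.real (clusterSet f U q κ) * μ.real (countEvent f U B k m j)|
      ≤ β + r g + g * μ.real U ^ 2 := by
  have hA := measurableSet_clusterSet hf.measurable hU q κ
  -- A blank of length `g` follows the cluster. Visits inside it cost `β`, decay at lag `g`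
  -- separates the remaining `l` steps from the cluster, and stationarity restores the window from
  -- `l` to `m` at a cost of at most `g * μ.real U`, multiplied by the measure of the cluster set.
  obtain ⟨l, hl⟩ : ∃ l, m + 1 = l + g := ⟨m + 1 - g, by lia⟩
  have hlm : m = l + (g - 1) := by lia
  have hE := measurableSet_countEvent hf.measurable hU hB k l j
  have hS : MeasurableSet {x | visits f U (q + 1) (m + 1) x + j = k ∧ f^[m + 1] x ∈ B} :=
    (((measurable_visits hf.measurable hU _ _).add_const j) (measurableSet_singleton k)).inter
      (hf.measurable.iterate _ hB)
  have h1 : |μ.real (clusterSet f U q κ ∩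
        {x | visits f U (q + 1) (m + 1) x + j = k ∧ f^[m + 1] x ∈ B}) -
      μ.real (clusterSet f U q κ ∩ f^[g] ⁻¹' countEvent f U B k l j)| ≤ β := by
    refine (abs_measureReal_sub_le_of_diff_subset (hA.inter hS)
      (hA.inter (hf.measurable.iterate g hE)) fun x hx => ?_).trans hβ
    refine and_congr_right fun hxA => ?_
    have h0 : visits f U (q + 1) g x = 0 := by
      by_contra h0
      exact hx ⟨hxA, h0⟩
    simp only [countEvent, mem_preimage, mem_ofPred_eq, visits_iterate,
      ← Function.iterate_add_apply, zero_add, hl]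
    rw [← visits_add hqg (by lia : g ≤ l + g), h0, zero_add]
  have h2 := hdec κ _ hE g (by lia)
  have h3 := abs_countEvent_sub_le hf hU hB k l j (g - 1)
  rw [← hlm] at h3
  have h4 : μ.real (clusterSet f U q κ) ≤ μ.real U := measureReal_mono fun x hx => hx.1
  have h5 : μ.real (countEvent f U B k l j) * r g ≤ r g :=
    mul_le_of_le_one_left (hr g) measureReal_le_one
  have h6 : |μ.real (clusterSet f U q κ) * μ.real (countEvent f U B k l j) -
      μ.real (clusterSet f U q κ) * μ.real (countEvent f U B k m j)| ≤ g * μ.real U ^ 2 := by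
    rw [← mul_sub, abs_mul, abs_of_nonneg measureReal_nonneg]
    have h7 : ((g - 1 : ℕ) : ℝ) ≤ g := by exact_mod_cast Nat.sub_le _ _
    calc _ ≤ μ.real U * (g * μ.real U) :=
          mul_le_mul h4 (h3.trans (mul_le_mul_of_nonneg_right h7 measureReal_nonneg))
            (abs_nonneg _) measureReal_nonneg
      _ = _ := by ring
  rw [abs_le] at h1 h2 h6 ⊢
  constructor <;> linarith

/-- The increments of the law of the number of visits. -/
theorem abs_countEvent_succ_sub_le (hf : MeasurePreserving f μ μ) (hU : MeasurableSet U)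
    {q g m : ℕ} (hqg : q + 1 ≤ g) (hgm : g ≤ m + 1) {r : ℕ → ℝ}
    (hr : ∀ s, 0 ≤ r s) (hdec : ClusterDecay μ f U q r) {β : ℝ}
    (hβ : ∀ κ, μ.real (clusterSet f U q κ ∩ {x | visits f U (q + 1) g x ≠ 0}) ≤ β)
    {B : Set X} (hB : MeasurableSet B) (k : ℕ) :
    |μ.real (countEvent f U B k (m + 1) 0) - μ.real (countEvent f U B k m 0) -
      ∑ κ ∈ Finset.range (k + 1), μ.real (clusterSet f U q κ) *
        (μ.real (countEvent f U B k m (κ + 1)) - μ.real (countEvent f U B k m κ))|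
      ≤ 2 * (k + 1) * (β + r g + g * μ.real U ^ 2) := by
  set S : ℕ → Set X := fun j => {x | visits f U 1 (m + 1) x + j = k ∧ f^[m + 1] x ∈ B} with hSdef
  have hSm : ∀ j, MeasurableSet (S j) := fun j =>
    (((measurable_visits hf.measurable hU _ _).add_const j) (measurableSet_singleton k)).inter
      (hf.measurable.iterate _ hB)
  -- By stationarity the window `0, …, m - 1` may be replaced by `1, …, m`. The windows of the two
  -- events then differ only in time `0`, so only points of `U` contribute to the difference.
  have hS0 : μ.real (countEvent f U B k m 0) = μ.real (S 0) := by
    rw [← measureReal_preimage_iterate hf 1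
      (measurableSet_countEvent hf.measurable hU hB k m 0)]
    congr 1
    ext x
    simp only [countEvent, mem_preimage, mem_ofPred_eq, visits_iterate,
      ← Function.iterate_add_apply, zero_add, S]
  have hsplit : ∀ E : Set X, MeasurableSet E → μ.real E = μ.real (U ∩ E) + μ.real (Uᶜ ∩ E) :=
    fun E hE => by
      rw [inter_comm U, inter_comm Uᶜ, ← sdiff_eq, measureReal_inter_add_sdiff hU]
  have hin : U ∩ countEvent f U B k (m + 1) 0 = U ∩ S 1 := by
    ext x
    refine and_congr_right fun hx => ?_
    simp only [countEvent, mem_ofPred_eq, S]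
    rw [visits_succ_of_mem (a := 0) (by lia) (by simpa using hx)]
  have hout : Uᶜ ∩ countEvent f U B k (m + 1) 0 = Uᶜ ∩ S 0 := by
    ext x
    refine and_congr_right fun hx => ?_
    simp only [countEvent, mem_ofPred_eq, S]
    rw [visits_succ_of_notMem (a := 0) (by lia) (by simpa using hx)]
  have hdiff : μ.real (countEvent f U B k (m + 1) 0) - μ.real (countEvent f U B k m 0) =
      μ.real (U ∩ S 1) - μ.real (U ∩ S 0) := by
    rw [hS0, hsplit _ (measurableSet_countEvent hf.measurable hU hB k (m + 1) 0),
      hsplit _ (hSm 0), hin, hout]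
    ring
  -- A cluster with more than `k` later visits already exceeds the prescribed count, which is why
  -- the sizes stop at `k`.
  have hdecomp : ∀ j, μ.real (U ∩ S j) = ∑ κ ∈ Finset.range (k + 1), μ.real (clusterSet f U q κ ∩
      {x | visits f U (q + 1) (m + 1) x + (κ + j) = k ∧ f^[m + 1] x ∈ B}) := by
    intro j
    have hmem : ∀ κ x, x ∈ clusterSet f U q κ →
        (x ∈ S j ↔ visits f U (q + 1) (m + 1) x + (κ + j) = k ∧ f^[m + 1] x ∈ B) := by
      intro κ x hx
      simp only [S, mem_ofPred_eq]
      rw [← visits_add (a := 1) (b := q + 1) (c := m + 1) (by lia) (by lia), hx.2]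
      refine and_congr_left fun _ => ?_
      lia
    have hU' : U ∩ S j = ⋃ κ ∈ Finset.range (k + 1), clusterSet f U q κ ∩ S j := by
      ext x
      simp only [mem_inter_iff, mem_iUnion, exists_prop, Finset.mem_range]
      constructor
      · rintro ⟨hx, hxS⟩
        refine ⟨visits f U 1 (q + 1) x, ?_, ⟨hx, rfl⟩, hxS⟩
        have := ((hmem _ x ⟨hx, rfl⟩).1 hxS).1
        lia
      · rintro ⟨κ, _, hx, hxS⟩
        exact ⟨hx.1, hxS⟩
    rw [hU', measureReal_biUnion_finset]
    · refine Finset.sum_congr rfl fun κ _ => ?_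
      congr 1
      ext x
      exact and_congr_right fun hx => hmem κ x hx
    · intro κ _ κ' _ hne
      exact (disjoint_clusterSet q hne).mono inter_subset_left inter_subset_left
    · exact fun κ _ => (measurableSet_clusterSet hf.measurable hU q κ).inter (hSm j)
  rw [hdiff, hdecomp, hdecomp, ← Finset.sum_sub_distrib, ← Finset.sum_sub_distrib]
  refine (Finset.abs_sum_le_sum_abs _ _).trans ?_
  refine (Finset.sum_le_card_nsmul _ _ (2 * (β + r g + g * μ.real U ^ 2)) fun κ _ => ?_).trans
    (le_of_eq ?_)
  · have h1 := abs_cluster_inter_sub_le hf hU hqg hgm hr hdec (hβ κ) hB k (κ + 1)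
    have h2 := abs_cluster_inter_sub_le hf hU hqg hgm hr hdec (hβ κ) hB k (κ + 0)
    rw [add_zero] at h2 ⊢
    rw [abs_le] at h1 h2 ⊢
    constructor <;> linarith
  · rw [Finset.card_range, nsmul_eq_mul]
    push_cast
    ring

/-- Summation by parts. The differences `a (j - 1) - a j` play the role of the rate of clusters of
size `j`, which puts the one-step equation in Kolmogorov form. -/
theorem sum_cluster_mul_sub (a w : ℕ → ℝ) (k : ℕ) :
    ∑ κ ∈ Finset.range (k + 1), a κ * ((if κ + 1 ≤ k then w (k - (κ + 1)) else 0) - w (k - κ)) =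
      -a 0 * w k + ∑ i ∈ Finset.range k, (a (k - i - 1) - a (k - i)) * w i := by
  simp only [mul_sub, Finset.sum_sub_distrib]
  rw [Finset.sum_range_succ, Finset.sum_range_succ' (fun κ => a κ * w (k - κ))]
  have h1 : ∀ κ ∈ Finset.range k, a κ * (if κ + 1 ≤ k then w (k - (κ + 1)) else 0) =
      a κ * w (k - (κ + 1)) := fun κ hκ => by
    rw [if_pos (Nat.succ_le_of_lt (Finset.mem_range.1 hκ))]
  rw [Finset.sum_congr rfl h1, if_neg (by lia),
    ← Finset.sum_range_reflect fun i => (a (k - i - 1) - a (k - i)) * w i]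
  have h2 : ∀ κ ∈ Finset.range k,
      (a (k - (k - 1 - κ) - 1) - a (k - (k - 1 - κ))) * w (k - 1 - κ) =
      a κ * w (k - (κ + 1)) - a (κ + 1) * w (k - (κ + 1)) := fun κ hκ => by
    have hκ := Finset.mem_range.1 hκ
    have e1 : k - (k - 1 - κ) - 1 = κ := by lia
    have e2 : k - (k - 1 - κ) = κ + 1 := by lia
    have e3 : k - 1 - κ = k - (κ + 1) := by lia
    rw [e1, e2, e3]
    ring
  rw [Finset.sum_congr rfl h2, Finset.sum_sub_distrib]
  simp
  ring

end OneStep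


/-! ### Stability of the discrete equations and the choice of a separating time. -/

section Euler

theorem sum_cluster_telescope (a : ℕ → ℝ) (k : ℕ) :
    ∑ i ∈ Finset.range k, (a (k - i - 1) - a (k - i)) = a 0 - a k := by
  have := Finset.sum_range_sub (fun i => a (k - i)) k
  simp only [Nat.sub_self, Nat.sub_zero, ← Nat.sub_sub] at this
  exact this

/-- A step of the discrete Kolmogorov equations is a contraction. -/
theorem abs_cluster_step_le {a : ℕ → ℝ} (ha : Antitone a) (ha0 : ∀ k, 0 ≤ a k) (ha1 : a 0 ≤ 1)
    {e : ℕ → ℝ} {E : ℝ} {k : ℕ} (he : ∀ i ≤ k, |e i| ≤ E) :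
    |e k + (-a 0 * e k + ∑ i ∈ Finset.range k, (a (k - i - 1) - a (k - i)) * e i)| ≤ E := by
  have hE : 0 ≤ E := (abs_nonneg _).trans (he k le_rfl)
  have h1 : |(1 - a 0) * e k| ≤ (1 - a 0) * E := by
    rw [abs_mul, abs_of_nonneg (sub_nonneg.2 ha1)]
    exact mul_le_mul_of_nonneg_left (he k le_rfl) (sub_nonneg.2 ha1)
  have h2 : |∑ i ∈ Finset.range k, (a (k - i - 1) - a (k - i)) * e i| ≤ (a 0 - a k) * E := by
    rw [← sum_cluster_telescope, Finset.sum_mul]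
    refine (Finset.abs_sum_le_sum_abs _ _).trans (Finset.sum_le_sum fun i hi => ?_)
    have h3 : 0 ≤ a (k - i - 1) - a (k - i) := sub_nonneg.2 (ha (Nat.sub_le _ _))
    rw [abs_mul, abs_of_nonneg h3]
    exact mul_le_mul_of_nonneg_left (he i (Finset.mem_range.1 hi).le) h3
  -- The coefficients `1 - a 0` and `a (k - i - 1) - a (k - i)` are nonnegative and add up to `1 - a
  -- k ≤ 1`.
  calc _ = |(1 - a 0) * e k + ∑ i ∈ Finset.range k, (a (k - i - 1) - a (k - i)) * e i| := by
        congr 1; ring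
    _ ≤ (1 - a 0) * E + (a 0 - a k) * E := (abs_add_le _ _).trans (add_le_add h1 h2)
    _ = E - a k * E := by ring
    _ ≤ E := sub_le_self _ (mul_nonneg (ha0 k) hE)

/-- Since a step does not expand the maximum over all counts `≤ k₀`, errors only add up: there is no
exponential factor as in Gronwall's inequality. -/
theorem abs_sub_le_of_approx_steps {a : ℕ → ℝ} (ha : Antitone a) (ha0 : ∀ k, 0 ≤ a k)
    (ha1 : a 0 ≤ 1) {w v : ℕ → ℕ → ℝ} {k₀ m₀ m₁ : ℕ} {E₀ e₁ e₂ : ℝ}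
    (hw : ∀ m, m₀ ≤ m → m < m₁ → ∀ k ≤ k₀, |w (m + 1) k - w m k -
      (-a 0 * w m k + ∑ i ∈ Finset.range k, (a (k - i - 1) - a (k - i)) * w m i)| ≤ e₁)
    (hv : ∀ m, m₀ ≤ m → m < m₁ → ∀ k ≤ k₀, |v (m + 1) k - v m k -
      (-a 0 * v m k + ∑ i ∈ Finset.range k, (a (k - i - 1) - a (k - i)) * v m i)| ≤ e₂)
    (h0 : ∀ k ≤ k₀, |w m₀ k - v m₀ k| ≤ E₀) (d : ℕ) (hd : m₀ + d ≤ m₁) :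
    ∀ k ≤ k₀, |w (m₀ + d) k - v (m₀ + d) k| ≤ E₀ + d * (e₁ + e₂) := by
  induction d with
  | zero => simpa using h0
  | succ d ih =>
    intro k hk
    have h1 := hw (m₀ + d) (by lia) (by lia) k hk
    have h2 := hv (m₀ + d) (by lia) (by lia) k hk
    have h3 := abs_cluster_step_le ha ha0 ha1 (e := fun k => w (m₀ + d) k - v (m₀ + d) k) (k := k)
      fun i hi => ih (by lia) i (hi.trans hk)
    have h4 : ∑ i ∈ Finset.range k, (a (k - i - 1) - a (k - i)) * (w (m₀ + d) i - v (m₀ + d) i) =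
        ∑ i ∈ Finset.range k, (a (k - i - 1) - a (k - i)) * w (m₀ + d) i -
        ∑ i ∈ Finset.range k, (a (k - i - 1) - a (k - i)) * v (m₀ + d) i := by
      simp only [mul_sub, Finset.sum_sub_distrib]
    rw [h4] at h3
    rw [← add_assoc]
    push_cast
    rw [abs_le] at h1 h2 h3 ⊢
    constructor <;> linarith

/-- The compound Poisson probabilities approximately solve the discrete Kolmogorov equations. -/
theorem abs_cpMass_step_le {θ : ℝ} {π a : ℕ → ℝ} {k : ℕ} {t δ ε C M P : ℝ} (hP0 : 0 ≤ P)
    (hP1 : P ≤ 1) (hM : ∀ i ≤ k, |cpMass θ π t i| ≤ M)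
    (hC : |cpMass θ π (t + δ) k - cpMass θ π t k - δ * cpDeriv θ π t k| ≤ C * δ ^ 2)
    (h0 : |a 0 - θ * δ| ≤ ε * δ)
    (hj : ∀ j < k, |a j - a (j + 1) - θ * δ * π (j + 1)| ≤ ε * δ) :
    |cpMass θ π (t + δ) k * P - cpMass θ π t k * P -
      (-a 0 * (cpMass θ π t k * P) +
        ∑ i ∈ Finset.range k, (a (k - i - 1) - a (k - i)) * (cpMass θ π t i * P))|
      ≤ C * δ ^ 2 + (k + 1) * (ε * δ * M) := by
  set p := fun i => cpMass θ π t i with hp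
  have hM0 : 0 ≤ M := (abs_nonneg _).trans (hM k le_rfl)
  have hε : 0 ≤ ε * δ := (abs_nonneg _).trans h0
  have hX : |(a 0 - θ * δ) * p k| ≤ ε * δ * M := by
    rw [abs_mul]
    exact mul_le_mul h0 (hM k le_rfl) (abs_nonneg _) hε
  have hY : |∑ i ∈ Finset.range k, (a (k - i - 1) - a (k - i) - θ * δ * π (k - i)) * p i|
      ≤ k * (ε * δ * M) := by
    refine (Finset.abs_sum_le_sum_abs _ _).trans
      ((Finset.sum_le_card_nsmul _ _ (ε * δ * M) fun i hi => ?_).trans (le_of_eq (by simp)))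
    have hi := Finset.mem_range.1 hi
    rw [abs_mul]
    have := hj (k - i - 1) (by lia)
    rw [Nat.sub_add_cancel (by lia : 1 ≤ k - i)] at this
    exact mul_le_mul this (hM i hi.le) (abs_nonneg _) hε
  have e : cpMass θ π (t + δ) k * P - cpMass θ π t k * P -
      (-a 0 * (cpMass θ π t k * P) +
        ∑ i ∈ Finset.range k, (a (k - i - 1) - a (k - i)) * (cpMass θ π t i * P)) =
      ((cpMass θ π (t + δ) k - cpMass θ π t k - δ * cpDeriv θ π t k) + (a 0 - θ * δ) * p k -
        ∑ i ∈ Finset.range k, (a (k - i - 1) - a (k - i) - θ * δ * π (k - i)) * p i) * P := by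
    simp only [sub_mul _ _ (p _), Finset.sum_sub_distrib]
    have e1 : ∑ i ∈ Finset.range k, θ * δ * π (k - i) * p i =
        δ * (θ * ∑ i ∈ Finset.range k, π (k - i) * cpMass θ π t i) := by
      simp only [Finset.mul_sum]
      exact Finset.sum_congr rfl fun i _ => by rw [hp]; ring
    have e2 : ∑ i ∈ Finset.range k, (a (k - i - 1) - a (k - i)) * (cpMass θ π t i * P) =
        (∑ i ∈ Finset.range k, (a (k - i - 1) * p i - a (k - i) * p i)) * P := by
      rw [Finset.sum_mul]
      exact Finset.sum_congr rfl fun i _ => by rw [hp]; ring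
    rw [e1, e2, cpDeriv, hp, Finset.sum_sub_distrib]
    ring
  rw [e, abs_mul, abs_of_nonneg hP0]
  refine (mul_le_of_le_one_right (abs_nonneg _) hP1).trans ?_
  rw [abs_le] at hC hX hY ⊢
  constructor <;> linarith

theorem exists_sum_Ico_lt {r : ℕ → ℝ} (hsum : Summable r) {ε : ℝ} (hε : 0 < ε) :
    ∃ a₀, ∀ a b, a₀ ≤ a → ∑ s ∈ Finset.Ico a b, r s < ε := by
  obtain ⟨s, hs⟩ := hsum.vanishing (Iio_mem_nhds hε)
  refine ⟨s.sup id + 1, fun a b ha => hs _ ?_⟩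
  refine Finset.disjoint_left.2 fun i hi his => ?_
  have := Finset.le_sup (f := id) his
  simp only [Finset.mem_Ico, id] at hi this
  lia

/-- A separating time that is short at the scale `1 / δ`, at which correlations are smaller
than `δ`. -/
theorem eventually_exists_separation {r : ℕ → ℝ} (hsum : Summable r) {ε : ℝ}
    (hε : 0 < ε) (G : ℕ) :
    ∀ᶠ δ : ℝ in 𝓝[>] 0, ∃ g, G ≤ g ∧ g * δ ≤ ε ∧ r g ≤ ε * δ := by
  obtain ⟨a₀, ha₀⟩ := exists_sum_Ico_lt hsum (show (0 : ℝ) < ε ^ 2 / 8 by positivity)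
  have hlim : Tendsto (fun δ : ℝ => ε / δ) (𝓝[>] 0) atTop :=
    tendsto_inv_nhdsGT_zero.const_mul_atTop hε
  filter_upwards [self_mem_nhdsWithin,
    hlim.eventually_ge_atTop (2 * (a₀ + G) + 8 : ℝ)] with δ hδ hbig
  have hδ : 0 < δ := hδ
  -- If no `g` worked, `r` would be at least `ε * δ` on the upper half of `[0, M]`, which has at
  -- least `ε / (4 * δ)` points. The sum there would be at least `ε ^ 2 / 4`, against a tail below
  -- `ε ^ 2 / 8`.
  set M := ⌊ε / δ⌋₊ with hM
  have hMle : (M : ℝ) ≤ ε / δ := Nat.floor_le (by positivity)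
  have hMgt : ε / δ < M + 1 := Nat.lt_floor_add_one _
  have hMbig : 2 * (a₀ + G) + 7 ≤ M := by
    have : ((2 * (a₀ + G) + 7 : ℕ) : ℝ) < M := by push_cast; linarith
    exact_mod_cast this.le
  by_contra! hc
  have hall : ∀ g ∈ Finset.Ico (M / 2 + 1) (M + 1), ε * δ ≤ r g := fun g hg => by
    rw [Finset.mem_Ico] at hg
    refine (hc g (by lia) ?_).le
    rw [← le_div_iff₀ hδ]
    refine le_trans ?_ hMle
    exact_mod_cast (by lia : g ≤ M)
  have h1 := Finset.card_nsmul_le_sum _ _ _ hall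
  have h2 := ha₀ (M / 2 + 1) (M + 1) (by lia)
  rw [Nat.card_Ico, nsmul_eq_mul] at h1
  have h3 : (M : ℝ) / 2 ≤ ((M + 1 - (M / 2 + 1) : ℕ) : ℝ) := by
    rw [div_le_iff₀ (by norm_num)]
    exact_mod_cast (by lia : M ≤ (M + 1 - (M / 2 + 1)) * 2)
  have h4 : ε / δ / 4 ≤ (M : ℝ) / 2 := by
    have : (0 : ℝ) ≤ a₀ + G := by positivity
    linarith
  have h5 : ε / δ / 4 * (ε * δ) = ε ^ 2 / 4 := by field_simp
  have h6 := mul_le_mul_of_nonneg_right (h4.trans h3) (by positivity : 0 ≤ ε * δ)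
  nlinarith

end Euler

/-! ### Asymptotic compound Poisson law of the number of visits. -/

section Limit

variable {X : Type*} [MeasurableSpace X] {μ : Measure X} {f : X → X}

/-- Rare sets `U n` with short clusters, decay of correlations, extremal index `θ` and cluster
size distribution `π`. -/
structure RareClusters (μ : Measure X) (f : X → X) (U : ℕ → Set X) (q : ℕ) (θ : ℝ)
    (π : ℕ → ℝ) : Prop where
  pos : 0 < θ
  measurableSet : ∀ n, MeasurableSet (U n)
  tendsto_measure : Tendsto (fun n => μ.real (U n)) atTop (𝓝[>] 0)
  gap : ∀ M, ∀ᶠ n in atTop, GapAfter f (U n) q M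
  decay : ∃ r : ℕ → ℝ, (∀ s, 0 ≤ r s) ∧ Summable r ∧ ∀ᶠ n in atTop, ClusterDecay μ f (U n) q r
  tendsto_index : Tendsto (fun n => μ.real (clusterSet f (U n) q 0) / μ.real (U n)) atTop (𝓝 θ)
  tendsto_size : ∀ j, Tendsto (fun n => (μ.real (clusterSet f (U n) q j) -
    μ.real (clusterSet f (U n) q (j + 1))) / μ.real (clusterSet f (U n) q 0)) atTop (𝓝 (π (j + 1)))

/-- Limits of quotients become errors `ε * μ.real (U n)`, the scale that can be summed over order `1
/ μ.real (U n)` steps. -/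
theorem RareClusters.eventually_abs_le {U : ℕ → Set X} {q : ℕ} {θ : ℝ} {π : ℕ → ℝ}
    (h : RareClusters μ f U q θ π) {ε : ℝ} (hε : 0 < ε) (k : ℕ) :
    ∀ᶠ n in atTop, |μ.real (clusterSet f (U n) q 0) - θ * μ.real (U n)| ≤ ε * μ.real (U n) ∧
      ∀ j < k, |μ.real (clusterSet f (U n) q j) - μ.real (clusterSet f (U n) q (j + 1)) -
        θ * μ.real (U n) * π (j + 1)| ≤ ε * μ.real (U n) := by
  have hpos : ∀ᶠ n in atTop, 0 < μ.real (U n) := h.tendsto_measure self_mem_nhdsWithin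
  have key : ∀ {x : ℕ → ℝ} {l : ℝ}, Tendsto (fun n => x n / μ.real (U n)) atTop (𝓝 l) →
      ∀ᶠ n in atTop, |x n - l * μ.real (U n)| ≤ ε * μ.real (U n) := by
    intro x l hx
    filter_upwards [hpos, (Metric.tendsto_nhds.1 hx) ε hε] with n hn hd
    rw [Real.dist_eq] at hd
    have e : x n - l * μ.real (U n) = (x n / μ.real (U n) - l) * μ.real (U n) := by
      field_simp
    rw [e, abs_mul, abs_of_pos hn]
    exact mul_le_mul_of_nonneg_right hd.le hn.le
  refine (key h.tendsto_index).and ?_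
  have hfin : ∀ᶠ n in atTop, ∀ j ∈ Finset.range k,
      |μ.real (clusterSet f (U n) q j) - μ.real (clusterSet f (U n) q (j + 1)) -
        θ * μ.real (U n) * π (j + 1)| ≤ ε * μ.real (U n) := by
    rw [Filter.eventually_all_finset]
    intro j _
    have hlim := (h.tendsto_size j).mul h.tendsto_index
    have h1 : Tendsto (fun n => (μ.real (clusterSet f (U n) q j) -
        μ.real (clusterSet f (U n) q (j + 1))) / μ.real (U n)) atTop (𝓝 (π (j + 1) * θ)) := by
      refine hlim.congr' ?_
      filter_upwards [h.tendsto_index.eventually (lt_mem_nhds h.pos)] with n hn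
      have h0 : μ.real (clusterSet f (U n) q 0) ≠ 0 := by
        rintro h0
        simp [h0] at hn
      field_simp
    filter_upwards [key h1] with n hn
    convert! hn using 3
    ring
  filter_upwards [hfin] with n hn j hj
  exact hn j (Finset.mem_range.2 hj)

theorem exists_cpMass_bounds (θ : ℝ) (π : ℕ → ℝ) (k : ℕ) (T : ℝ) :
    ∃ K, 0 ≤ K ∧ ∀ i ≤ k, (∀ s ∈ Icc 0 T, |cpMass θ π s i| ≤ K) ∧
      (∀ s ∈ Icc 0 T, ∀ t ∈ Icc 0 T, |cpMass θ π t i - cpMass θ π s i| ≤ K * |t - s|) ∧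
      ∀ t δ : ℝ, 0 ≤ t → 0 ≤ δ → t + δ ≤ T →
        |cpMass θ π (t + δ) i - cpMass θ π t i - δ * cpDeriv θ π t i| ≤ K * δ ^ 2 := by
  choose C hC0 hC using fun i => exists_cpMass_euler (θ := θ) (π := π) i T
  choose D hD0 hD using fun i => exists_lipschitz_cpMass (θ := θ) (π := π) i T
  choose M hM using fun i => isCompact_Icc.exists_bound_of_continuousOn (s := Icc 0 T)
    (continuous_cpMass (θ := θ) (π := π) i).continuousOn
  have hnn : ∀ i, 0 ≤ |M i| + D i + C i := fun i =>
    add_nonneg (add_nonneg (abs_nonneg _) (hD0 i)) (hC0 i)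
  refine ⟨∑ i ∈ Finset.range (k + 1), (|M i| + D i + C i), Finset.sum_nonneg fun i _ => hnn i,
    fun i hi => ?_⟩
  have hle : |M i| + D i + C i ≤ ∑ i ∈ Finset.range (k + 1), (|M i| + D i + C i) :=
    Finset.single_le_sum (f := fun i => |M i| + D i + C i) (fun i _ => hnn i)
      (Finset.mem_range.2 (Nat.lt_succ_of_le hi))
  refine ⟨fun s hs => ?_, fun s hs t ht => ?_, fun t δ ht hδ hT => ?_⟩
  · have h1 : |cpMass θ π s i| ≤ M i := hM i s hs
    linarith [le_abs_self (M i), hD0 i, hC0 i]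
  · refine (hD i s hs t ht).trans (mul_le_mul_of_nonneg_right ?_ (abs_nonneg _))
    linarith [abs_nonneg (M i), hD0 i, hC0 i]
  · refine (hC i t δ ht hδ hT).trans (mul_le_mul_of_nonneg_right ?_ (sq_nonneg _))
    linarith [abs_nonneg (M i), hD0 i, hC0 i]

theorem countEvent_zero_real (μ : Measure X) (f : X → X) (U B : Set X) (k : ℕ) :
    μ.real (countEvent f U B k 0 0) = (if k = 0 then 1 else 0) * μ.real B := by
  split_ifs with hk
  · rw [one_mul]
    congr 1
    ext x
    simp [countEvent, visits_self, hk]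
  · rw [zero_mul]
    convert! measureReal_empty (μ := μ)
    ext x
    simp [countEvent, visits_self, Ne.symm hk]

variable [IsProbabilityMeasure μ]

/-- The quantitative comparison of the law of the number of visits with the compound Poisson
probabilities. -/
theorem abs_countEvent_sub_cpMass_le (hf : MeasurePreserving f μ μ) {U : Set X}
    (hU : MeasurableSet U) {q k g m : ℕ} {θ T K ε β : ℝ} {π r : ℕ → ℝ}
    (hr : ∀ s, 0 ≤ r s) (hdec : ClusterDecay μ f U q r) (hgap : GapAfter f U q (2 * q))
    (hK0 : 0 ≤ K)
    (hK : ∀ i ≤ k, (∀ s ∈ Icc 0 T, |cpMass θ π s i| ≤ K) ∧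
      (∀ s ∈ Icc 0 T, ∀ t ∈ Icc 0 T, |cpMass θ π t i - cpMass θ π s i| ≤ K * |t - s|) ∧
      ∀ t δ : ℝ, 0 ≤ t → 0 ≤ δ → t + δ ≤ T →
        |cpMass θ π (t + δ) i - cpMass θ π t i - δ * cpDeriv θ π t i| ≤ K * δ ^ 2)
    (hθ : |μ.real (clusterSet f U q 0) - θ * μ.real U| ≤ ε * μ.real U)
    (hπ : ∀ j < k, |μ.real (clusterSet f U q j) - μ.real (clusterSet f U q (j + 1)) -
        θ * μ.real U * π (j + 1)| ≤ ε * μ.real U)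
    (hqg : q + 1 ≤ g) (hgε : g * μ.real U ≤ ε) (hrg : r g ≤ ε * μ.real U)
    (hδε : μ.real U ≤ ε) (hT : m * μ.real U ≤ T)
    (hβ : ∀ κ, μ.real (clusterSet f U q κ ∩ {x | visits f U (q + 1) g x ≠ 0}) ≤ β)
    (hβε : β ≤ 2 * ε * μ.real U) {B : Set X} (hB : MeasurableSet B) :
    |μ.real (countEvent f U B k m 0) - cpMass θ π (m * μ.real U) k * μ.real B| ≤
      (1 + K + T * (8 * (k + 1) + K + (k + 1) * K)) * ε := by
  set δ := μ.real U with hδ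
  set P := μ.real B with hP
  have hδ0 : 0 ≤ δ := measureReal_nonneg
  have hP0 : 0 ≤ P := measureReal_nonneg
  have hP1 : P ≤ 1 := measureReal_le_one
  have hε0 : 0 ≤ ε := hδ0.trans hδε
  have hT0 : 0 ≤ T := (mul_nonneg (Nat.cast_nonneg m) hδ0).trans hT
  -- The one-step estimate needs room for the blank, so the recursion starts at time `g`. Up to then
  -- both quantities stay near their common value at time `0`: the measure side moves by at most `l
  -- * δ ≤ ε`, the compound Poisson side by at most `K * ε`.
  have hstart : ∀ l : ℕ, l ≤ g → l ≤ m → ∀ i ≤ k,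
      |μ.real (countEvent f U B i l 0) - cpMass θ π (l * δ) i * P| ≤ (1 + K) * ε := by
    intro l hlg hlm i hi
    have hlT : l * δ ≤ T := (mul_le_mul_of_nonneg_right (by exact_mod_cast hlm) hδ0).trans hT
    have hlδ : l * δ ≤ ε := (mul_le_mul_of_nonneg_right (by exact_mod_cast hlg) hδ0).trans hgε
    have hl0 : 0 ≤ l * δ := by positivity
    have h1 := abs_countEvent_sub_le hf hU hB i 0 0 l
    rw [countEvent_zero_real, zero_add, ← cpMass_zero (θ := θ) (π := π)] at h1
    have h2 := (hK i hi).2.1 0 ⟨le_rfl, hT0⟩ (l * δ) ⟨hl0, hlT⟩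
    rw [sub_zero, abs_of_nonneg hl0] at h2
    have h3 : |cpMass θ π (l * δ) i * P - cpMass θ π 0 i * P| ≤ K * ε := by
      rw [← sub_mul, abs_mul, abs_of_nonneg hP0]
      exact (mul_le_of_le_one_right (abs_nonneg _) hP1).trans
        (h2.trans (mul_le_mul_of_nonneg_left hlδ hK0))
    rw [abs_le] at h1 h3 ⊢
    constructor <;> linarith
  have hK' : 0 ≤ T * (8 * (k + 1) + K + (k + 1) * K) := by positivity
  rcases le_total m g with hmg | hgm
  · refine (hstart m hmg le_rfl k le_rfl).trans (mul_le_mul_of_nonneg_right ?_ hε0)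
    linarith
  obtain ⟨d, rfl⟩ := Nat.exists_eq_add_of_le hgm
  set a : ℕ → ℝ := fun κ => μ.real (clusterSet f U q κ) with ha
  have hanti : Antitone a := antitone_nat_of_succ_le fun κ =>
    measureReal_clusterSet_succ_le hf hU hgap κ
  have hgδ : g * δ ^ 2 ≤ ε * δ := by nlinarith
  have hw : ∀ l, g ≤ l → l < g + d → ∀ i ≤ k,
      |μ.real (countEvent f U B i (l + 1) 0) - μ.real (countEvent f U B i l 0) -
        (-a 0 * μ.real (countEvent f U B i l 0) + ∑ j ∈ Finset.range i,
          (a (i - j - 1) - a (i - j)) * μ.real (countEvent f U B j l 0))| ≤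
        8 * (k + 1) * (ε * δ) := by
    intro l hl _ i hi
    have h1 := abs_countEvent_succ_sub_le hf hU hqg (by lia : g ≤ l + 1) hr hdec hβ hB i
    have h2 : ∀ κ ∈ Finset.range (i + 1), μ.real (clusterSet f U q κ) *
        (μ.real (countEvent f U B i l (κ + 1)) - μ.real (countEvent f U B i l κ)) =
        a κ * ((if κ + 1 ≤ i then (fun j => μ.real (countEvent f U B j l 0)) (i - (κ + 1)) else 0) -
          (fun j => μ.real (countEvent f U B j l 0)) (i - κ)) := fun κ hκ => by
      rw [countEvent_eq_of_le (Nat.lt_succ_iff.1 (Finset.mem_range.1 hκ))]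
      split_ifs with hκi
      · rw [countEvent_eq_of_le hκi]
      · rw [countEvent_eq_empty (not_le.1 hκi), measureReal_empty]
    rw [Finset.sum_congr rfl h2,
      sum_cluster_mul_sub a (fun j => μ.real (countEvent f U B j l 0)) i] at h1
    refine h1.trans ?_
    -- The three errors are at most `2 * ε * δ`, `ε * δ` and `ε * δ`; with the factor `2 * (i + 1)`
    -- of the one-step estimate this gives the constant `8`.
    have h3 : β + r g + g * δ ^ 2 ≤ 4 * (ε * δ) := by linarith
    have h4 : (i : ℝ) ≤ k := by exact_mod_cast hi
    have h5 : 0 ≤ ε * δ := by positivity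
    calc 2 * ((i : ℝ) + 1) * (β + r g + g * δ ^ 2) ≤ 2 * ((i : ℝ) + 1) * (4 * (ε * δ)) :=
          mul_le_mul_of_nonneg_left h3 (by positivity)
      _ = 8 * ((i : ℝ) + 1) * (ε * δ) := by ring
      _ ≤ 8 * ((k : ℝ) + 1) * (ε * δ) := by gcongr
  have hv : ∀ l, g ≤ l → l < g + d → ∀ i ≤ k,
      |cpMass θ π ((l + 1 : ℕ) * δ) i * P - cpMass θ π (l * δ) i * P -
        (-a 0 * (cpMass θ π (l * δ) i * P) + ∑ j ∈ Finset.range i,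
          (a (i - j - 1) - a (i - j)) * (cpMass θ π (l * δ) j * P))| ≤
        (K + (k + 1) * K) * (ε * δ) := by
    intro l _ hl i hi
    have hlT : l * δ + δ ≤ T := by
      have : ((l : ℝ) + 1) ≤ (g + d : ℕ) := by exact_mod_cast hl
      nlinarith
    have hl0 : 0 ≤ l * δ := by positivity
    have e : ((l + 1 : ℕ) : ℝ) * δ = l * δ + δ := by push_cast; ring
    rw [e]
    refine (abs_cpMass_step_le hP0 hP1
      (fun j hj => (hK j (hj.trans hi)).1 _ ⟨hl0, by linarith⟩)
      ((hK i hi).2.2 _ _ hl0 hδ0 hlT) hθ fun j hj => hπ j (hj.trans_le hi)).trans ?_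
    have h4 : (i : ℝ) ≤ k := by exact_mod_cast hi
    calc K * δ ^ 2 + ((i : ℝ) + 1) * (ε * δ * K) ≤ K * (ε * δ) + ((k : ℝ) + 1) * (ε * δ * K) := by
          rw [sq]; gcongr
      _ = _ := by ring
  have hmain := abs_sub_le_of_approx_steps hanti (fun _ => measureReal_nonneg) measureReal_le_one
    (w := fun l i => μ.real (countEvent f U B i l 0)) (v := fun l i => cpMass θ π (l * δ) i * P)
    hw hv (hstart g le_rfl hgm) d le_rfl k le_rfl
  refine hmain.trans ?_
  -- The number of steps times the error scale `ε * δ` is at most `T * ε`.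
  have hdT : d * δ ≤ T := by
    refine le_trans (mul_le_mul_of_nonneg_right ?_ hδ0) hT
    exact_mod_cast Nat.le_add_left d g
  calc (1 + K) * ε + d * (8 * (k + 1) * (ε * δ) + (K + (k + 1) * K) * (ε * δ)) =
        (1 + K) * ε + (d * δ) * ((8 * (k + 1) + K + (k + 1) * K) * ε) := by ring
    _ ≤ (1 + K) * ε + T * ((8 * (k + 1) + K + (k + 1) * K) * ε) := by gcongr
    _ = _ := by ring

/-- The number of visits before a time of order `1 / μ (U n)` is asymptotically compound Poisson
and independent of the future. -/
theorem RareClusters.tendsto_countEvent (hf : MeasurePreserving f μ μ) {U : ℕ → Set X} {q : ℕ}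
    {θ : ℝ} {π : ℕ → ℝ} (h : RareClusters μ f U q θ π) {t : ℝ} (ht : 0 ≤ t) {m : ℕ → ℕ}
    (hm : Tendsto (fun n => m n * μ.real (U n)) atTop (𝓝 t)) {B : ℕ → Set X}
    (hB : ∀ n, MeasurableSet (B n)) (k : ℕ) :
    Tendsto (fun n => μ.real (countEvent f (U n) (B n) k (m n) 0) -
      cpMass θ π t k * μ.real (B n)) atTop (𝓝 0) := by
  obtain ⟨K, hK0, hK⟩ := exists_cpMass_bounds θ π k (t + 1)
  set C := 1 + K + (t + 1) * (8 * (k + 1) + K + (k + 1) * K) + K with hC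
  have hC0 : 0 < C := by positivity
  rw [Metric.tendsto_nhds]
  intro η hη
  set ε := η / (2 * C) with hε
  have hε0 : 0 < ε := by positivity
  obtain ⟨r, hr, hsum, hdec⟩ := h.decay
  obtain ⟨s₀, hs₀⟩ := exists_sum_Ico_lt hsum hε0
  have hto0 : Tendsto (fun n => μ.real (U n)) atTop (𝓝 0) :=
    h.tendsto_measure.mono_right nhdsWithin_le_nhds
  filter_upwards [hdec, h.gap (2 * q), h.gap s₀, h.eventually_abs_le hε0 k,
    h.tendsto_measure.eventually (eventually_exists_separation hsum hε0 (q + 1)),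
    hto0.eventually (gt_mem_nhds hε0), hm.eventually (gt_mem_nhds (lt_add_one t)),
    (Metric.tendsto_nhds.1 hm) ε hε0] with n hdecn hgap hgap₀ hab hsep hδε hmT hmt
  obtain ⟨g, hqg, hgε, hrg⟩ := hsep
  have hβ := fun κ => measureReal_second_cluster_le (h.measurableSet n) (g := g) hr hdecn hgap₀ κ
  have hδ0 : 0 ≤ μ.real (U n) := measureReal_nonneg
  have hβε : g * μ.real (U n) ^ 2 + μ.real (U n) * ∑ s ∈ Finset.Ico (s₀ + 1) g, r s ≤
      2 * ε * μ.real (U n) := by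
    have := (hs₀ (s₀ + 1) g (by lia)).le
    nlinarith
  have h1 := abs_countEvent_sub_cpMass_le hf (h.measurableSet n) hr hdecn hgap hK0 hK hab.1 hab.2
    hqg hgε hrg hδε.le hmT.le hβ hβε (hB n)
  have h2 := (hK k le_rfl).2.1 t ⟨ht, by linarith⟩ (m n * μ.real (U n)) ⟨by positivity, hmT.le⟩
  rw [Real.dist_eq] at hmt
  have h3 : |cpMass θ π (m n * μ.real (U n)) k * μ.real (B n) - cpMass θ π t k * μ.real (B n)| ≤
      K * ε := by
    rw [← sub_mul, abs_mul, abs_of_nonneg (measureReal_nonneg (s := B n))]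
    exact (mul_le_of_le_one_right (abs_nonneg _) measureReal_le_one).trans
      (h2.trans (mul_le_mul_of_nonneg_left hmt.le hK0))
  rw [Real.dist_eq, sub_zero]
  have h4 : C * ε < η := by
    rw [hε]
    have : C * (η / (2 * C)) = η / 2 := by field_simp
    linarith
  refine lt_of_le_of_lt ?_ h4
  rw [abs_le] at h1 h3 ⊢
  constructor <;> linarith

end Limit


/-! ### From visits in blocks to the rare event point process. -/

section REPP

theorem toPointMeasure_val {ν : Measure ℝ≥0} (h : IsPointMeasure ν) : (toPointMeasure ν).1 = ν := by
  have : toPointMeasure ν = ⟨ν, h⟩ := dif_pos h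
  rw [this]

variable {X : Type*} [MeasurableSpace X] {μ : Measure X} {f : X → X} {φ : X → EReal} {u : ℝ}

theorem repp_measure_eq (x : X) :
    (Measure.sum fun j : ℕ => (exceedSet φ u).indicator
      (fun _ => Measure.dirac ((j : ℝ≥0) / ((μ (exceedSet φ u)).toNNReal)⁻¹)) (f^[j] x)) =
    pointSum (fun j => (exceedSet φ u).indicator (fun _ => 1) (f^[j] x))
      (fun j => (j : ℝ≥0) * (μ (exceedSet φ u)).toNNReal) := by
  rw [pointSum]
  congr 1
  funext j
  by_cases hj : f^[j] x ∈ exceedSet φ u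
  · simp [hj]
  · simp [hj]

theorem repp_val (hu : 0 < (μ (exceedSet φ u)).toNNReal) (x : X) :
    (repp μ f φ u x).1 = pointSum (fun j => (exceedSet φ u).indicator (fun _ => 1) (f^[j] x))
      (fun j => (j : ℝ≥0) * (μ (exceedSet φ u)).toNNReal) := by
  have hp : IsPointMeasure (pointSum (fun j => (exceedSet φ u).indicator (fun _ => 1) (f^[j] x))
      (fun j => (j : ℝ≥0) * (μ (exceedSet φ u)).toNNReal)) := by
    refine isPointMeasure_pointSum _ _ fun t => ?_
    obtain ⟨n, hn⟩ := exists_nat_gt (t / (μ (exceedSet φ u)).toNNReal)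
    refine ⟨n, fun i hi => ?_⟩
    rw [← div_le_iff₀ hu]
    exact hn.le.trans (by exact_mod_cast hi)
  rw [repp, repp_measure_eq, toPointMeasure_val hp]

/-- The first time in the `l`-th cell of the grid of mesh `h` when the unit of time is `1 / δ`. -/
noncomputable def cellStart (δ h : ℝ≥0) (l : ℕ) : ℕ := ⌈l * h / δ⌉₊

theorem repp_gridCell (hu : 0 < (μ (exceedSet φ u)).toNNReal) (h : ℝ≥0) (l : ℕ) (x : X) :
    (repp μ f φ u x).1 (gridCell h l) =
      visits f (exceedSet φ u) (cellStart (μ (exceedSet φ u)).toNNReal h l)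
        (cellStart (μ (exceedSet φ u)).toNNReal h (l + 1)) x := by
  set δ := (μ (exceedSet φ u)).toNNReal
  have hmem : ∀ j : ℕ, (j : ℝ≥0) * δ ∈ gridCell h l ↔
      j ∈ Finset.Ico (cellStart δ h l) (cellStart δ h (l + 1)) := fun j => by
    rw [gridCell, mem_Ico, Finset.mem_Ico, cellStart, cellStart, Nat.ceil_le, Nat.lt_ceil,
      div_le_iff₀ hu, lt_div_iff₀ hu]
    push_cast
    rfl
  rw [repp_val hu, pointSum_apply _ _ (measurableSet_gridCell h l),
    tsum_eq_sum (s := Finset.Ico (cellStart δ h l) (cellStart δ h (l + 1))), visits]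
  · rw [Nat.cast_sum]
    refine Finset.sum_congr rfl fun j hj => ?_
    rw [indicator_of_mem ((hmem j).2 hj)]
    simp
  · intro j hj
    rw [indicator_of_notMem fun hj' => hj ((hmem j).1 hj'), mul_zero]

theorem monotone_cellStart (δ h : ℝ≥0) : Monotone (cellStart δ h) := fun a b hab => by
  refine Nat.ceil_mono ?_
  gcongr

/-- A version of the rare event point process that is measurable for every level. -/
noncomputable def reppVersion (μ : Measure X) (f : X → X) (φ : X → EReal) (u : ℝ) (x : X) :
    PointMeasure :=
  open Classical in
  if 0 < (μ (exceedSet φ u)).toNNReal then repp μ f φ u x else toPointMeasure 0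

theorem measurable_reppVersion_gridCell (hf : Measurable f) (hU : MeasurableSet (exceedSet φ u))
    (h : ℝ≥0) (l : ℕ) : Measurable fun x => (reppVersion μ f φ u x).1 (gridCell h l) := by
  unfold reppVersion
  split_ifs with hu
  · simp only [repp_gridCell hu]
    exact (measurable_from_top (f := fun n : ℕ => (n : ℝ≥0∞))).comp (measurable_visits hf hU _ _)
  · exact measurable_const

variable [IsProbabilityMeasure μ]

/-- The numbers of visits in successive long blocks of times are asymptotically independent. -/
theorem RareClusters.tendsto_blocks (hf : MeasurePreserving f μ μ) {U : ℕ → Set X} {q : ℕ}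
    {θ : ℝ} {π : ℕ → ℝ} (h : RareClusters μ f U q θ π) {t : ℝ} (ht : 0 ≤ t) {L : ℕ}
    (c : ℕ → ℕ → ℕ) (hc0 : ∀ n, c n 0 = 0) (hmono : ∀ n, Monotone (c n))
    (hc : ∀ l, Tendsto (fun n => ((c n (l + 1) : ℝ) - c n l) * μ.real (U n)) atTop (𝓝 t))
    (k : Fin L → ℕ) :
    Tendsto (fun n => μ.real {x | ∀ l : Fin L, visits f (U n) (c n l) (c n (l + 1)) x = k l}) atTop
      (𝓝 (∏ l, cpMass θ π t (k l))) := by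
  induction L generalizing c with
  | zero => simp
  | succ L ih =>
    -- The blocks after the first, with time restarted at `c n 1`. Their event `B n` is the future
    -- event of `countEvent`, whose limit theorem allows `B` to depend on `n`; this gives the
    -- induction step.
    set c' : ℕ → ℕ → ℕ := fun n l => c n (l + 1) - c n 1
    have hle : ∀ n l, c n 1 ≤ c n (l + 1) := fun n l => hmono n (by lia)
    set B : ℕ → Set X := fun n =>
      {x | ∀ l : Fin L, visits f (U n) (c' n l) (c' n (l + 1)) x = k l.succ} with hBdef
    have hB : ∀ n, MeasurableSet (B n) := fun n => by
      simp only [hBdef, ofPred_forall]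
      exact MeasurableSet.iInter fun l =>
        measurable_visits hf.measurable (h.measurableSet n) _ _ (measurableSet_singleton _)
    have hBlim := ih c' (fun n => by simp [c'])
      (fun n a b hab => Nat.sub_le_sub_right (hmono n (by lia)) _)
      (fun l => by
        refine (hc (l + 1)).congr fun n => ?_
        simp only [c']
        rw [Nat.cast_sub (hle n _), Nat.cast_sub (hle n _)]
        ring) (fun l => k l.succ)
    have hset : ∀ n, {x | ∀ l : Fin (L + 1), visits f (U n) (c n l) (c n (l + 1)) x = k l} =
        countEvent f (U n) (B n) (k 0) (c n 1) 0 := fun n => by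
      ext x
      simp only [Fin.forall_fin_succ, countEvent, hBdef, mem_ofPred_eq, Fin.val_zero, Fin.val_succ,
        hc0, zero_add, add_zero, visits_iterate, c', Nat.sub_add_cancel (hle n _)]
    have hm : Tendsto (fun n => (c n 1 : ℝ) * μ.real (U n)) atTop (𝓝 t) := by
      refine (hc 0).congr fun n => ?_
      simp [hc0]
    have h1 := (h.tendsto_countEvent hf ht hm hB (k 0)).add (hBlim.const_mul (cpMass θ π t (k 0)))
    rw [zero_add, ← Fin.prod_univ_succ fun l => cpMass θ π t (k l)] at h1
    refine h1.congr fun n => ?_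
    rw [hset]
    ring

theorem reppVersion_ae_eq (hf : MeasurePreserving f μ μ) (hU : MeasurableSet (exceedSet φ u)) :
    reppVersion μ f φ u =ᵐ[μ] repp μ f φ u := by
  by_cases hu : 0 < (μ (exceedSet φ u)).toNNReal
  · exact Eventually.of_forall fun x => if_pos hu
  · have h0 : μ (exceedSet φ u) = 0 := by
      have := nonpos_iff_eq_zero.1 (not_lt.1 hu)
      rw [ENNReal.toNNReal_eq_zero_iff] at this
      exact this.resolve_right (measure_ne_top _ _)
    have hnull : ∀ᵐ x ∂μ, ∀ j : ℕ, f^[j] x ∉ exceedSet φ u := by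
      refine ae_all_iff.2 fun j => (measure_eq_zero_iff_ae_notMem (s := f^[j] ⁻¹' exceedSet φ u)).1 ?_
      rw [(hf.iterate j).measure_preimage hU.nullMeasurableSet, h0]
    filter_upwards [hnull] with x hx
    rw [reppVersion, if_neg hu, repp, repp_measure_eq, pointSum]
    simp [hx]

theorem tendsto_cellStart {δ : ℕ → ℝ≥0} (hδ : Tendsto (fun n => (δ n : ℝ)) atTop (𝓝[>] 0))
    (h : ℝ≥0) (l : ℕ) :
    Tendsto (fun n => (cellStart (δ n) h l : ℝ) * δ n) atTop (𝓝 (l * h)) := by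
  have hpos : ∀ᶠ n in atTop, 0 < (δ n : ℝ) := hδ self_mem_nhdsWithin
  have h0 : Tendsto (fun n => (δ n : ℝ)) atTop (𝓝 0) := hδ.mono_right nhdsWithin_le_nhds
  have h1 : Tendsto (fun n => (l * h : ℝ) + δ n) atTop (𝓝 (l * h)) := by
    simpa using tendsto_const_nhds.add h0
  refine tendsto_of_tendsto_of_tendsto_of_le_of_le' tendsto_const_nhds h1 ?_ ?_
  · filter_upwards [hpos] with n hn
    rw [← div_le_iff₀ hn]
    exact_mod_cast Nat.le_ceil (l * h / δ n)
  · filter_upwards [hpos] with n hn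
    have h2 : ((cellStart (δ n) h l : ℝ≥0)) < l * h / δ n + 1 := Nat.ceil_lt_add_one zero_le
    have h3 : (cellStart (δ n) h l : ℝ) ≤ l * h / δ n + 1 := by exact_mod_cast h2.le
    calc (cellStart (δ n) h l : ℝ) * δ n ≤ (l * h / δ n + 1) * δ n := by gcongr
      _ = l * h + δ n := by field_simp

/-- A version of the compound Poisson process with clusters that never accumulate. -/
noncomputable def compoundPoissonVersion (ω : (ℕ → ℝ) × (ℕ → ℕ)) : PointMeasure :=
  open Classical in
  if Tendsto (arrival ω.1) atTop atTop then toPointMeasure (cpMeasure ω) else toPointMeasure 0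

theorem compoundPoissonVersion_val {ω : (ℕ → ℝ) × (ℕ → ℕ)}
    (hω : Tendsto (arrival ω.1) atTop atTop) : (compoundPoissonVersion ω).1 = cpMeasure ω := by
  have hp : IsPointMeasure (cpMeasure ω) := isPointMeasure_pointSum _ _ fun t =>
    eventually_atTop.1 (hω.eventually_ge_atTop t)
  rw [compoundPoissonVersion, if_pos hω, toPointMeasure_val hp]

theorem measurable_compoundPoissonVersion_gridCell (h : ℝ≥0) (l : ℕ) :
    Measurable fun ω => (compoundPoissonVersion ω).1 (gridCell h l) := by
  classical
  have e : (fun ω => (compoundPoissonVersion ω).1 (gridCell h l)) = fun ω =>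
      if Tendsto (arrival ω.1) atTop atTop then cpMeasure ω (gridCell h l) else 0 := by
    funext ω
    split_ifs with hω
    · rw [compoundPoissonVersion_val hω]
    · rw [compoundPoissonVersion, if_neg hω, toPointMeasure_val isPointMeasure_zero]
      rfl
  rw [e]
  refine Measurable.ite ?_ ((Measure.measurable_coe (measurableSet_gridCell h l)).comp
    measurable_cpMeasure) measurable_const
  exact measurableSet_tendsto _ fun i => (measurable_arrival i).comp measurable_fst

variable {θ : {r : ℝ // 0 < r}} {p : PMF ℕ}

theorem ae_waitingTime_nonneg :
    ∀ᵐ ω ∂compoundPoissonSpace θ p, ∀ l : ℕ, 0 ≤ ω.1 l := by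
  have := isProbabilityMeasure_expMeasure θ.2
  refine ae_all_iff.2 fun l => ?_
  have h1 : ∀ᵐ r ∂expMeasure (θ : ℝ), 0 ≤ r := by
    have hm : MeasurableSet (Iio (0 : ℝ)) := measurableSet_Iio
    have h2 : expMeasure (θ : ℝ) (Iio 0) = 0 := by
      rw [← lintegral_indicator_one hm, lintegral_expMeasure θ (measurable_one.indicator hm),
        setLIntegral_congr_fun (g := fun _ => 0) measurableSet_Ici, lintegral_zero]
      intro r hr
      simp [not_lt.2 (mem_Ici.1 hr)]
    filter_upwards [measure_eq_zero_iff_ae_notMem.1 h2] with r hr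
    exact not_lt.1 hr
  exact Measure.quasiMeasurePreserving_fst.ae
    ((measurePreserving_eval_infinitePi (fun _ : ℕ => expMeasure (θ : ℝ)) l).quasiMeasurePreserving.ae
      h1)

theorem compoundPoissonVersion_ae_eq :
    compoundPoissonVersion =ᵐ[compoundPoissonSpace θ p] compoundPoisson := by
  filter_upwards [ae_waitingTime_nonneg (θ := θ) (p := p), ae_tendsto_arrival (p := p) θ] with ω h1 h2
  rw [compoundPoissonVersion, if_pos h2, compoundPoisson, cpMeasure, pointSum]
  congr 3
  funext i
  -- `arrival` truncates each waiting time and `compoundPoisson` truncates the sum; they agree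
  -- because almost surely no waiting time is negative.
  rw [Real.toNNReal_sum_of_nonneg fun l _ => h1 l]
  rfl

/-- Convergence of the rare event point processes to the compound Poisson process. -/
theorem RareClusters.tendstoInDistribution_repp (hf : MeasurePreserving f μ μ) {u : ℕ → ℝ} {q : ℕ}
    (hp : p 0 = 0)
    (h : RareClusters μ f (fun n => exceedSet φ (u n)) q θ fun j => (p j).toReal) :
    TendstoInDistribution (fun n => repp μ f φ (u n)) atTop compoundPoisson
      (fun _ => μ) (compoundPoissonSpace θ p) := by
  refine TendstoInDistribution.congr (fun n => reppVersion_ae_eq hf (h.measurableSet n))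
    compoundPoissonVersion_ae_eq ?_
  refine tendstoInDistribution_of_counts
    (fun n g l => measurable_reppVersion_gridCell hf.measurable (h.measurableSet n) g l)
    measurable_compoundPoissonVersion_gridCell fun g hg L k => ?_
  have hlimit : compoundPoissonSpace θ p {ω | HasCounts g k (compoundPoissonVersion ω).1} =
      ENNReal.ofReal (∏ l, cpMass θ (fun j => (p j).toReal) g (k l)) := by
    rw [ENNReal.ofReal_prod_of_nonneg fun l _ => cpMass_nonneg θ.2.le
      (fun _ => ENNReal.toReal_nonneg) _ g.coe_nonneg, ← compoundPoissonSpace_hasCounts θ hp]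
    refine measure_congr ?_
    filter_upwards [ae_tendsto_arrival (p := p) θ] with ω hω
    change HasCounts g k (compoundPoissonVersion ω).1 = HasCounts g k (cpMeasure ω)
    rw [compoundPoissonVersion_val hω]
  rw [hlimit]
  set δ : ℕ → ℝ≥0 := fun n => (μ (exceedSet φ (u n))).toNNReal with hδ
  have hδt : Tendsto (fun n => (δ n : ℝ)) atTop (𝓝[>] 0) := h.tendsto_measure
  have hblocks := h.tendsto_blocks hf g.coe_nonneg (fun n => cellStart (δ n) g)
    (fun n => by simp [cellStart]) (fun n => monotone_cellStart _ _) (fun l => by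
      have h1 := (tendsto_cellStart hδt g (l + 1)).sub (tendsto_cellStart hδt g l)
      have e : ((l + 1 : ℕ) : ℝ) * g - l * g = g := by push_cast; ring
      rw [e] at h1
      refine h1.congr fun n => ?_
      rw [← sub_mul]
      rfl) k
  refine (ENNReal.tendsto_ofReal hblocks).congr' ?_
  have hpos : ∀ᶠ n in atTop, 0 < (δ n : ℝ) := hδt self_mem_nhdsWithin
  filter_upwards [hpos] with n hn
  have hn' : 0 < (μ (exceedSet φ (u n))).toNNReal := by exact_mod_cast hn
  rw [ofReal_measureReal]
  congr 1
  ext x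
  simp only [mem_ofPred_eq, HasCounts, reppVersion, if_pos hn', repp_gridCell hn', Nat.cast_inj]
  rfl

end REPP


/-! ### The cluster sets in terms of the admissible indices -/

section OrbitBalls

variable {X : Type*} {f : X → X} {m : ℕ → ℕ} {N : ℕ} {W : ℕ → Set X}

/-- The points of `W i` with at least `k` visits to the union of the sets `W j` at the times
`1, …, m_N - m_1`. -/
def atLeast (f : X → X) (m : ℕ → ℕ) (N : ℕ) (W : ℕ → Set X) (i k : ℕ) : Set X :=
  {x | x ∈ W i ∧ k ≤ visits f (⋃ j ∈ Finset.Icc 1 N, W j) 1 (m N - m 1 + 1) x}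

theorem pullBack_self_inter (i : ℕ) : pullBack f m W i i ∩ W i = W i := by
  simp [pullBack]

theorem atLeast_zero (i : ℕ) :
    atLeast f m N W i 0 = W i := by simp [atLeast]

theorem clusterSet_eq_iUnion_atLeast (k : ℕ) :
    clusterSet f (⋃ j ∈ Finset.Icc 1 N, W j) (m N - m 1) k =
      ⋃ i ∈ Finset.Icc 1 N, atLeast f m N W i k \ atLeast f m N W i (k + 1) := by
  ext x
  simp only [clusterSet, atLeast, mem_ofPred_eq, mem_iUnion, exists_prop, Set.mem_sdiff]
  grind

variable [TopologicalSpace X]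

/-- Small open neighbourhoods `W i` of the points `f^{m_i}(ζ)`, between which `f` moves points only
along the orbit of `ζ`. -/
structure OrbitBalls (f : X → X) (ζ : X) (m : ℕ → ℕ) (N : ℕ) (W : ℕ → Set X) : Prop where
  strictMono : StrictMonoOn m (Set.Icc 1 N)
  isOpen : ∀ i, IsOpen (W i)
  mem : ∀ i ∈ Finset.Icc 1 N, f^[m i] ζ ∈ W i
  return_time : ∀ i ∈ Finset.Icc 1 N, ∀ j ∈ Finset.Icc 1 N, ∀ s ≤ 2 * (m N - m 1), ∀ x ∈ W i,
    f^[s] x ∈ W j → m j = s + m i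
  continuousOn : ∀ i j, 1 ≤ i → i < j → j ≤ N → ContinuousOn f^[m j - m i] (W i)
  nesting : NestingCondition f m N W
  singlePiece : SinglePiece f m N W

variable {ζ : X}

namespace OrbitBalls

variable (h : OrbitBalls f ζ m N W)

include h

theorem lt_iff {i j : ℕ} (hi : i ∈ Finset.Icc 1 N) (hj : j ∈ Finset.Icc 1 N) :
    m i < m j ↔ i < j :=
  h.strictMono.lt_iff_lt (by simpa using hi) (by simpa using hj)

theorem le_iff {i j : ℕ} (hi : i ∈ Finset.Icc 1 N) (hj : j ∈ Finset.Icc 1 N) :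
    m i ≤ m j ↔ i ≤ j :=
  h.strictMono.le_iff_le (by simpa using hi) (by simpa using hj)

theorem sub_le {i j : ℕ} (hi : i ∈ Finset.Icc 1 N) (hj : j ∈ Finset.Icc 1 N) :
    m j - m i ≤ m N - m 1 := by
  have hN : 1 ≤ N := (Finset.mem_Icc.1 hi).1.trans (Finset.mem_Icc.1 hi).2
  have h1 := (h.le_iff (i := 1) (j := i) (by simp [hN]) hi).2 (Finset.mem_Icc.1 hi).1
  have h2 := (h.le_iff (i := j) (j := N) hj (by simp [hN])).2 (Finset.mem_Icc.1 hj).2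
  lia

theorem iterate_sub {i a b : ℕ} (hi : i ∈ Finset.Icc 1 N) (ha : a ∈ Finset.Icc 1 N)
    (hb : b ∈ Finset.Icc 1 N) (hia : i ≤ a) (hab : a ≤ b) (x : X) :
    f^[m b - m a] (f^[m a - m i] x) = f^[m b - m i] x := by
  rw [← Function.iterate_add_apply]
  have h1 := (h.le_iff hi ha).2 hia
  have h2 := (h.le_iff ha hb).2 hab
  congr 2
  lia

theorem gapAfter :
    GapAfter f (⋃ j ∈ Finset.Icc 1 N, W j) (m N - m 1) (2 * (m N - m 1)) := by
  intro x hx s hs hs2 hfx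
  simp only [mem_iUnion, exists_prop] at hx hfx
  obtain ⟨i, hi, hxi⟩ := hx
  obtain ⟨j, hj, hxj⟩ := hfx
  have h1 := h.return_time i hi j hj s hs2 x hxi hxj
  have h2 := h.sub_le hi hj
  lia

theorem disjoint {i j : ℕ} (hi : i ∈ Finset.Icc 1 N) (hj : j ∈ Finset.Icc 1 N) (hij : i ≠ j) :
    Disjoint (W i) (W j) := by
  refine Set.disjoint_left.2 fun x hx hx' => hij ?_
  have := h.return_time i hi j hj 0 (Nat.zero_le _) x hx hx'
  exact h.strictMono.injOn (by simpa using hi) (by simpa using hj) (by lia)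

/-- The main consequence of the condition that the intersections are connected. -/
theorem pullBack_inter_subset {i l j : ℕ} (hi : 1 ≤ i) (hil : i < l) (hlj : l < j) (hj : j ≤ N)
    (hfr : pullBack f m W l j ∩ frontier (W l) = ∅) :
    pullBack f m W i j ∩ W i ⊆ pullBack f m W i l := by
  have hi' : i ∈ Finset.Icc 1 N := Finset.mem_Icc.2 (by lia)
  have hl' : l ∈ Finset.Icc 1 N := Finset.mem_Icc.2 (by lia)
  have hj' : j ∈ Finset.Icc 1 N := Finset.mem_Icc.2 (by lia)
  have hconn := (h.singlePiece i j hi (hil.trans hlj) hj).image _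
    ((h.continuousOn i l hi hil (by lia)).mono inter_subset_right)
  have hsub : f^[m l - m i] '' (pullBack f m W i j ∩ W i) ⊆ pullBack f m W l j := by
    rintro _ ⟨x, hx, rfl⟩
    rw [pullBack, mem_preimage, h.iterate_sub hi' hl' hj' hil.le hlj.le]
    exact hx.1
  -- The image is connected and avoids the frontier of `W l`, so it lies in `W l` or in the
  -- complement of the closure. It contains `f^[m l] ζ`, which is in `W l`.
  have hkey : f^[m l - m i] '' (pullBack f m W i j ∩ W i) ⊆ W l := by
    refine hconn.subset_left_of_subset_union (h.isOpen l) isClosed_closure.isOpen_compl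
      (Set.disjoint_left.2 fun x hx hx' => hx' (subset_closure hx)) (fun y hy => ?_) ?_
    · by_contra hc
      simp only [mem_union, mem_compl_iff, not_or, not_not] at hc
      have hy' : y ∈ pullBack f m W l j ∩ frontier (W l) :=
        ⟨hsub hy, hc.2, fun hint => hc.1 (interior_subset hint)⟩
      rw [hfr] at hy'
      exact hy'
    · have e : ∀ {b : ℕ}, b ∈ Finset.Icc 1 N → i ≤ b → f^[m b - m i] (f^[m i] ζ) = f^[m b] ζ := by
        intro b hb hib
        rw [← Function.iterate_add_apply, Nat.sub_add_cancel ((h.le_iff hi' hb).2 hib)]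
      refine ⟨f^[m l] ζ, ⟨f^[m i] ζ, ⟨?_, h.mem i hi'⟩, e hl' hil.le⟩, h.mem l hl'⟩
      rw [pullBack, mem_preimage, e hj' (hil.trans hlj).le]
      exact h.mem j hj'
  exact fun x hx => hkey ⟨x, hx, rfl⟩

/-- The first return lies in some `W l` and happens at time `m l - m i`; the gap lets the remaining
visits be counted from there. Conversely any such visit, not only the first, adds one to the count.
-/
theorem mem_atLeast_succ_iff {i : ℕ} (hi : i ∈ Finset.Icc 1 N) (k : ℕ) (x : X) :
    x ∈ atLeast f m N W i (k + 1) ↔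
      x ∈ W i ∧ ∃ l, i < l ∧ l ≤ N ∧ f^[m l - m i] x ∈ atLeast f m N W l k := by
  set U := ⋃ j ∈ Finset.Icc 1 N, W j with hU
  have hWU : ∀ {l y}, l ∈ Finset.Icc 1 N → y ∈ W l → y ∈ U := fun hl hy =>
    mem_biUnion (Finset.mem_coe.2 hl) hy
  refine and_congr_right fun hx => ⟨fun hv => ?_, ?_⟩
  · obtain ⟨r, hr1, hrq, hr, hfirst⟩ := exists_first_visit (f := f) (U := U) (q := m N - m 1)
      (x := x) (by lia)
    obtain ⟨l, hl, hrl⟩ : ∃ l, l ∈ Finset.Icc 1 N ∧ f^[r] x ∈ W l := by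
      simpa only [hU, mem_iUnion, exists_prop] using hr
    have hrt := h.return_time i hi l hl r (by lia) x hx hrl
    have e : m l - m i = r := by lia
    refine ⟨l, (h.lt_iff hi hl).1 (by lia), (Finset.mem_Icc.1 hl).2, ?_, ?_⟩
    · rw [e]; exact hrl
    · rw [e, h.gapAfter.visits_iterate_eq (hWU hi hx) hrq]
      have := visits_eq_of_first_visit hr1 hrq hr hfirst
      lia
  · rintro ⟨l, hil, hlN, hxl, hv⟩
    have hl : l ∈ Finset.Icc 1 N := Finset.mem_Icc.2 (by lia)
    have hlt := (h.lt_iff hi hl).2 hil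
    have hle := h.sub_le hi hl
    rw [h.gapAfter.visits_iterate_eq (hWU hi hx) hle] at hv
    have h3 := visits_add (f := f) (U := U) (a := 1) (b := m l - m i) (c := m N - m 1 + 1)
      (by lia) (by lia) x
    have h4 := visits_succ_of_mem (f := f) (U := U) (a := m l - m i) (b := m N - m 1 + 1)
      (by lia) (hWU hl hxl)
    lia

/-- Each further visit goes to a strictly larger index, so a point of `W i` has at most `N - i` of
them. -/
theorem atLeast_eq_empty (k : ℕ) {i : ℕ} (hi : 1 ≤ i) (hiN : i ≤ N) (hik : N < i + k) :
    atLeast f m N W i k = ∅ := by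
  induction k generalizing i with
  | zero => lia
  | succ k ih =>
    refine eq_empty_of_forall_notMem fun x hx => ?_
    obtain ⟨-, l, hil, hlN, hxl⟩ := (h.mem_atLeast_succ_iff (Finset.mem_Icc.2 ⟨hi, hiN⟩) k x).1 hx
    rw [ih (by lia) hlN (by lia)] at hxl
    exact hxl

/-- The union of the pull-backs chosen at level `k` meets `W i` in the set of points of `W i` with
at least `k + 1` later visits. -/
theorem pullUnion_inter_eq {j : ℕ → ℕ → ℕ} {k : ℕ}
    (hj : ∀ l ∈ Finset.Icc 1 (N - k), l ≤ j l k ∧ j l k ≤ N ∧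
      atLeast f m N W l k = pullBack f m W l (j l k) ∩ W l ∧
      (j l k ≠ l → pullBack f m W l (j l k) ∩ frontier (W l) = ∅))
    {i : ℕ} (hi : 1 ≤ i) (hiN : i ≤ N) :
    pullUnion f m N W j i k ∩ W i = atLeast f m N W i (k + 1) := by
  have hi' : i ∈ Finset.Icc 1 N := Finset.mem_Icc.2 ⟨hi, hiN⟩
  ext x
  rw [h.mem_atLeast_succ_iff hi']
  simp only [pullUnion, mem_inter_iff, mem_iUnion, exists_prop, Finset.mem_Icc]
  rw [and_comm]
  refine and_congr_right fun hx => ⟨?_, ?_⟩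
  · rintro ⟨l, ⟨hil, hlN⟩, hxl⟩
    obtain ⟨hlj, hjN, hV, hfr⟩ := hj l (Finset.mem_Icc.2 (by lia))
    have hl' : l ∈ Finset.Icc 1 N := Finset.mem_Icc.2 (by lia)
    -- Membership in the pull-back of `W (j l k)` does not by itself give a visit to `W l`;
    -- avoidance of the frontier supplies it when `j l k ≠ l`.
    have hxl' : f^[m l - m i] x ∈ W l := by
      by_cases hne : j l k = l
      · rwa [hne] at hxl
      · exact h.pullBack_inter_subset hi (by lia) (by lia) hjN (hfr hne) ⟨hxl, hx⟩
    refine ⟨l, by lia, by lia, ?_⟩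
    rw [hV]
    refine ⟨?_, hxl'⟩
    rw [pullBack, mem_preimage, h.iterate_sub hi' hl' (Finset.mem_Icc.2 (by lia)) (by lia) hlj]
    exact hxl
  · rintro ⟨l, hil, hlN, hxl⟩
    have hlk : l + k ≤ N := by
      by_contra hc
      rw [h.atLeast_eq_empty k (by lia) hlN (by lia)] at hxl
      exact hxl
    have hl' : l ∈ Finset.Icc 1 N := Finset.mem_Icc.2 (by lia)
    obtain ⟨hlj, hjN, hV, -⟩ := hj l (Finset.mem_Icc.2 (by lia))
    rw [hV] at hxl
    refine ⟨l, by lia, ?_⟩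
    have h1 := hxl.1
    rw [pullBack, mem_preimage, h.iterate_sub hi' hl' (Finset.mem_Icc.2 (by lia)) (by lia) hlj] at h1
    exact h1

/-- Some pull-back in the union meets the boundary of `W i`, so the nesting condition leaves only
the alternative that it contains all of `W i`. -/
theorem atLeast_eq_of_notMem_indexSet {j : ℕ → ℕ → ℕ} {k : ℕ}
    (hj : ∀ l ∈ Finset.Icc 1 (N - k), l ≤ j l k ∧ j l k ≤ N ∧
      atLeast f m N W l k = pullBack f m W l (j l k) ∩ W l ∧
      (j l k ≠ l → pullBack f m W l (j l k) ∩ frontier (W l) = ∅))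
    {i : ℕ} (hi : i ∈ Finset.Icc 1 (N - (k + 1))) (hiI : i ∉ indexSet f m N W j k) :
    atLeast f m N W i (k + 1) = W i := by
  have hi1 := Finset.mem_Icc.1 hi
  rw [← h.pullUnion_inter_eq hj hi1.1 (by lia), inter_eq_right]
  have hne : (pullUnion f m N W j i k ∩ frontier (W i)).Nonempty := by
    rw [nonempty_iff_ne_empty]
    intro h0
    exact hiI (Finset.mem_filter.2 ⟨hi, h0⟩)
  obtain ⟨x, hx, hxf⟩ := hne
  simp only [pullUnion, mem_iUnion, exists_prop, Finset.mem_Icc] at hx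
  obtain ⟨l, hl, hxl⟩ := hx
  obtain ⟨hlj, hjN, -⟩ := hj l (Finset.mem_Icc.2 (by lia))
  rcases h.nesting i (j l k) hi1.1 (by lia) hjN with hsub | hfr
  · refine hsub.trans fun y hy => ?_
    exact mem_biUnion (Finset.mem_coe.2 (Finset.mem_Icc.2 hl)) hy
  · have : x ∈ pullBack f m W i (j l k) ∩ frontier (W i) := ⟨hxl, hxf⟩
    rw [hfr] at this
    exact this.elim

/-- The invariant of the induction on `k`. The set identity is what the measure formula uses; the
frontier clause is carried along because `pullBack_inter_subset` needs it at the next level. -/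
theorem indexChoice_spec {j : ℕ → ℕ → ℕ} (hj : IsIndexChoice f m N W j) (k : ℕ) :
    ∀ l ∈ Finset.Icc 1 (N - k), l ≤ j l k ∧ j l k ≤ N ∧
      atLeast f m N W l k = pullBack f m W l (j l k) ∩ W l ∧
      (j l k ≠ l → pullBack f m W l (j l k) ∩ frontier (W l) = ∅) := by
  induction k with
  | zero =>
    intro l hl
    rw [hj.zero l hl, atLeast_zero, pullBack_self_inter]
    exact ⟨le_rfl, (Finset.mem_Icc.1 hl).2, rfl, fun h => absurd rfl h⟩
  | succ k ih =>
    intro i hi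
    have hi1 := Finset.mem_Icc.1 hi
    by_cases hiI : i ∈ indexSet f m N W j k
    · obtain ⟨⟨l, hl, hjl⟩, hP⟩ := hj.succ_mem k i hiI
      have hl1 := Finset.mem_Icc.1 hl
      obtain ⟨hlj, hjN, -⟩ := ih l (Finset.mem_Icc.2 (by lia))
      refine ⟨by lia, by lia, ?_, fun _ => ?_⟩
      · rw [← hP, h.pullUnion_inter_eq ih hi1.1 (by lia)]
      · rw [hjl]
        refine subset_empty_iff.1 ((inter_subset_inter_left _ ?_).trans
          (Finset.mem_filter.1 hiI).2.subset)
        exact fun y hy => mem_biUnion (Finset.mem_coe.2 hl) hy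
    · rw [hj.succ_not_mem k i hi hiI, pullBack_self_inter,
        h.atLeast_eq_of_notMem_indexSet ih hi hiI]
      exact ⟨le_rfl, by lia, rfl, fun h => absurd rfl h⟩

/-- Nesting between `W a` and `W b` leaves two cases: either visiting `W a` forces a visit to `W b`,
or reaching `W b` from `W i` requires passing through `W a`. -/
theorem pullBack_total {i a b : ℕ} (hi : 1 ≤ i) (hia : i < a) (hab : a ≤ b) (hb : b ≤ N) :
    pullBack f m W i a ∩ W i ⊆ pullBack f m W i b ∩ W i ∨
      pullBack f m W i b ∩ W i ⊆ pullBack f m W i a ∩ W i := by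
  rcases hab.eq_or_lt with rfl | hab
  · exact Or.inl subset_rfl
  rcases h.nesting a b (by lia) hab hb with hsub | hfr
  · refine Or.inl fun x hx => ⟨?_, hx.2⟩
    have h1 := hsub hx.1
    rw [pullBack, mem_preimage, h.iterate_sub (Finset.mem_Icc.2 (by lia))
      (Finset.mem_Icc.2 (by lia)) (Finset.mem_Icc.2 (by lia)) hia.le hab.le] at h1
    exact h1
  · exact Or.inr fun x hx => ⟨h.pullBack_inter_subset hi hia hab hb hfr hx, hx.2⟩

end OrbitBalls

theorem exists_forall_subset_of_total {ι α : Type*} {s : Finset ι} (hs : s.Nonempty)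
    {D : ι → Set α} (htot : ∀ a ∈ s, ∀ b ∈ s, D a ⊆ D b ∨ D b ⊆ D a) :
    ∃ a ∈ s, ∀ b ∈ s, D b ⊆ D a := by
  obtain ⟨a, ha, hmax⟩ := s.exists_maximalFor D hs
  refine ⟨a, ha, fun b hb => ?_⟩
  rcases htot a ha b hb with h | h
  · exact hmax hb h
  · exact h

open Classical in
/-- The next row of indices. -/
noncomputable def nextRow (f : X → X) (m : ℕ → ℕ) (N : ℕ) (W : ℕ → Set X) (k : ℕ) (r : ℕ → ℕ)
    (i : ℕ) : ℕ :=
  if hl : i ∈ indexSet f m N W (fun l _ => r l) k ∧ ∃ l ∈ Finset.Icc (i + 1) (N - k),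
      pullUnion f m N W (fun l _ => r l) i k ∩ W i = pullBack f m W i (r l) ∩ W i
  then r hl.2.choose else i

/-- The rows of indices. -/
noncomputable def indexRow (f : X → X) (m : ℕ → ℕ) (N : ℕ) (W : ℕ → Set X) : ℕ → ℕ → ℕ
  | 0 => fun i => i
  | k + 1 => nextRow f m N W k (indexRow f m N W k)

theorem indexRow_bounds (k : ℕ) : ∀ l ∈ Finset.Icc 1 (N - k),
    l ≤ indexRow f m N W k l ∧ indexRow f m N W k l ≤ N := by
  induction k with
  | zero => exact fun l hl => ⟨le_rfl, (Finset.mem_Icc.1 hl).2⟩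
  | succ k ih =>
    intro i hi
    have hi1 := Finset.mem_Icc.1 hi
    rw [indexRow, nextRow]
    split_ifs with hl
    · have h1 := Finset.mem_Icc.1 hl.2.choose_spec.1
      have h2 := ih hl.2.choose (Finset.mem_Icc.2 (by lia))
      exact ⟨by lia, h2.2⟩
    · exact ⟨le_rfl, by lia⟩

/-- The finitely many pull-backs inside `W i` form a chain, so their union is its largest member.
Row `k + 1` depends only on row `k`, so the rows can be built recursively. -/
theorem OrbitBalls.exists_isIndexChoice (h : OrbitBalls f ζ m N W) :
    ∃ j : ℕ → ℕ → ℕ, IsIndexChoice f m N W j := by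
  refine ⟨fun i k => indexRow f m N W k i, ⟨fun i _ => rfl, fun k i hi => ?_, fun k i hi hiI => ?_⟩⟩
  · have hi1 := Finset.mem_Icc.1 (Finset.mem_filter.1 hi).1
    have hex : ∃ l ∈ Finset.Icc (i + 1) (N - k),
        pullUnion f m N W (fun l _ => indexRow f m N W k l) i k ∩ W i =
          pullBack f m W i (indexRow f m N W k l) ∩ W i := by
      obtain ⟨a, ha, hmax⟩ := exists_forall_subset_of_total
        (s := Finset.Icc (i + 1) (N - k)) (Finset.nonempty_Icc.2 (by lia))
        (D := fun l => pullBack f m W i (indexRow f m N W k l) ∩ W i) fun a ha b hb => by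
          have ha1 := Finset.mem_Icc.1 ha
          have hb1 := Finset.mem_Icc.1 hb
          have hra := indexRow_bounds (f := f) (m := m) (N := N) (W := W) k a
            (Finset.mem_Icc.2 (by lia))
          have hrb := indexRow_bounds (f := f) (m := m) (N := N) (W := W) k b
            (Finset.mem_Icc.2 (by lia))
          rcases le_total (indexRow f m N W k a) (indexRow f m N W k b) with hle | hle
          · exact h.pullBack_total hi1.1 (by lia) hle hrb.2
          · exact (h.pullBack_total hi1.1 (by lia) hle hra.2).symm
      refine ⟨a, ha, Subset.antisymm ?_ ?_⟩
      · rintro x ⟨hx, hxi⟩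
        simp only [pullUnion, mem_iUnion, exists_prop] at hx
        obtain ⟨b, hb, hxb⟩ := hx
        exact hmax b hb ⟨hxb, hxi⟩
      · exact inter_subset_inter_left _ fun x hx => mem_biUnion (Finset.mem_coe.2 ha) hx
    have hl : i ∈ indexSet f m N W (fun l _ => indexRow f m N W k l) k ∧
        ∃ l ∈ Finset.Icc (i + 1) (N - k),
          pullUnion f m N W (fun l _ => indexRow f m N W k l) i k ∩ W i =
            pullBack f m W i (indexRow f m N W k l) ∩ W i := ⟨hi, hex⟩
    have e : indexRow f m N W (k + 1) i = indexRow f m N W k hl.2.choose := by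
      rw [indexRow, nextRow, dif_pos hl]
    exact ⟨⟨_, hl.2.choose_spec.1, e⟩, by rw [e]; exact hl.2.choose_spec.2⟩
  · rw [indexRow, nextRow, dif_neg]
    exact fun hl => hiI hl.1

theorem OrbitBalls.clusterSet_eq_empty (h : OrbitBalls f ζ m N W) {k : ℕ} (hk : N ≤ k) :
    clusterSet f (⋃ j ∈ Finset.Icc 1 N, W j) (m N - m 1) k = ∅ := by
  rw [clusterSet_eq_iUnion_atLeast]
  simp only [iUnion_eq_empty, Finset.mem_Icc]
  intro i hi
  rw [h.atLeast_eq_empty k hi.1 hi.2 (by lia), empty_sdiff]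

section Measure

variable [MeasurableSpace X] [OpensMeasurableSpace X] {μ : Measure X} [IsFiniteMeasure μ]

theorem OrbitBalls.measureReal_clusterSet (h : OrbitBalls f ζ m N W) (hf : Measurable f) (k : ℕ) :
    μ.real (clusterSet f (⋃ j ∈ Finset.Icc 1 N, W j) (m N - m 1) k) =
      ∑ i ∈ Finset.Icc 1 N,
        (μ.real (atLeast f m N W i k) - μ.real (atLeast f m N W i (k + 1))) := by
  have hU : MeasurableSet (⋃ j ∈ Finset.Icc 1 N, W j) :=
    Finset.measurableSet_biUnion _ fun i _ => (h.isOpen i).measurableSet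
  have hm : ∀ i k, MeasurableSet (atLeast f m N W i k) := fun i k =>
    (h.isOpen i).measurableSet.inter (measurable_visits hf hU _ _ measurableSet_Ici)
  rw [clusterSet_eq_iUnion_atLeast, measureReal_biUnion_finset]
  · refine Finset.sum_congr rfl fun i _ => measureReal_sdiff (fun x hx => ⟨hx.1, ?_⟩) (hm _ _)
    exact (Nat.le_succ k).trans hx.2
  · intro i hi j hj hij
    exact (h.disjoint hi hj hij).mono (fun x hx => hx.1.1) fun x hx => hx.1.1
  · exact fun i _ => (hm i k).diff (hm i _)

theorem OrbitBalls.measureReal_clusterSet_eq (h : OrbitBalls f ζ m N W) (hf : Measurable f)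
    {j : ℕ → ℕ → ℕ} (hj : IsIndexChoice f m N W j) {k : ℕ} (hk : k < N) :
    μ.real (clusterSet f (⋃ j ∈ Finset.Icc 1 N, W j) (m N - m 1) k) =
      μ.real (pullBack f m W (N - k) (j (N - k) k) ∩ W (N - k)) +
        ∑ i ∈ indexSet f m N W j k,
          (μ.real (pullBack f m W i (j i k) ∩ W i) -
            μ.real (pullBack f m W i (j i (k + 1)) ∩ W i)) := by
  have hspec := h.indexChoice_spec hj
  rw [h.measureReal_clusterSet hf]
  set F : ℕ → ℝ := fun i =>
    μ.real (atLeast f m N W i k) - μ.real (atLeast f m N W i (k + 1)) with hF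
  have h1 : ∑ i ∈ Finset.Icc 1 N, F i = ∑ i ∈ Finset.Icc 1 (N - k), F i := by
    refine (Finset.sum_subset (Finset.Icc_subset_Icc_right (Nat.sub_le _ _)) fun i hi hi' => ?_).symm
    have hi1 := Finset.mem_Icc.1 hi
    rw [Finset.mem_Icc] at hi'
    rw [hF]
    dsimp only
    rw [h.atLeast_eq_empty k hi1.1 hi1.2 (by lia),
      h.atLeast_eq_empty (k + 1) hi1.1 hi1.2 (by lia), sub_self]
  have h2 : ∑ i ∈ Finset.Icc 1 (N - k), F i =
      ∑ i ∈ Finset.Icc 1 (N - (k + 1)), F i + F (N - k) := by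
    have e : N - k = N - (k + 1) + 1 := by lia
    rw [e, Finset.sum_Icc_succ_top (by lia)]
  have h3 : F (N - k) = μ.real (pullBack f m W (N - k) (j (N - k) k) ∩ W (N - k)) := by
    rw [hF]
    dsimp only
    rw [h.atLeast_eq_empty (k + 1) (by lia) (by lia) (by lia), measureReal_empty, sub_zero,
      (hspec k (N - k) (Finset.mem_Icc.2 (by lia))).2.2.1]
  -- For `i ∉ I_{k+1}` every point of `W i` has at least `k + 1` later visits, so the difference
  -- vanishes.
  have h4 : ∑ i ∈ Finset.Icc 1 (N - (k + 1)), F i = ∑ i ∈ indexSet f m N W j k, F i := by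
    refine (Finset.sum_subset (Finset.filter_subset _ _) fun i hi hiI => ?_).symm
    have e1 := h.atLeast_eq_of_notMem_indexSet (hspec k) hi hiI
    have e2 : atLeast f m N W i k = W i :=
      Subset.antisymm (fun x hx => hx.1) fun x hx => by
        rw [← e1] at hx
        exact ⟨hx.1, (Nat.le_succ k).trans hx.2⟩
    rw [hF]
    dsimp only
    rw [e1, e2, sub_self]
  rw [h1, h2, h3, h4, add_comm]
  congr 1
  refine Finset.sum_congr rfl fun i hi => ?_
  have hi1 := Finset.mem_filter.1 hi
  have hi2 := Finset.mem_Icc.1 hi1.1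
  rw [hF]
  dsimp only
  rw [(hspec k i (Finset.mem_Icc.2 (by lia))).2.2.1, (hspec (k + 1) i hi1.1).2.2.1]

end Measure

end OrbitBalls


/-! ### Small balls along an orbit -/

section SmallBalls

variable {X : Type*} {f : X → X} {ζ : X}

theorem eq_of_iterate_eq {a b : ℕ} (hb : f^[b] ζ ∉ Function.periodicPts f)
    (hab : f^[a] ζ = f^[b] ζ) : a = b := by
  by_contra hne
  refine hb ?_
  rcases lt_or_gt_of_ne hne with hlt | hlt
  · refine ⟨b - a, by lia, ?_⟩
    rw [Function.IsPeriodicPt, Function.IsFixedPt]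
    nth_rewrite 1 [← hab]
    rw [← Function.iterate_add_apply, Nat.sub_add_cancel hlt.le]
  · refine ⟨a - b, by lia, ?_⟩
    rw [Function.IsPeriodicPt, Function.IsFixedPt, ← Function.iterate_add_apply,
      Nat.sub_add_cancel hlt.le, hab]

variable [TopologicalSpace X]

theorem continuousAt_iterate_orbit (hcont : ∀ s : ℕ, ContinuousAt f (f^[s] ζ)) (s a : ℕ) :
    ContinuousAt f^[s] (f^[a] ζ) := by
  induction s with
  | zero => exact continuousAt_id
  | succ s ih =>
    rw [Function.iterate_succ']
    refine ContinuousAt.comp ?_ ih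
    rw [← Function.iterate_add_apply]
    exact hcont _

theorem eventually_continuousAt_iterate (hcont : ∀ s : ℕ, ContinuousAt f (f^[s] ζ)) {a b : ℕ}
    (hcont' : ∀ s : ℕ, a ≤ s → s < b → ∀ᶠ y in 𝓝 (f^[s] ζ), ContinuousAt f y) {c s : ℕ}
    (hac : a ≤ c) (hcs : s + c ≤ b) : ∀ᶠ y in 𝓝 (f^[c] ζ), ContinuousAt f^[s] y := by
  induction s with
  | zero => exact Eventually.of_forall fun y => continuousAt_id
  | succ s ih =>
    have h1 : Tendsto f^[s] (𝓝 (f^[c] ζ)) (𝓝 (f^[s + c] ζ)) := by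
      rw [Function.iterate_add_apply]
      exact continuousAt_iterate_orbit hcont s c
    filter_upwards [ih (by lia), h1.eventually (hcont' (s + c) (by lia) (by lia))] with y hy1 hy2
    rw [Function.iterate_succ']
    exact ContinuousAt.comp hy2 hy1

variable {N : ℕ} {m : ℕ → ℕ} {W : ℕ → ℕ → Set X}

/-- If `m j ≠ s + m i`, nonperiodicity makes `f^[s] ξ_i` and `ξ_j` distinct. Disjoint neighbourhoods
and continuity of `f^[s]` at `ξ_i` then rule out the passage for small sets, and only finitely many
triples `(i, j, s)` occur. -/
theorem eventually_return_time [T2Space X] (hcont : ∀ s : ℕ, ContinuousAt f (f^[s] ζ))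
    (hnonper : ∀ i ∈ Finset.Icc 1 N, f^[m i] ζ ∉ Function.periodicPts f)
    (hsmall : ∀ i ∈ Finset.Icc 1 N, ∀ V ∈ 𝓝 (f^[m i] ζ), ∀ᶠ n in atTop, W n i ⊆ V) (M : ℕ) :
    ∀ᶠ n in atTop, ∀ i ∈ Finset.Icc 1 N, ∀ j ∈ Finset.Icc 1 N, ∀ s ≤ M, ∀ x ∈ W n i,
      f^[s] x ∈ W n j → m j = s + m i := by
  have key : ∀ i ∈ Finset.Icc 1 N, ∀ j ∈ Finset.Icc 1 N, ∀ s ∈ Finset.range (M + 1),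
      ∀ᶠ n in atTop, ∀ x ∈ W n i, f^[s] x ∈ W n j → m j = s + m i := by
    intro i hi j hj s _
    by_cases hs : m j = s + m i
    · exact Eventually.of_forall fun _ _ _ _ => hs
    · have hne : f^[s] (f^[m i] ζ) ≠ f^[m j] ζ := fun heq => hs
        (eq_of_iterate_eq (hnonper j hj) (by rwa [Function.iterate_add_apply])).symm
      obtain ⟨V, V', hV, hV', hdisj⟩ := t2_separation_nhds hne
      filter_upwards [hsmall i hi _ (continuousAt_iterate_orbit hcont s (m i) hV),
        hsmall j hj _ hV'] with n h1 h2 x hx hx'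
      exact (Set.disjoint_left.1 hdisj (h1 hx) (h2 hx')).elim
  have h1 : ∀ᶠ n in atTop, ∀ i ∈ Finset.Icc 1 N, ∀ j ∈ Finset.Icc 1 N, ∀ s ∈ Finset.range (M + 1),
      ∀ x ∈ W n i, f^[s] x ∈ W n j → m j = s + m i := by
    simp only [Filter.eventually_all_finset]
    exact key
  filter_upwards [h1] with n hn i hi j hj s hs
  exact hn i hi j hj s (Finset.mem_range.2 (by lia))

theorem eventually_continuousOn_iterate (hcont : ∀ s : ℕ, ContinuousAt f (f^[s] ζ))
    (hcont' : ∀ s : ℕ, m 1 ≤ s → s < m N → ∀ᶠ y in 𝓝 (f^[s] ζ), ContinuousAt f y)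
    (hm : StrictMonoOn m (Set.Icc 1 N))
    (hsmall : ∀ i ∈ Finset.Icc 1 N, ∀ V ∈ 𝓝 (f^[m i] ζ), ∀ᶠ n in atTop, W n i ⊆ V) :
    ∀ᶠ n in atTop, ∀ i j, 1 ≤ i → i < j → j ≤ N → ContinuousOn f^[m j - m i] (W n i) := by
  have h1 : ∀ᶠ n in atTop, ∀ i ∈ Finset.Icc 1 N, ∀ j ∈ Finset.Icc 1 N,
      i < j → ContinuousOn f^[m j - m i] (W n i) := by
    simp only [Filter.eventually_all_finset]
    intro i hi j hj
    by_cases hij : i < j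
    · have hi1 := Finset.mem_Icc.1 hi
      have hj1 := Finset.mem_Icc.1 hj
      have hle1 : m 1 ≤ m i := hm.monotoneOn (by simp; lia) (by simp; lia) hi1.1
      have hle2 : m j ≤ m N := hm.monotoneOn (by simp; lia) (by simp; lia) hj1.2
      have hle3 : m i ≤ m j := hm.monotoneOn (by simp; lia) (by simp; lia) hij.le
      filter_upwards [hsmall i hi _ (eventually_continuousAt_iterate hcont hcont'
        (s := m j - m i) hle1 (by lia))] with n hn _
      exact fun y hy => (show ContinuousAt _ _ from hn hy).continuousWithinAt
    · exact Eventually.of_forall fun _ h => absurd h hij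
  filter_upwards [h1] with n hn i j hi hij hj
  exact hn i (Finset.mem_Icc.2 (by lia)) j (Finset.mem_Icc.2 (by lia)) hij

end SmallBalls

/-! ### Cluster sizes and decay of correlations -/

section Sizes

variable {X : Type*} [MeasurableSpace X] {μ : Measure X} [IsProbabilityMeasure μ] {f : X → X}

/-- Apply the decay to an element of `C₁` representing the indicator of the cluster set and to `ψ =
1_E`, whose `L¹` norm is `μ.real E`. The rate is `K * |ρ s|`, with an absolute value because `ρ`
carries no sign condition. -/
theorem AssumptionA.eventually_clusterDecay {C₁ : Type*} [NormedAddCommGroup C₁] [NormedSpace ℝ C₁]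
    {toFun : C₁ →ₗ[ℝ] (X → ℝ)} {A : ℕ → ℕ → Set X} (hA : AssumptionA f μ toFun A)
    (hf : MeasurePreserving f μ μ) {U : ℕ → Set X} {q : ℕ} (hU : ∀ n, MeasurableSet (U n))
    (hAU : ∀ᶠ n in atTop, ∀ κ, A n κ = clusterSet f (U n) q κ) :
    ∃ r : ℕ → ℝ, (∀ s, 0 ≤ r s) ∧ Summable r ∧ ∀ᶠ n in atTop, ClusterDecay μ f (U n) q r := by
  obtain ⟨ρ, hρ, hdec⟩ := hA.decay
  obtain ⟨K, hK, hind⟩ := hA.indicator_bound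
  refine ⟨fun s => K * |ρ s|, fun s => by positivity, hρ.abs.mul_left K, ?_⟩
  filter_upwards [hAU, hind] with n hn hindn κ E hE s hs
  obtain ⟨g, hg, hgK⟩ := hindn κ
  rw [hn κ] at hg
  have hAm := measurableSet_clusterSet hf.measurable (hU n) q κ
  have hEm : MeasurableSet (f^[s] ⁻¹' E) := hf.measurable.iterate s hE
  obtain ⟨-, h1⟩ := hdec g (E.indicator 1) ((integrable_const 1).indicator hE) s hs
  have e1 : ∫ x, toFun g x * E.indicator 1 (f^[s] x) ∂μ =
      μ.real (clusterSet f (U n) q κ ∩ f^[s] ⁻¹' E) := by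
    rw [← integral_indicator_one (hAm.inter hEm)]
    refine integral_congr_ae ?_
    filter_upwards [hg] with x hx
    rw [hx, inter_indicator_one]
    rfl
  have e2 : ∫ x, toFun g x ∂μ = μ.real (clusterSet f (U n) q κ) := by
    rw [integral_congr_ae hg, integral_indicator_one hAm]
  have e3 : ∫ x, |E.indicator (1 : X → ℝ) x| ∂μ = μ.real E := by
    rw [← integral_indicator_one hE]
    refine integral_congr_ae (Eventually.of_forall fun x => ?_)
    exact abs_of_nonneg (indicator_nonneg (fun _ _ => zero_le_one) x)
  rw [e1, e2, e3, integral_indicator_one hE] at h1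
  refine h1.trans ?_
  calc ‖g‖ * μ.real E * ρ s ≤ ‖g‖ * μ.real E * |ρ s| :=
        mul_le_mul_of_nonneg_left (le_abs_self _) (by positivity)
    _ ≤ K * μ.real E * |ρ s| := by gcongr
    _ = μ.real E * (K * |ρ s|) := by ring

/-- Convergence of the relative measures of the cluster sets determines the cluster size
distribution and the extremal index. -/
theorem exists_index_of_tendsto_sizes {a : ℕ → ℕ → ℝ} {δ : ℕ → ℝ} {N : ℕ} {π : ℕ → ℝ}
    (hanti : ∀ᶠ n in atTop, Antitone (a n)) (ha0 : ∀ n k, 0 ≤ a n k)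
    (hzero : ∀ᶠ n in atTop, ∀ k, N ≤ k → a n k = 0) (hδ : ∀ᶠ n in atTop, 0 < δ n)
    (hsum : ∀ᶠ n in atTop, ∑ k ∈ Finset.range N, a n k = δ n)
    (hlim : ∀ k, Tendsto (fun n => (a n k - a n (k + 1)) / a n 0) atTop (𝓝 (π (k + 1)))) :
    ∃ (θ : {r : ℝ // 0 < r}) (p : PMF ℕ), p 0 = 0 ∧ (∀ k, 1 ≤ k → (p k).toReal = π k) ∧
      Tendsto (fun n => a n 0 / δ n) atTop (𝓝 (θ : ℝ)) := by
  have hpos : ∀ᶠ n in atTop, 0 < a n 0 := by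
    filter_upwards [hanti, hδ, hsum] with n h1 h2 h3
    by_contra hc
    have h4 : ∀ k ∈ Finset.range N, a n k ≤ 0 := fun k _ => (h1 (Nat.zero_le k)).trans (not_lt.1 hc)
    have h5 := Finset.sum_nonpos h4
    linarith
  have hπ0 : ∀ k, 0 ≤ π (k + 1) := fun k => by
    refine ge_of_tendsto (hlim k) ?_
    filter_upwards [hanti, hpos] with n h1 h2
    exact div_nonneg (sub_nonneg.2 (h1 (Nat.le_succ k))) h2.le
  have hπN : ∀ k, N ≤ k → π (k + 1) = 0 := fun k hk => by
    refine tendsto_nhds_unique (hlim k) (tendsto_const_nhds.congr' ?_)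
    filter_upwards [hzero] with n hn
    rw [hn k hk, hn (k + 1) (by lia), sub_self, zero_div]
  have hratio : ∀ k, Tendsto (fun n => a n k / a n 0) atTop
      (𝓝 (1 - ∑ i ∈ Finset.range k, π (i + 1))) := fun k => by
    refine (tendsto_const_nhds.sub (tendsto_finsetSum (Finset.range k) fun i _ => hlim i)).congr' ?_
    filter_upwards [hpos] with n hn
    rw [← Finset.sum_div, Finset.sum_range_sub' (a n) k, sub_div, div_self hn.ne']
    ring
  have hπsum : ∑ i ∈ Finset.range N, π (i + 1) = 1 := by
    have h1 := tendsto_nhds_unique (hratio N) (tendsto_const_nhds.congr' (by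
      filter_upwards [hzero] with n hn
      rw [hn N le_rfl, zero_div] : (fun _ : ℕ => (0 : ℝ)) =ᶠ[atTop] fun n => a n N / a n 0))
    linarith
  -- The limit is the sum over `k` of the tails of `π`, that is, the mean cluster size; `θ` is its
  -- inverse.
  have hinv : Tendsto (fun n => δ n / a n 0) atTop
      (𝓝 (∑ k ∈ Finset.range N, (1 - ∑ i ∈ Finset.range k, π (i + 1)))) := by
    refine (tendsto_finsetSum (Finset.range N) fun k _ => hratio k).congr' ?_
    filter_upwards [hsum] with n hn
    rw [← Finset.sum_div, hn]
  set S := ∑ k ∈ Finset.range N, (1 - ∑ i ∈ Finset.range k, π (i + 1)) with hS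
  -- The term `a n 0` is one of the nonnegative summands of `δ n`, so the ratio is at least `1`.
  have hS1 : 1 ≤ S := by
    refine ge_of_tendsto hinv ?_
    filter_upwards [hpos, hsum, hδ] with n h1 h2 h3
    rw [le_div_iff₀ h1, one_mul, ← h2]
    refine Finset.single_le_sum (f := a n) (fun k _ => ha0 n k) (Finset.mem_range.2 ?_)
    by_contra hN
    have : N = 0 := by lia
    rw [this, Finset.sum_range_zero] at h2
    exact h3.ne h2
  have hpsum : ∑ k ∈ Finset.range (N + 1), (if k = 0 then 0 else ENNReal.ofReal (π k)) = 1 := by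
    rw [Finset.sum_range_succ']
    simp only [Nat.add_one_ne_zero, if_false, if_true, add_zero]
    rw [← ENNReal.ofReal_sum_of_nonneg fun i _ => hπ0 i, hπsum, ENNReal.ofReal_one]
  have hpout : ∀ k ∉ Finset.range (N + 1), (if k = 0 then 0 else ENNReal.ofReal (π k)) = 0 := by
    intro k hk
    rw [Finset.mem_range, not_lt] at hk
    obtain ⟨k, rfl⟩ : ∃ k', k = k' + 1 := ⟨k - 1, by lia⟩
    rw [if_neg (by lia), hπN k (by lia), ENNReal.ofReal_zero]
  refine ⟨⟨S⁻¹, by positivity⟩, PMF.ofFinset _ _ hpsum hpout, by simp, fun k hk => ?_, ?_⟩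
  · obtain ⟨k, rfl⟩ : ∃ k', k = k' + 1 := ⟨k - 1, by lia⟩
    rw [PMF.ofFinset_apply, if_neg (by lia), ENNReal.toReal_ofReal (hπ0 k)]
  · refine (hinv.inv₀ (by linarith)).congr fun n => ?_
    rw [inv_div]

end Sizes

end ClusterREPP

/-! ### Assembly of the two statements. -/

theorem mainTheorem3
    {X : Type*} [MetricSpace X] [MeasurableSpace X] [BorelSpace X]
    (μ : Measure X) [IsProbabilityMeasure μ]
    (f : X → X) (hf : MeasurePreserving f μ μ)
    (φ : X → EReal) (hφ : Measurable φ)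
    -- the maximal points `ξ_i = f^{m_i}(ζ)`, `1 ≤ i ≤ N`
    (uF : EReal) (ζ : X) (N : ℕ) (hN : 1 ≤ N) (m : ℕ → ℕ)
    (hm : StrictMonoOn m (Set.Icc 1 N))
    (ε : ℕ → ℝ → ℝ) (hmax : HasOrbitMaxima f φ uF ζ N m ε)
    (hnonper : ∀ i ∈ Finset.Icc 1 N, f^[m i] ζ ∉ Function.periodicPts f)
    -- continuity of `f` along the orbit, and near the segment that joins the maximal points
    (hcont : ∀ s : ℕ, ContinuousAt f (f^[s] ζ))
    (hcont' : ∀ s : ℕ, m 1 ≤ s → s < m N → ∀ᶠ y in 𝓝 (f^[s] ζ), ContinuousAt f y)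
    -- the levels `u_n`
    (u : ℕ → ℝ) (hu : Tendsto (fun n => (u n : EReal)) atTop (𝓝[<] uF))
    (τ : ℝ) (hτ : 0 < τ)
    (huτ : Tendsto (fun n : ℕ => (n : ℝ) * μ.real (exceedSet φ (u n))) atTop (𝓝 τ))
    -- summable decay of correlations against `L¹`
    {C₁ : Type*} [NormedAddCommGroup C₁] [NormedSpace ℝ C₁] [CompleteSpace C₁]
    (toFun : C₁ →ₗ[ℝ] (X → ℝ))
    (hA : AssumptionA f μ toFun (fun n κ => nestedA f φ (m N - m 1) (u n) κ))
    -- the balls `U_n(ξ_i)` and the nesting condition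
    (W : ℕ → ℕ → Set X) (hW : ∀ n i, W n i = Metric.ball (f^[m i] ζ) (ε i (u n)))
    (hR3 : ∀ᶠ n in atTop, NestingCondition f m N (W n))
    (hpiece : ∀ᶠ n in atTop, SinglePiece f m N (W n)) :
    -- the measures of the sets `A^(k)_{q,n}`, with `q = m_N - m_1`
    (∀ᶠ n in atTop,
      (∃ j : ℕ → ℕ → ℕ, IsIndexChoice f m N (W n) j) ∧
      (∀ j : ℕ → ℕ → ℕ, IsIndexChoice f m N (W n) j → ∀ k < N,
        μ.real (nestedA f φ (m N - m 1) (u n) k) =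
          μ.real (pullBack f m (W n) (N - k) (j (N - k) k) ∩ W n (N - k)) +
          ∑ i ∈ indexSet f m N (W n) j k,
            (μ.real (pullBack f m (W n) i (j i k) ∩ W n i) -
              μ.real (pullBack f m (W n) i (j i (k + 1)) ∩ W n i))) ∧
      (∀ k, N ≤ k → μ (nestedA f φ (m N - m 1) (u n) k) = 0)) ∧
    -- convergence of the rare event point processes
    (∀ π : ℕ → ℝ,
      (∀ k, 1 ≤ k → Tendsto (fun n =>
        (μ.real (nestedA f φ (m N - m 1) (u n) (k - 1)) -
          μ.real (nestedA f φ (m N - m 1) (u n) k)) /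
            μ.real (nestedA f φ (m N - m 1) (u n) 0)) atTop (𝓝 (π k))) →
      ∃ (θ : {r : ℝ // 0 < r}) (p : PMF ℕ),
        p 0 = 0 ∧ (∀ k, 1 ≤ k → (p k).toReal = π k) ∧
        Tendsto (fun n => μ.real (nestedA f φ (m N - m 1) (u n) 0) /
          μ.real (exceedSet φ (u n))) atTop (𝓝 (θ : ℝ)) ∧
        TendstoInDistribution (fun n => repp μ f φ (u n)) atTop compoundPoisson
          (fun _ => μ) (compoundPoissonSpace θ p)) := by
  have hU : ∀ n, MeasurableSet (exceedSet φ (u n)) := fun n =>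
    measurableSet_lt measurable_const hφ
  have hlev : Tendsto u atTop (levelsToMax uF) := tendsto_comap_iff.2 hu
  have hrad : ∀ i ∈ Finset.Icc 1 N, Tendsto (fun n => ε i (u n)) atTop (𝓝[>] 0) := fun i hi =>
    (hmax.radius_tendsto i hi).comp hlev
  have hsmall : ∀ i ∈ Finset.Icc 1 N, ∀ V ∈ 𝓝 (f^[m i] ζ), ∀ᶠ n in atTop, W n i ⊆ V := by
    intro i hi V hV
    obtain ⟨r, hr, hball⟩ := Metric.mem_nhds_iff.1 hV
    filter_upwards [((hrad i hi).mono_right nhdsWithin_le_nhds).eventually (gt_mem_nhds hr)]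
      with n hn
    rw [hW]
    exact (Metric.ball_subset_ball hn.le).trans hball
  have hret := eventually_return_time hcont hnonper hsmall
  have hpos : ∀ᶠ n in atTop, ∀ i ∈ Finset.Icc 1 N, 0 < ε i (u n) := by
    rw [Filter.eventually_all_finset]
    exact fun i hi => hrad i hi self_mem_nhdsWithin
  have hUW : ∀ᶠ n in atTop, exceedSet φ (u n) = ⋃ i ∈ Finset.Icc 1 N, W n i := by
    filter_upwards [hlev.eventually hmax.exceedSet_eq] with n hn
    simp only [hn, hW]
  have hballs : ∀ᶠ n in atTop, OrbitBalls f ζ m N (W n) := by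
    filter_upwards [hret (2 * (m N - m 1)), hpos, hR3, hpiece,
      eventually_continuousOn_iterate hcont hcont' hm hsmall] with n h1 h2 h3 h4 h5
    exact ⟨hm, fun i => by rw [hW]; exact Metric.isOpen_ball,
      fun i hi => by rw [hW]; exact Metric.mem_ball_self (h2 i hi), h1, h5, h3, h4⟩
  have hnested : ∀ᶠ n in atTop, ∀ κ, nestedA f φ (m N - m 1) (u n) κ =
      clusterSet f (exceedSet φ (u n)) (m N - m 1) κ := by
    filter_upwards [hballs, hUW] with n h1 h2 κ
    exact nestedA_eq φ (u n) (h2 ▸ h1.gapAfter) κ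
  refine ⟨?_, fun π hπ => ?_⟩
  · filter_upwards [hballs, hUW, hnested] with n h1 h2 h3
    refine ⟨h1.exists_isIndexChoice, fun j hj k hk => ?_, fun k hk => ?_⟩
    · rw [h3, h2]
      exact h1.measureReal_clusterSet_eq hf.measurable hj hk
    · rw [h3, h2, h1.clusterSet_eq_empty hk, measure_empty]
  · set U : ℕ → Set X := fun n => exceedSet φ (u n)
    set a : ℕ → ℕ → ℝ := fun n κ => μ.real (clusterSet f (U n) (m N - m 1) κ)
    -- Since `n * μ.real (U n)` tends to `τ > 0`, the measures tend to `0` and are eventually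
    -- positive.
    have hδ : Tendsto (fun n => μ.real (U n)) atTop (𝓝[>] 0) := by
      refine tendsto_nhdsWithin_iff.2 ⟨?_, ?_⟩
      · have h1 := huτ.mul tendsto_inv_atTop_nhds_zero_nat
        rw [mul_zero] at h1
        refine h1.congr' ?_
        filter_upwards [eventually_gt_atTop 0] with n hn
        have : (n : ℝ) ≠ 0 := by exact_mod_cast hn.ne'
        field_simp
        rfl
      · filter_upwards [huτ.eventually (lt_mem_nhds hτ)] with n hn
        exact pos_of_mul_pos_right hn (Nat.cast_nonneg n)
    have hsum : ∀ᶠ n in atTop, ∑ k ∈ Finset.range N, a n k = μ.real (U n) := by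
      filter_upwards [hballs, hUW] with n h1 h2
      rw [← measureReal_biUnion_finset (fun k _ l _ hkl => disjoint_clusterSet _ hkl)
        fun k _ => measurableSet_clusterSet hf.measurable (hU n) _ k]
      congr 1
      refine Subset.antisymm (iUnion₂_subset fun k _ x hx => hx.1) fun x hx => ?_
      have hx' : x ∈ clusterSet f (U n) (m N - m 1) (visits f (U n) 1 (m N - m 1 + 1) x) :=
        ⟨hx, rfl⟩
      refine mem_biUnion (Finset.mem_coe.2 (Finset.mem_range.2 ?_)) hx'
      by_contra hc
      have h3 : U n = ⋃ i ∈ Finset.Icc 1 N, W n i := h2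
      have h4 := h1.clusterSet_eq_empty (not_lt.1 hc)
      rw [← h3] at h4
      rw [h4] at hx'
      exact hx'
    have hsizes : ∀ k, Tendsto (fun n => (a n k - a n (k + 1)) / a n 0) atTop (𝓝 (π (k + 1))) := by
      intro k
      refine (hπ (k + 1) (by lia)).congr' ?_
      filter_upwards [hnested] with n hn
      simp only [hn, Nat.add_sub_cancel]
      rfl
    obtain ⟨θ, p, hp0, hpπ, hθ⟩ := exists_index_of_tendsto_sizes (a := a)
      (δ := fun n => μ.real (U n)) (N := N) (π := π)
      (by
        filter_upwards [hballs, hUW] with n h1 h2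
        exact antitone_nat_of_succ_le fun k =>
          measureReal_clusterSet_succ_le hf (hU n) (h2 ▸ h1.gapAfter) k)
      (fun n k => measureReal_nonneg)
      (by
        filter_upwards [hballs, hUW] with n h1 h2 k hk
        have h3 : U n = ⋃ i ∈ Finset.Icc 1 N, W n i := h2
        have h4 := h1.clusterSet_eq_empty hk
        rw [← h3] at h4
        change μ.real (clusterSet f (U n) (m N - m 1) k) = 0
        rw [h4, measureReal_empty])
      (hδ self_mem_nhdsWithin) hsum hsizes
    have hrare : RareClusters μ f U (m N - m 1) θ fun j => (p j).toReal :=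
      { pos := θ.2
        measurableSet := hU
        tendsto_measure := hδ
        -- A return between the balls takes time `m j - m i ≤ m N - m 1`. The gap is needed for
        -- every `M`, since the cutoff of the tail of correlations is arbitrary.
        gap := fun M => by
          filter_upwards [hret M, hballs, hUW] with n h1 h2 h3 x hx s hs hsM hfx
          have h4 : U n = ⋃ i ∈ Finset.Icc 1 N, W n i := h3
          rw [h4] at hx hfx
          simp only [mem_iUnion, exists_prop] at hx hfx
          obtain ⟨i, hi, hxi⟩ := hx
          obtain ⟨j, hj, hxj⟩ := hfx
          have h5 := h1 i hi j hj s hsM x hxi hxj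
          have h6 := h2.sub_le hi hj
          lia
        decay := hA.eventually_clusterDecay hf hU hnested
        tendsto_index := hθ
        tendsto_size := fun j => by
          rw [hpπ (j + 1) (by lia)]
          exact hsizes j }
    refine ⟨θ, p, hp0, hpπ, hθ.congr' ?_, hrare.tendstoInDistribution_repp hf hp0⟩
    filter_upwards [hnested] with n hn
    rw [hn]
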